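/- **Setting.** Let $|\psi\rangle$ be a pure state of $n\ge 2$ qubits with one of the qubits singled out as the target, and let $$|\psi\rangle = s\,|u_0\rangle_{\mathrm{target}}\otimes|v_0\rangle_{\mathrm{rest}}+\sqrt{1-s^2}\,|u_1\rangle_{\mathrm{target}}\otimes|v_1\rangle_{\mathrm{rest}}$$ be a Schmidt decomposition of it, where $s\in[0,1]$, $(u_0,u_1)$ is orthonormal in $\mathbb C^2$ and $(v_0,v_1)$ is orthonormal in $\mathbb C^{2^{n-1}}$. Let $\mathcal N[\cdot]=\sum_{i=1}^r K_i(\cdot)K_i^\dagger$ be a single-qubit channel ($\sum_i K_i^\dagger K_i=I$), acting on the target qubit. For a pure state $\phi$ of the $n$ qubits let $E(\phi)=-\mathrm{Tr}(\rho_{\mathrm{target}}\log_2\rho_{\mathrm{target}})$ be the von Neumann entanglement entropy between the target qubit and the rest. Let $\rho=(\mathcal N\otimes\mathcal I)[|\psi\rangle\langle\psi|]$, and let $E_{\mathrm{oF}}(\rho)=\inf\sum_i p_iE(\phi_i)$ be its entanglement of formation, the infimum being over all finite ensembles of normalized pure states with $\rho=\sum_i p_i|\phi_i\rangle\langle\phi_i|$.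 For $R\ge r$ and a unitary $U\in\mathbb U(R)$ put $$K^{U}_{i'}=\sum_{i=1}^{r}U_{i,i'}K_i,\qquad p^U_{i'}=\|(K^U_{i'}\otimes I)\psi\|^2,\qquad E_{\mathrm{av}}(U)=\sum_{i'=1}^{R}p^U_{i'}\,E\Big(\tfrac{1}{\sqrt{p^U_{i'}}}(K^U_{i'}\otimes I)\psi\Big),$$ where terms with $p^U_{i'}=0$ count as $0$. **Theorem.** There is a deterministic algorithm, in the model of a random access machine with exact real arithmetic (unit-cost operations $+,-,\times,\div$, square root, $\cos$, $\arccos$ and comparisons, with rational constants), which on input $s,u_0,u_1$ and $K_1,\dots,K_r$ takes a number of steps bounded by a polynomial in $r$ alone (so independent of $n$ and $\psi$, and constant for bounded $r$) and returns a unitary $U_{\mathrm{opt}}\in\mathbb U(\max(r,4))$ such that $$E_{\mathrm{av}}(U_{\mathrm{opt}})=E_{\mathrm{oF}}(\rho),$$ where the infimum in $E_{\mathrm{oF}}(\rho)$ is attained. In particular $E_{\mathrm{av}}(U_{\mathrm{opt}})\le E_{\mathrm{av}}(U)$ for every $R\ge r$ and every $U\in\mathbb U(R)$: the unraveling given by $U_{\mathrm{opt}}$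 minimizes the ensemble-averaged von Neumann entanglement entropy between the noisy qubit and the rest. -/

import Mathlib

noncomputable section

/-! Pure states of `n` qubits, the bipartition `qubit q : remaining qubits`, and the entanglement
of formation with respect to this bipartition. -/

/-- State vectors of `n` qubits, with the Euclidean norm, in the computational basis. -/
abbrev QState (n : ℕ) : Type := EuclideanSpace ℂ (Fin n → Fin 2)

/-- Computational basis labels of all qubits but `q`. -/
abbrev RestIdx {n : ℕ} (q : Fin n) : Type := {j : Fin n // j ≠ q} → Fin 2

/-- The basis label with value `a` on the qubit `q` and values `y` on the other qubits. -/
def glueIdx {n : ℕ} (q : Fin n) (a : Fin 2) (y : RestIdx q) : Fin n → Fin 2 :=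
  fun j => if h : j = q then a else y ⟨j, h⟩

/-- `|u⟩ ⊗ |v⟩`, where `u` is the factor on the qubit `q`. -/
def tensorAt {n : ℕ} (q : Fin n) (u : EuclideanSpace ℂ (Fin 2))
    (v : EuclideanSpace ℂ (RestIdx q)) : QState n :=
  WithLp.toLp 2 fun x => u (x q) * v (fun j => x j.1)

/-- The operator `K ⊗ I`, with `K` acting on the qubit `q`. -/
def localOp {n : ℕ} (q : Fin n) (K : Matrix (Fin 2) (Fin 2) ℂ) :
    Matrix (Fin n → Fin 2) (Fin n → Fin 2) ℂ :=
  Matrix.of fun x y => if ∀ j, j ≠ q → x j = y j then K (x q) (y q) else 0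

/-- The vector `(K ⊗ I)|ψ⟩`. -/
def applyAt {n : ℕ} (q : Fin n) (K : Matrix (Fin 2) (Fin 2) ℂ) (ψ : QState n) : QState n :=
  WithLp.toLp 2 (Matrix.mulVec (localOp q K) ψ.ofLp)

/-- The operator `|φ⟩⟨φ|`. -/
def ketbra {n : ℕ} (φ : QState n) : Matrix (Fin n → Fin 2) (Fin n → Fin 2) ℂ :=
  Matrix.of fun x y => φ x * star (φ y)

/-- The action of the single-qubit channel with Kraus operators `K i` on the qubit `q`. -/
def channelAt {n r : ℕ} (q : Fin n) (K : Fin r → Matrix (Fin 2) (Fin 2) ℂ)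
    (ρ : Matrix (Fin n → Fin 2) (Fin n → Fin 2) ℂ) :
    Matrix (Fin n → Fin 2) (Fin n → Fin 2) ℂ :=
  ∑ i, localOp q (K i) * ρ * (localOp q (K i)).conjTranspose

/-- Kraus operators of a completely positive trace preserving map. -/
def IsKraus {r : ℕ} (K : Fin r → Matrix (Fin 2) (Fin 2) ℂ) : Prop :=
  ∑ i, (K i).conjTranspose * K i = 1

/-- The reduced state of the qubit `q`: the partial trace of `|φ⟩⟨φ|` over the other qubits. -/
def reducedState {n : ℕ} (q : Fin n) (φ : QState n) : Matrix (Fin 2) (Fin 2) ℂ :=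
  Matrix.of fun a b => ∑ y : RestIdx q, ketbra φ (glueIdx q a y) (glueIdx q b y)

theorem reducedState_isHermitian {n : ℕ} (q : Fin n) (φ : QState n) :
    (reducedState q φ).IsHermitian := by
  ext a b
  simp [reducedState, ketbra, Matrix.conjTranspose_apply, mul_comm]

/-- The von Neumann entanglement entropy `-Tr (ρ_q log₂ ρ_q)` of `φ` between the qubit `q` and
the other qubits, computed from the eigenvalues of the reduced state `ρ_q`
(here `0 * log₂ 0 = 0`). -/
def entEntropy {n : ℕ} (q : Fin n) (φ : QState n) : ℝ :=
  -∑ k, (reducedState_isHermitian q φ).eigenvalues k *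
    Real.logb 2 ((reducedState_isHermitian q φ).eigenvalues k)

/-- `ρ = ∑ i, p i |φ i⟩⟨φ i|` is a convex combination of normalized pure states. -/
def IsEnsemble {n m : ℕ} (p : Fin m → ℝ) (φ : Fin m → QState n)
    (ρ : Matrix (Fin n → Fin 2) (Fin n → Fin 2) ℂ) : Prop :=
  (∀ i, 0 ≤ p i) ∧ ∑ i, p i = 1 ∧ (∀ i, ‖φ i‖ = 1) ∧ ∑ i, (p i : ℂ) • ketbra (φ i) = ρ

/-- The ensemble-averaged entanglement entropy `∑ i, p i * E (φ i)`. -/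
def avgEntropy {n m : ℕ} (q : Fin n) (p : Fin m → ℝ) (φ : Fin m → QState n) : ℝ :=
  ∑ i, p i * entEntropy q (φ i)

/-- The values of the ensemble-averaged entanglement entropy over all finite ensemble
decompositions of `ρ`. -/
def ensembleAverages {n : ℕ} (q : Fin n)
    (ρ : Matrix (Fin n → Fin 2) (Fin n → Fin 2) ℂ) : Set ℝ :=
  {e | ∃ (m : ℕ) (p : Fin m → ℝ) (φ : Fin m → QState n),
    IsEnsemble p φ ρ ∧ e = avgEntropy q p φ}

/-- The entanglement of formation of `ρ` between the qubit `q` and the other qubits. -/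
def entOfFormation {n : ℕ} (q : Fin n)
    (ρ : Matrix (Fin n → Fin 2) (Fin n → Fin 2) ℂ) : ℝ :=
  sInf (ensembleAverages q ρ)

/-! Unravelings. -/

/-- The probability `‖K i |ψ⟩‖²` of the `i`-th trajectory. -/
def trajProb {n m : ℕ} (q : Fin n) (K : Fin m → Matrix (Fin 2) (Fin 2) ℂ) (ψ : QState n)
    (i : Fin m) : ℝ :=
  ‖applyAt q (K i) ψ‖ ^ 2

/-- The `i`-th trajectory `(1 / √p i) K i |ψ⟩` (a trajectory with `p i = 0` does not occur; it
gets the value `0` and does not contribute to averages). -/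
def trajState {n m : ℕ} (q : Fin n) (K : Fin m → Matrix (Fin 2) (Fin 2) ℂ) (ψ : QState n)
    (i : Fin m) : QState n :=
  ((1 / Real.sqrt (trajProb q K ψ i) : ℝ) : ℂ) • applyAt q (K i) ψ

/-- The average entanglement entropy of the unraveling of `ψ` given by the Kraus operators `K`. -/
def unravelingEntropy {n m : ℕ} (q : Fin n) (K : Fin m → Matrix (Fin 2) (Fin 2) ℂ)
    (ψ : QState n) : ℝ :=
  avgEntropy q (trajProb q K ψ) (trajState q K ψ)

/-- The Kraus operators `K' i' = ∑ i, U i i' • K i`, with `i' < R` and `i < r ≤ R`. -/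
def mixKraus {r R : ℕ} (h : r ≤ R) (K : Fin r → Matrix (Fin 2) (Fin 2) ℂ)
    (U : Matrix (Fin R) (Fin R) ℂ) : Fin R → Matrix (Fin 2) (Fin 2) ℂ :=
  fun i' => ∑ i : Fin r, U (Fin.castLE h i) i' • K i

/-! A real random access machine with exact real arithmetic, given by a structured imperative
language with an explicit count of steps. All programs are deterministic and halt. There is no
conversion of real numbers to integers, and real constants are rational. -/

namespace RealRAM

/-- A state: index registers with natural numbers, and memory cells with real numbers. -/
structure State where
  idx : ℕ → ℕ
  mem : ℕ → ℝ

/-- Index expressions. -/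
inductive IExp : Type
  | lit (k : ℕ) : IExp
  | reg (x : ℕ) : IExp
  | add (a b : IExp) : IExp
  | sub (a b : IExp) : IExp
  | mul (a b : IExp) : IExp

def IExp.eval (σ : State) : IExp → ℕ
  | .lit k => k
  | .reg x => σ.idx x
  | .add a b => a.eval σ + b.eval σ
  | .sub a b => a.eval σ - b.eval σ
  | .mul a b => a.eval σ * b.eval σ

/-- The number of operations in an index expression. -/
def IExp.size : IExp → ℕ
  | .lit _ => 1
  | .reg _ => 1
  | .add a b => a.size + b.size + 1
  | .sub a b => a.size + b.size + 1
  | .mul a b => a.size + b.size + 1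

/-- Real expressions; `cell a` reads the memory cell with address `a`. -/
inductive RExp : Type
  | lit (c : ℚ) : RExp
  | cell (a : IExp) : RExp
  | add (e f : RExp) : RExp
  | sub (e f : RExp) : RExp
  | mul (e f : RExp) : RExp
  | div (e f : RExp) : RExp
  | sqrt (e : RExp) : RExp
  | cos (e : RExp) : RExp
  | arccos (e : RExp) : RExp

/-- The operations are total: `x / 0 = 0`, `√x = 0` for `x < 0`, and `arccos` is constant on each
side of `[-1, 1]`. -/
def RExp.eval (σ : State) : RExp → ℝ
  | .lit c => (c : ℝ)
  | .cell a => σ.mem (a.eval σ)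
  | .add e f => e.eval σ + f.eval σ
  | .sub e f => e.eval σ - f.eval σ
  | .mul e f => e.eval σ * f.eval σ
  | .div e f => e.eval σ / f.eval σ
  | .sqrt e => Real.sqrt (e.eval σ)
  | .cos e => Real.cos (e.eval σ)
  | .arccos e => Real.arccos (e.eval σ)

/-- The number of operations in a real expression, address computations included. -/
def RExp.size : RExp → ℕ
  | .lit _ => 1
  | .cell a => a.size + 1
  | .add e f => e.size + f.size + 1
  | .sub e f => e.size + f.size + 1
  | .mul e f => e.size + f.size + 1
  | .div e f => e.size + f.size + 1
  | .sqrt e => e.size + 1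
  | .cos e => e.size + 1
  | .arccos e => e.size + 1

/-- Programs: assignments to index registers and to memory cells, composition, branching on
`a ≤ b` for indices or for reals, and `loop x b c`, which evaluates `b` once and then runs `c`
for `x = 0, …, b - 1`. -/
inductive Prog : Type
  | skip : Prog
  | setIdx (x : ℕ) (e : IExp) : Prog
  | setMem (a : IExp) (e : RExp) : Prog
  | seq (c d : Prog) : Prog
  | ifIdx (a b : IExp) (c d : Prog) : Prog
  | ifReal (a b : RExp) (c d : Prog) : Prog
  | loop (x : ℕ) (b : IExp) (c : Prog) : Prog

def State.setIdx (σ : State) (x k : ℕ) : State := ⟨Function.update σ.idx x k, σ.mem⟩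

def State.setMem (σ : State) (a : ℕ) (v : ℝ) : State := ⟨σ.idx, Function.update σ.mem a v⟩

/-- The state after the iterations `0, …, k - 1` of the loop body `f` with loop register `x`. -/
def iter (f : State → State) (x : ℕ) (σ : State) : ℕ → State
  | 0 => σ
  | k + 1 => f ((iter f x σ k).setIdx x k)

/-- The state in which a program halts. -/
def Prog.run : Prog → State → State
  | .skip, σ => σ
  | .setIdx x e, σ => σ.setIdx x (e.eval σ)
  | .setMem a e, σ => σ.setMem (a.eval σ) (e.eval σ)
  | .seq c d, σ => d.run (c.run σ)
  | .ifIdx a b c d, σ => if a.eval σ ≤ b.eval σ then c.run σ else d.run σ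
  | .ifReal a b c d, σ => if a.eval σ ≤ b.eval σ then c.run σ else d.run σ
  | .loop x b c, σ => iter c.run x σ (b.eval σ)

/-- The number of steps that a program takes. -/
def Prog.steps : Prog → State → ℕ
  | .skip, _ => 1
  | .setIdx _ e, _ => e.size + 1
  | .setMem a e, _ => a.size + e.size + 1
  | .seq c d, σ => c.steps σ + d.steps (c.run σ)
  | .ifIdx a b c d, σ =>
      a.size + b.size + 1 + (if a.eval σ ≤ b.eval σ then c.steps σ else d.steps σ)
  | .ifReal a b c d, σ =>
      a.size + b.size + 1 + (if a.eval σ ≤ b.eval σ then c.steps σ else d.steps σ)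
  | .loop x b c, σ =>
      b.size + 1 +
        ∑ k ∈ Finset.range (b.eval σ), (c.steps ((iter c.run x σ k).setIdx x k) + 1)

/-- The real part (`c = 0`) or the imaginary part (`c = 1`) of a complex number. -/
def part (z : ℂ) (c : Fin 2) : ℝ := if c = 0 then z.re else z.im

/-- The input. Index register `0` holds the number `r` of Kraus operators, all other registers
hold `0`. The memory holds `s` in cell `0`, the entries of `u 0` and `u 1` in the cells
`1, …, 8`, the entries of `K 0, …, K (r - 1)`, row by row, in the cells `9, …, 8 + 8 r`, and `0`
elsewhere; each complex entry takes two cells, first the real part, then the imaginary part. -/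
def input {r : ℕ} (K : Fin r → Matrix (Fin 2) (Fin 2) ℂ) (s : ℝ)
    (u : Fin 2 → EuclideanSpace ℂ (Fin 2)) : State where
  idx x := if x = 0 then r else 0
  mem k :=
    if k = 0 then s
    else if k < 9 then
      part (u (Fin.ofNat 2 ((k - 1) / 4)) (Fin.ofNat 2 ((k - 1) / 2))) (Fin.ofNat 2 (k - 1))
    else if h : (k - 9) / 8 < r then
      part (K ⟨(k - 9) / 8, h⟩ (Fin.ofNat 2 ((k - 9) / 4)) (Fin.ofNat 2 ((k - 9) / 2)))
        (Fin.ofNat 2 (k - 9))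
    else 0

/-- The `R × R` complex matrix that a halting state holds: row by row, from the address in index
register `1` on, each entry by its real part and its imaginary part. -/
def output (R : ℕ) (σ : State) : Matrix (Fin R) (Fin R) ℂ :=
  Matrix.of fun i j =>
    ⟨σ.mem (σ.idx 1 + 2 * (R * i.1 + j.1)), σ.mem (σ.idx 1 + 2 * (R * i.1 + j.1) + 1)⟩

end RealRAM

end

/-! Every vector `(K ⊗ I)ψ` lies in the product of the target with the span of `v 0` and `v 1`, so
it is encoded by the 2 × 2 matrix `K * schmidtMat s u`; the size of the rest drops out, and the
problem is that of a mixed state of two qubits. The entropy of a normalized matrix `M` is a convex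
increasing function of its concurrence `|2 det M|` (`entEntropy_ofMat`, `concEntropy_convexOn`,
`concEntropy_monotoneOn`). Hence, as in Wootters' argument, it suffices to find an ensemble whose
members all have one concurrence `C` that is also a lower bound for the average concurrence of every
ensemble.

The concurrence comes from the symmetric bilinear form `tangleForm`. On four vectors that generate
the state it is a symmetric matrix `τ`, and mixing them by a unitary `V` turns it into `Vᵀ τ V`.
Takagi factorization makes it diagonal with entries `l i ≥ 0`, and `le_sum_norm_of_takagi` bounds
the total concurrence of any ensemble below by `2 l k - ∑ l i`. Either this bound or zero is
attained. If no `l k` exceeds the sum of the others, phases close a polygon with sides `l i`, and a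
Hadamard matrix then makes all concurrences vanish. Otherwise phases `I` on the smaller values give
a real form of trace `C`, and a real rotation equalizes the ratio of tangle to squared norm over the
four vectors. `isLeast_unravelingEntropy` combines the bound with the construction.

For the machine, operators on a qubit form a space of dimension four, so Givens rotations of columns
compress the Kraus family to four operators in quadratic time; everything else has fixed size. The
squares of the Takagi values are roots of a real-rooted quartic, computable from square roots, `cos`
and `arccos`; eigenvectors come from Krylov sequences and exact zero tests. `CompReal` and `Comp`
record that a quantity is so computable, and `exists_evaluates` compiles it into a program with a
constant step bound. -/

open RealRAM

/-! Functions of the memory that a bounded number of machine operations computes. -/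

/-- The real functions of the memory that are computed from the first `D` cells by a bounded number
of arithmetic operations and comparisons. -/
inductive CompReal (D : ℕ) : ((ℕ → ℝ) → ℝ) → Prop
  | lit (c : ℚ) : CompReal D fun _ => (c : ℝ)
  | cell (k : ℕ) (hk : k < D) : CompReal D fun ω => ω k
  | add {f g} : CompReal D f → CompReal D g → CompReal D fun ω => f ω + g ω
  | sub {f g} : CompReal D f → CompReal D g → CompReal D fun ω => f ω - g ω
  | mul {f g} : CompReal D f → CompReal D g → CompReal D fun ω => f ω * g ω
  | div {f g} : CompReal D f → CompReal D g → CompReal D fun ω => f ω / g ω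
  | sqrt {f} : CompReal D f → CompReal D fun ω => Real.sqrt (f ω)
  | cos {f} : CompReal D f → CompReal D fun ω => Real.cos (f ω)
  | arccos {f} : CompReal D f → CompReal D fun ω => Real.arccos (f ω)
  | ite {a b f g} : CompReal D a → CompReal D b → CompReal D f → CompReal D g →
      CompReal D fun ω => if a ω ≤ b ω then f ω else g ω

open Classical in
/-- Conditions on the memory that a bounded number of machine operations decides. -/
def CompPred (D : ℕ) (p : (ℕ → ℝ) → Prop) : Prop :=
  CompReal D fun ω => if p ω then 1 else 0

namespace CompReal

variable {D : ℕ} {f g a b : (ℕ → ℝ) → ℝ} {p q : (ℕ → ℝ) → Prop}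

theorem const (c : ℚ) {x : ℝ} (h : (c : ℝ) = x) : CompReal D fun _ => x := h ▸ lit c

theorem zero : CompReal D fun _ => (0 : ℝ) := const 0 (by norm_num)

theorem one : CompReal D fun _ => (1 : ℝ) := const 1 (by norm_num)

theorem ofNat {n : ℕ} [n.AtLeastTwo] : CompReal D fun _ => (OfNat.ofNat n : ℝ) :=
  const (OfNat.ofNat n) (by norm_num)

theorem neg (hf : CompReal D f) : CompReal D fun ω => -f ω := by
  simpa using zero.sub hf

theorem pow (hf : CompReal D f) (n : ℕ) : CompReal D fun ω => f ω ^ n := by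
  induction n with
  | zero => simpa using one
  | succ n ih => simpa [pow_succ] using ih.mul hf

theorem abs (hf : CompReal D f) : CompReal D fun ω => |f ω| := by
  simpa [Real.sqrt_sq_eq_abs] using (hf.pow 2).sqrt

theorem max (hf : CompReal D f) (hg : CompReal D g) : CompReal D fun ω => max (f ω) (g ω) := by
  simpa only [max_def] using ite hf hg hg hf

theorem sum {ι : Type*} (s : Finset ι) {F : ι → (ℕ → ℝ) → ℝ} (h : ∀ i ∈ s, CompReal D (F i)) :
    CompReal D fun ω => ∑ i ∈ s, F i ω := by
  classical
  induction s using Finset.induction_on with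
  | empty => simpa using zero
  | insert i s hi ih =>
    simp only [Finset.sum_insert hi]
    exact (h i (by simp)).add (ih fun j hj => h j (by simp [hj]))

/-- A function computed from the first `D` cells depends on these only. -/
theorem congr (hf : CompReal D f) {ω ω' : ℕ → ℝ} (h : ∀ k < D, ω k = ω' k) : f ω = f ω' := by
  induction hf with
  | lit => rfl
  | cell k hk => exact h k hk
  | add _ _ h₁ h₂ => simp only [h₁, h₂]
  | sub _ _ h₁ h₂ => simp only [h₁, h₂]
  | mul _ _ h₁ h₂ => simp only [h₁, h₂]
  | div _ _ h₁ h₂ => simp only [h₁, h₂]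
  | sqrt _ h₁ => simp only [h₁]
  | cos _ h₁ => simp only [h₁]
  | arccos _ h₁ => simp only [h₁]
  | ite _ _ _ _ h₁ h₂ h₃ h₄ => simp only [h₁, h₂, h₃, h₄]

open Classical in
theorem cond (hp : CompPred D p) (hf : CompReal D f) (hg : CompReal D g) :
    CompReal D fun ω => if p ω then f ω else g ω := by
  -- The indicator of `p` takes only the values 0 and 1, so the machine test `1 ≤ indicator` decides
  -- `p`.
  have h := ite one hp hf hg
  convert h using 2 with ω
  by_cases h : p ω <;> simp [h]

end CompReal

namespace CompPred

variable {D : ℕ} {f g : (ℕ → ℝ) → ℝ} {p q : (ℕ → ℝ) → Prop}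

theorem le (hf : CompReal D f) (hg : CompReal D g) : CompPred D fun ω => f ω ≤ g ω := by
  unfold CompPred
  convert CompReal.ite hf hg CompReal.one CompReal.zero

theorem not (hp : CompPred D p) : CompPred D fun ω => ¬ p ω := by
  unfold CompPred
  convert CompReal.cond hp CompReal.zero CompReal.one using 2 with ω
  by_cases h : p ω <;> simp [h]

theorem and (hp : CompPred D p) (hq : CompPred D q) : CompPred D fun ω => p ω ∧ q ω := by
  unfold CompPred
  convert CompReal.cond hp hq CompReal.zero using 2 with ω
  by_cases h : p ω <;> by_cases h' : q ω <;> simp [h, h']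

theorem eq (hf : CompReal D f) (hg : CompReal D g) : CompPred D fun ω => f ω = g ω := by
  simpa only [le_antisymm_iff] using (le hf hg).and (le hg hf)

/-- A condition that does not involve the memory is settled classically when the program is chosen;
no test is made at run time. -/
theorem const (P : Prop) : CompPred D fun _ => P := by
  unfold CompPred
  by_cases h : P <;> simp [h, CompReal.zero, CompReal.one]

theorem forall_fin {n : ℕ} {p : Fin n → (ℕ → ℝ) → Prop} (h : ∀ i, CompPred D (p i)) :
    CompPred D fun ω => ∀ i, p i ω := by
  induction n with
  | zero => simpa using const True
  | succ n ih =>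
    simp only [Fin.forall_fin_succ]
    exact (h 0).and (ih fun i => h i.succ)

end CompPred

/-! ### Computable families in types with real coordinates. -/

open Classical in
/-- Types with a notion of computable families of elements, given by real coordinates. -/
class RAMType (X : Type*) where
  comp : ℕ → ((ℕ → ℝ) → X) → Prop
  comp_cond : ∀ {D : ℕ} {p : (ℕ → ℝ) → Prop} {f g : (ℕ → ℝ) → X}, CompPred D p →
    comp D f → comp D g → comp D fun ω => if p ω then f ω else g ω

/-- A family of elements of `X` whose coordinates are computed from the first `D` cells. -/
def Comp {X : Type*} [RAMType X] (D : ℕ) (f : (ℕ → ℝ) → X) : Prop := RAMType.comp D f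

instance : RAMType ℝ where
  comp := CompReal
  comp_cond hp hf hg := CompReal.cond hp hf hg

instance : RAMType ℂ where
  comp D f := CompReal D (fun ω => (f ω).re) ∧ CompReal D (fun ω => (f ω).im)
  comp_cond hp hf hg := by
    simp only [apply_ite Complex.re, apply_ite Complex.im]
    exact ⟨CompReal.cond hp hf.1 hg.1, CompReal.cond hp hf.2 hg.2⟩

instance {ι : Type*} {X : ι → Type*} [∀ i, RAMType (X i)] : RAMType (∀ i, X i) where
  comp D f := ∀ i, Comp D fun ω => f ω i
  comp_cond {D p f g} hp hf hg i := by
    have := RAMType.comp_cond hp (hf i) (hg i)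
    unfold Comp
    convert this using 2 with ω
    by_cases h : p ω <;> simp [h]

instance {ι κ X : Type*} [RAMType X] : RAMType (Matrix ι κ X) :=
  inferInstanceAs (RAMType (ι → κ → X))

instance {X Y : Type*} [RAMType X] [RAMType Y] : RAMType (X × Y) where
  comp D f := Comp D (fun ω => (f ω).1) ∧ Comp D (fun ω => (f ω).2)
  comp_cond hp hf hg := by
    simp only [apply_ite Prod.fst, apply_ite Prod.snd]
    exact ⟨RAMType.comp_cond hp hf.1 hg.1, RAMType.comp_cond hp hf.2 hg.2⟩

namespace Comp

variable {D : ℕ}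

open Classical in
theorem cond {X : Type*} [RAMType X] {p : (ℕ → ℝ) → Prop} {f g : (ℕ → ℝ) → X}
    (hp : CompPred D p) (hf : Comp D f) (hg : Comp D g) :
    Comp D fun ω => if p ω then f ω else g ω := RAMType.comp_cond hp hf hg

theorem pair {X Y : Type*} [RAMType X] [RAMType Y] {f : (ℕ → ℝ) → X} {g : (ℕ → ℝ) → Y}
    (hf : Comp D f) (hg : Comp D g) : Comp D fun ω => (f ω, g ω) := ⟨hf, hg⟩

theorem mk {f g : (ℕ → ℝ) → ℝ} (hf : CompReal D f) (hg : CompReal D g) :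
    Comp D fun ω => (⟨f ω, g ω⟩ : ℂ) := ⟨hf, hg⟩

theorem ofReal {f : (ℕ → ℝ) → ℝ} (hf : CompReal D f) : Comp D fun ω => (f ω : ℂ) :=
  ⟨hf, CompReal.zero⟩

theorem re {f : (ℕ → ℝ) → ℂ} (hf : Comp D f) : CompReal D fun ω => (f ω).re := hf.1

theorem im {f : (ℕ → ℝ) → ℂ} (hf : Comp D f) : CompReal D fun ω => (f ω).im := hf.2

section Complex

variable {f g : (ℕ → ℝ) → ℂ}

theorem czero : Comp D fun _ => (0 : ℂ) := ⟨CompReal.zero, CompReal.zero⟩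

theorem cone : Comp D fun _ => (1 : ℂ) := ⟨CompReal.one, CompReal.zero⟩

theorem cI : Comp D fun _ => Complex.I := ⟨by simpa using CompReal.zero, by simpa using CompReal.one⟩

theorem cadd (hf : Comp D f) (hg : Comp D g) : Comp D fun ω => f ω + g ω :=
  ⟨hf.1.add hg.1, hf.2.add hg.2⟩

theorem csub (hf : Comp D f) (hg : Comp D g) : Comp D fun ω => f ω - g ω :=
  ⟨hf.1.sub hg.1, hf.2.sub hg.2⟩

theorem cneg (hf : Comp D f) : Comp D fun ω => -f ω := ⟨hf.1.neg, hf.2.neg⟩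

theorem cmul (hf : Comp D f) (hg : Comp D g) : Comp D fun ω => f ω * g ω :=
  ⟨by simpa using (hf.1.mul hg.1).sub (hf.2.mul hg.2),
    by simpa using (hf.1.mul hg.2).add (hf.2.mul hg.1)⟩

theorem cstar (hf : Comp D f) : Comp D fun ω => star (f ω) := ⟨hf.1, hf.2.neg⟩

theorem normSq (hf : Comp D f) : CompReal D fun ω => Complex.normSq (f ω) := by
  simpa [Complex.normSq_apply] using (hf.1.mul hf.1).add (hf.2.mul hf.2)

theorem csum {ι : Type*} (s : Finset ι) {F : ι → (ℕ → ℝ) → ℂ} (h : ∀ i ∈ s, Comp D (F i)) :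
    Comp D fun ω => ∑ i ∈ s, F i ω := by
  constructor
  · simpa using CompReal.sum s fun i hi => (h i hi).1
  · simpa using CompReal.sum s fun i hi => (h i hi).2

theorem eq_pred (hf : Comp D f) (hg : Comp D g) : CompPred D fun ω => f ω = g ω := by
  simpa only [Complex.ext_iff] using (CompPred.eq hf.1 hg.1).and (CompPred.eq hf.2 hg.2)

end Complex

theorem vec_eq_pred {n : ℕ} {f g : (ℕ → ℝ) → Fin n → ℂ} (hf : Comp D f) (hg : Comp D g) :
    CompPred D fun ω => f ω = g ω := by
  simpa only [funext_iff] using CompPred.forall_fin fun i => eq_pred (hf i) (hg i)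

section Matrix

variable {l m n : Type*} [Fintype m]

theorem mmul {A : (ℕ → ℝ) → Matrix l m ℂ} {B : (ℕ → ℝ) → Matrix m n ℂ} (hA : Comp D A)
    (hB : Comp D B) : Comp D fun ω => A ω * B ω := fun i j => by
  simpa only [Matrix.mul_apply] using csum Finset.univ fun k _ => cmul (hA i k) (hB k j)

theorem mulVec {A : (ℕ → ℝ) → Matrix l m ℂ} {x : (ℕ → ℝ) → m → ℂ} (hA : Comp D A)
    (hx : Comp D x) : Comp D fun ω => (A ω).mulVec (x ω) := fun i => by
  simpa only [Matrix.mulVec, dotProduct] using csum Finset.univ fun k _ => cmul (hA i k) (hx k)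

theorem dotProd {x y : (ℕ → ℝ) → m → ℂ} (hx : Comp D x)
    (hy : Comp D y) : Comp D fun ω => x ω ⬝ᵥ y ω := by
  simpa only [dotProduct] using csum Finset.univ fun k _ => cmul (hx k) (hy k)

theorem conjTranspose {A : (ℕ → ℝ) → Matrix l n ℂ} (hA : Comp D A) :
    Comp D fun ω => (A ω).conjTranspose := fun i j => cstar (hA j i)

theorem transpose {A : (ℕ → ℝ) → Matrix l n ℂ} (hA : Comp D A) :
    Comp D fun ω => (A ω).transpose := fun i j => hA j i

theorem mone {n : ℕ} : Comp D fun _ => (1 : Matrix (Fin n) (Fin n) ℂ) := fun i j => by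
  by_cases h : i = j
  · subst h; simpa using cone
  · simpa [Matrix.one_apply_ne h] using czero

theorem trace {A : (ℕ → ℝ) → Matrix m m ℂ} (hA : Comp D A) :
    Comp D fun ω => (A ω).trace := by
  simpa only [Matrix.trace, Matrix.diag_apply] using csum Finset.univ fun k _ => hA k k

end Matrix

end Comp

/-- Among finitely many computable candidates, one that satisfies its (decidable) condition can be
selected computably. -/
theorem exists_comp_select {X ι : Type*} [RAMType X] [Fintype ι] [Nonempty ι] {D : ℕ}
    {p : ι → (ℕ → ℝ) → Prop} {f : ι → (ℕ → ℝ) → X} (hp : ∀ i, CompPred D (p i))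
    (hf : ∀ i, Comp D (f i)) :
    ∃ g : (ℕ → ℝ) → X, Comp D g ∧ ∀ ω, (∃ i, p i ω) → ∃ i, p i ω ∧ g ω = f i ω := by
  classical
  have key : ∀ s : Finset ι, ∃ g : (ℕ → ℝ) → X, Comp D g ∧
      ∀ ω, (∃ i ∈ s, p i ω) → ∃ i, p i ω ∧ g ω = f i ω := by
    intro s
    induction s using Finset.induction_on with
    | empty => exact ⟨f (Classical.arbitrary ι), hf _, by simp⟩
    | insert i s hi ih =>
      obtain ⟨g, hg, h⟩ := ih
      refine ⟨fun ω => if p i ω then f i ω else g ω, Comp.cond (hp i) (hf i) hg, fun ω hω => ?_⟩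
      by_cases hpi : p i ω
      · exact ⟨i, hpi, by simp [hpi]⟩
      · obtain ⟨j, hj, hpj⟩ := hω
        have hj' : j ∈ s := by
          rcases Finset.mem_insert.1 hj with rfl | h
          · exact absurd hpj hpi
          · exact h
        obtain ⟨k, hk, hk'⟩ := h ω ⟨j, hj', hpj⟩
        exact ⟨k, hk, by simp [hpi, hk']⟩
  obtain ⟨g, hg, h⟩ := key Finset.univ
  exact ⟨g, hg, fun ω ⟨i, hi⟩ => h ω ⟨i, Finset.mem_univ i, hi⟩⟩

/-! Real-rooted polynomials of degree three and four. -/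

/-- Viète's trigonometric formula for the largest root of a real-rooted depressed cubic. -/
theorem cubic_root_eq_cos {a b c : ℝ} (hab : b ≤ a) (hbc : c ≤ b) (hsum : a + b + c = 0) :
    a = 2 * √(-(a * b + a * c + b * c) / 3) *
      Real.cos (Real.arccos (a * b * c / (2 * √(-(a * b + a * c + b * c) / 3) ^ 3)) / 3) := by
  set ρ := √(-(a * b + a * c + b * c) / 3) with hρ
  obtain rfl : c = -a - b := by linarith
  have hp : 0 ≤ -(a * b + a * (-a - b) + b * (-a - b)) / 3 := by nlinarith [sq_nonneg (a + 2 * b)]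
  have hρ2 : ρ ^ 2 = -(a * b + a * (-a - b) + b * (-a - b)) / 3 := Real.sq_sqrt hp
  have hρ0 : 0 ≤ ρ := Real.sqrt_nonneg _
  have ha : 0 ≤ a := by linarith
  -- For `ρ = 0` all roots vanish, and the quotient under `arccos` has denominator zero; the
  -- prefactor zero makes its value irrelevant.
  rcases hρ0.eq_or_lt with h0 | hpos
  · rw [← h0] at hρ2 ⊢
    nlinarith [sq_nonneg (a + 2 * b)]
  have h1 : a ≤ 2 * ρ := by
    apply le_of_sq_le_sq _ (by positivity)
    nlinarith [sq_nonneg (a + 2 * b)]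
  have h2 : ρ ≤ a := by
    apply le_of_sq_le_sq _ ha
    nlinarith [mul_nonneg (sub_nonneg.2 hab) (sub_nonneg.2 (hbc.trans hab))]
  set β := Real.arccos (a / (2 * ρ)) with hβ
  have hcos : Real.cos β = a / (2 * ρ) := by
    apply Real.cos_arccos
    · have : 0 ≤ a / (2 * ρ) := by positivity
      linarith
    · rw [div_le_one (by positivity)]; exact h1
  have hβ0 : 0 ≤ β := Real.arccos_nonneg _
  -- Since `ρ ≤ a`, the cosine of `β` is at least 1/2. So `3 * β` stays in `[0, π]`, where `arccos`
  -- inverts the cosine; this singles out the largest root.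
  have hβ1 : β ≤ Real.pi / 3 := by
    by_contra! h
    have := Real.cos_lt_cos_of_nonneg_of_le_pi (by positivity) (Real.arccos_le_pi _) h
    rw [Real.cos_pi_div_three, ← hβ, hcos, div_lt_iff₀ (by positivity)] at this
    linarith
  have h3 : a * b * (-a - b) / (2 * ρ ^ 3) = Real.cos (3 * β) := by
    rw [Real.cos_three_mul, hcos]
    field_simp
    have : 3 * ρ ^ 2 = a * a + a * b + b * b := by rw [hρ2]; ring
    linear_combination (4 * a) * this
  rw [h3, Real.arccos_cos (by positivity) (by linarith), mul_div_cancel_left₀ _ (by norm_num), hcos]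
  field_simp

namespace CompReal

variable {D : ℕ}

/-- Subtracting the mean `S₁ / 3` depresses the cubic; Viète's formula gives the largest root and
the quadratic cofactor the other two. Ordering the roots makes them single-valued functions of the
coefficients. -/
theorem exists_cubic_roots {S₁ S₂ S₃ : (ℕ → ℝ) → ℝ} (h₁ : CompReal D S₁) (h₂ : CompReal D S₂)
    (h₃ : CompReal D S₃) :
    ∃ x y z : (ℕ → ℝ) → ℝ, CompReal D x ∧ CompReal D y ∧ CompReal D z ∧
      ∀ ω a b c, b ≤ a → c ≤ b → a + b + c = S₁ ω → a * b + a * c + b * c = S₂ ω →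
        a * b * c = S₃ ω → x ω = a ∧ y ω = b ∧ z ω = c := by
  have hm : CompReal D fun ω => S₁ ω / 3 := h₁.div ofNat
  have hP : CompReal D fun ω => S₂ ω - 3 * (S₁ ω / 3) ^ 2 := h₂.sub (ofNat.mul (hm.pow 2))
  have hQ : CompReal D fun ω => S₃ ω - S₁ ω / 3 * S₂ ω + 2 * (S₁ ω / 3) ^ 3 :=
    (h₃.sub (hm.mul h₂)).add (ofNat.mul (hm.pow 3))
  have hρ : CompReal D fun ω => √(-(S₂ ω - 3 * (S₁ ω / 3) ^ 2) / 3) := (hP.neg.div ofNat).sqrt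
  have ht : CompReal D fun ω => 2 * √(-(S₂ ω - 3 * (S₁ ω / 3) ^ 2) / 3) *
      Real.cos (Real.arccos ((S₃ ω - S₁ ω / 3 * S₂ ω + 2 * (S₁ ω / 3) ^ 3) /
        (2 * √(-(S₂ ω - 3 * (S₁ ω / 3) ^ 2) / 3) ^ 3)) / 3) :=
    (ofNat.mul hρ).mul ((hQ.div (ofNat.mul (hρ.pow 3))).arccos.div ofNat).cos
  obtain ⟨t, ht, ht'⟩ : ∃ t : (ℕ → ℝ) → ℝ, CompReal D t ∧ ∀ ω, t ω =
      2 * √(-(S₂ ω - 3 * (S₁ ω / 3) ^ 2) / 3) *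
      Real.cos (Real.arccos ((S₃ ω - S₁ ω / 3 * S₂ ω + 2 * (S₁ ω / 3) ^ 3) /
        (2 * √(-(S₂ ω - 3 * (S₁ ω / 3) ^ 2) / 3) ^ 3)) / 3) := ⟨_, ht, fun _ => rfl⟩
  -- The other two roots of the depressed cubic have sum `-t` and product `P + t²`, with `P` its
  -- second symmetric function; this is the root of their discriminant, equal to `b - c`.
  have hd : CompReal D fun ω => √(t ω ^ 2 - 4 * (S₂ ω - 3 * (S₁ ω / 3) ^ 2 + t ω ^ 2)) :=
    ((ht.pow 2).sub (ofNat.mul (hP.add (ht.pow 2)))).sqrt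
  have hk : CompReal D fun _ => 2 := ofNat
  refine ⟨_, _, _, ht.add hm, ((ht.neg.add hd).div hk).add hm,
    ((ht.neg.sub hd).div hk).add hm, fun ω a b c hab hbc e₁ e₂ e₃ => ?_⟩
  have hta : t ω = a - S₁ ω / 3 := by
    have := cubic_root_eq_cos (a := a - S₁ ω / 3) (b := b - S₁ ω / 3) (c := c - S₁ ω / 3)
      (by linarith) (by linarith) (by linarith)
    rw [this, ht']
    have hp : (a - S₁ ω / 3) * (b - S₁ ω / 3) + (a - S₁ ω / 3) * (c - S₁ ω / 3) +
        (b - S₁ ω / 3) * (c - S₁ ω / 3) = S₂ ω - 3 * (S₁ ω / 3) ^ 2 := by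
      rw [← e₂, ← e₁]; ring
    have hq : (a - S₁ ω / 3) * (b - S₁ ω / 3) * (c - S₁ ω / 3) =
        S₃ ω - S₁ ω / 3 * S₂ ω + 2 * (S₁ ω / 3) ^ 3 := by
      rw [← e₃, ← e₂, ← e₁]; ring
    rw [hp, hq]
  have hdisc : √(t ω ^ 2 - 4 * (S₂ ω - 3 * (S₁ ω / 3) ^ 2 + t ω ^ 2)) = b - c := by
    have : t ω ^ 2 - 4 * (S₂ ω - 3 * (S₁ ω / 3) ^ 2 + t ω ^ 2) = (b - c) ^ 2 := by
      rw [hta, ← e₂, ← e₁]; ring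
    rw [this, Real.sqrt_sq (by linarith)]
  refine ⟨by rw [hta]; ring, ?_, ?_⟩ <;> rw [hdisc, hta] <;> linarith

/-- Newton's identities turn power sums into elementary symmetric functions. The squares of `a + b -
c - d`, `a - b + c - d` and `a - b - c + d` are the roots of a resolvent cubic, and signed sums of
these three numbers with `p₁` give four times each root. -/
theorem exists_quartic_roots {p₁ p₂ p₃ p₄ : (ℕ → ℝ) → ℝ} (h₁ : CompReal D p₁)
    (h₂ : CompReal D p₂) (h₃ : CompReal D p₃) (h₄ : CompReal D p₄) :
    ∃ x y z w : (ℕ → ℝ) → ℝ, CompReal D x ∧ CompReal D y ∧ CompReal D z ∧ CompReal D w ∧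
      ∀ ω a b c d, b ≤ a → c ≤ b → d ≤ c → a + b + c + d = p₁ ω →
        a ^ 2 + b ^ 2 + c ^ 2 + d ^ 2 = p₂ ω → a ^ 3 + b ^ 3 + c ^ 3 + d ^ 3 = p₃ ω →
        a ^ 4 + b ^ 4 + c ^ 4 + d ^ 4 = p₄ ω → x ω = a ∧ y ω = b ∧ z ω = c ∧ w ω = d := by
  obtain ⟨e₂, he₂, he₂'⟩ : ∃ e : (ℕ → ℝ) → ℝ, CompReal D e ∧
      ∀ ω, e ω = (p₁ ω ^ 2 - p₂ ω) / 2 :=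
    ⟨_, ((h₁.pow 2).sub h₂).div ofNat, fun _ => rfl⟩
  obtain ⟨e₃, he₃, he₃'⟩ : ∃ e : (ℕ → ℝ) → ℝ, CompReal D e ∧
      ∀ ω, e ω = (p₁ ω ^ 3 - 3 * p₁ ω * p₂ ω + 2 * p₃ ω) / 6 :=
    ⟨_, (((h₁.pow 3).sub ((ofNat.mul h₁).mul h₂)).add (ofNat.mul h₃)).div ofNat,
      fun _ => rfl⟩
  obtain ⟨e₄, he₄, he₄'⟩ : ∃ e : (ℕ → ℝ) → ℝ, CompReal D e ∧
      ∀ ω, e ω = (p₁ ω ^ 4 - 6 * p₁ ω ^ 2 * p₂ ω + 3 * p₂ ω ^ 2 + 8 * p₁ ω * p₃ ω - 6 * p₄ ω) / 24 :=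
    ⟨_, (((((h₁.pow 4).sub ((ofNat.mul (h₁.pow 2)).mul h₂)).add (ofNat.mul (h₂.pow 2))).add
      ((ofNat.mul h₁).mul h₃)).sub (ofNat.mul h₄)).div ofNat, fun _ => rfl⟩
  obtain ⟨q, hq, hq'⟩ : ∃ e : (ℕ → ℝ) → ℝ, CompReal D e ∧
      ∀ ω, e ω = p₁ ω ^ 3 - 4 * p₁ ω * e₂ ω + 8 * e₃ ω :=
    ⟨_, ((h₁.pow 3).sub ((ofNat.mul h₁).mul he₂)).add (ofNat.mul he₃), fun _ => rfl⟩
  obtain ⟨S₁, hS₁, hS₁'⟩ : ∃ e : (ℕ → ℝ) → ℝ, CompReal D e ∧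
      ∀ ω, e ω = 3 * p₁ ω ^ 2 - 8 * e₂ ω :=
    ⟨_, (ofNat.mul (h₁.pow 2)).sub (ofNat.mul he₂), fun _ => rfl⟩
  obtain ⟨S₂, hS₂, hS₂'⟩ : ∃ e : (ℕ → ℝ) → ℝ, CompReal D e ∧
      ∀ ω, e ω = 3 * p₁ ω ^ 4 - 16 * p₁ ω ^ 2 * e₂ ω + 16 * e₂ ω ^ 2 + 16 * p₁ ω * e₃ ω - 64 * e₄ ω :=
    ⟨_, ((((ofNat.mul (h₁.pow 4)).sub ((ofNat.mul (h₁.pow 2)).mul he₂)).add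
      (ofNat.mul (he₂.pow 2))).add ((ofNat.mul h₁).mul he₃)).sub (ofNat.mul he₄),
      fun _ => rfl⟩
  obtain ⟨x, y, z, hx, hy, hz, hroots⟩ := exists_cubic_roots hS₁ hS₂ (hq.pow 2)
  -- The resolvent determines the third combination up to sign. The ordering makes the first two
  -- nonnegative, and `q` is the product of all three, so it supplies the missing sign.
  obtain ⟨w, hw, hw'⟩ : ∃ e : (ℕ → ℝ) → ℝ, CompReal D e ∧
      ∀ ω, e ω = if 0 ≤ q ω then √(z ω) else -√(z ω) :=
    ⟨_, ite zero hq hz.sqrt hz.sqrt.neg, fun _ => rfl⟩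
  have hk : CompReal D fun _ => 4 := ofNat
  refine ⟨_, _, _, _, (((h₁.add hx.sqrt).add hy.sqrt).add hw).div hk,
    (((h₁.add hx.sqrt).sub hy.sqrt).sub hw).div hk,
    (((h₁.sub hx.sqrt).add hy.sqrt).sub hw).div hk,
    (((h₁.sub hx.sqrt).sub hy.sqrt).add hw).div hk,
    fun ω a b c d hab hbc hcd k₁ k₂ k₃ k₄ => ?_⟩
  have l₂ : e₂ ω = a * b + a * c + a * d + b * c + b * d + c * d := by
    rw [he₂', ← k₁, ← k₂]; ring
  have l₃ : e₃ ω = a * b * c + a * b * d + a * c * d + b * c * d := by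
    rw [he₃', ← k₁, ← k₂, ← k₃]; ring
  have l₄ : e₄ ω = a * b * c * d := by
    rw [he₄', ← k₁, ← k₂, ← k₃, ← k₄]; ring
  have lq : q ω = (a + b - c - d) * (a - b + c - d) * (a - b - c + d) := by
    rw [hq', l₂, l₃, ← k₁]; ring
  obtain ⟨hX, hY, hZ⟩ := hroots ω ((a + b - c - d) ^ 2) ((a - b + c - d) ^ 2) ((a - b - c + d) ^ 2)
    (by nlinarith [mul_nonneg (sub_nonneg.2 hbc) (by linarith : 0 ≤ a - d)])
    (by nlinarith [mul_nonneg (sub_nonneg.2 hab) (by linarith : 0 ≤ c - d)])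
    (by rw [hS₁', l₂, ← k₁]; ring) (by rw [hS₂', l₂, l₃, l₄, ← k₁]; ring) (by rw [lq]; ring)
  have hXs : √(x ω) = a + b - c - d := by rw [hX, Real.sqrt_sq (by linarith)]
  have hYs : √(y ω) = a - b + c - d := by rw [hY, Real.sqrt_sq (by linarith)]
  have hWs : w ω = a - b - c + d := by
    rw [hw', hZ, Real.sqrt_sq_eq_abs, lq]
    -- If the second combination vanishes, then `a = b` and `c = d`, so the third one vanishes as
    -- well and its sign does not matter.
    rcases (by linarith : 0 ≤ a - b + c - d).eq_or_lt with h | h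
    · have h' : a - b - c + d = 0 := by linarith
      simp [h']
    · have h' : 0 < (a + b - c - d) * (a - b + c - d) := mul_pos (by linarith) h
      rcases le_or_gt 0 (a - b - c + d) with h'' | h''
      · rw [if_pos (mul_nonneg h'.le h''), abs_of_nonneg h'']
      · rw [if_neg (not_le.2 (mul_neg_of_pos_of_neg h' h'')), abs_of_neg h'', neg_neg]
  refine ⟨?_, ?_, ?_, ?_⟩ <;> rw [hXs, hYs, hWs, ← k₁] <;> ring

end CompReal

/-! Takagi factorization of complex symmetric `4 × 4` matrices. -/

-- Power sums of eigenvalues are available from matrix products alone, without diagonalization.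
open Matrix in
theorem Matrix.IsHermitian.trace_pow_eq_sum {n : Type*} [Fintype n] [DecidableEq n]
    {A : Matrix n n ℂ} (hA : A.IsHermitian) (k : ℕ) :
    ((A ^ k).trace).re = ∑ i, hA.eigenvalues i ^ k := by
  conv_lhs => rw [hA.spectral_theorem, ← map_pow, Unitary.conjStarAlgAut_apply,
    Matrix.trace_mul_comm, ← mul_assoc]
  rw [Unitary.coe_star_mul_self, one_mul, Matrix.diagonal_pow, Matrix.trace_diagonal]
  simp [← Complex.ofReal_pow]

-- The traces of four powers determine the quartic. They determine the eigenvalues only as a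
-- multiset, so they are produced in increasing order, a permutation of the list `eigenvalues`.
open Matrix in
theorem Comp.exists_eigenvalues {D : ℕ} {H : (ℕ → ℝ) → Matrix (Fin 4) (Fin 4) ℂ} (hH : Comp D H) :
    ∃ μ : (ℕ → ℝ) → Fin 4 → ℝ, Comp D μ ∧ ∀ ω, (hω : (H ω).IsHermitian) →
      ∃ σ : Equiv.Perm (Fin 4), μ ω = hω.eigenvalues ∘ σ := by
  have h2 := Comp.mmul hH hH
  have h3 := Comp.mmul h2 hH
  have h4 := Comp.mmul h3 hH
  obtain ⟨x, y, z, w, hx, hy, hz, hw, h⟩ := CompReal.exists_quartic_roots (Comp.re (Comp.trace hH))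
    (Comp.re (Comp.trace h2)) (Comp.re (Comp.trace h3)) (Comp.re (Comp.trace h4))
  refine ⟨fun ω => ![w ω, z ω, y ω, x ω], fun i => ?_, fun ω hω => ⟨Tuple.sort hω.eigenvalues, ?_⟩⟩
  · fin_cases i
    exacts [hw, hz, hy, hx]
  · set σ := Tuple.sort hω.eigenvalues
    have hσ : Monotone (hω.eigenvalues ∘ σ) := Tuple.monotone_sort _
    have hs : ∀ k : ℕ, hω.eigenvalues (σ 3) ^ k + hω.eigenvalues (σ 2) ^ k +
        hω.eigenvalues (σ 1) ^ k + hω.eigenvalues (σ 0) ^ k = ((H ω ^ k).trace).re := by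
      intro k
      rw [hω.trace_pow_eq_sum, ← Equiv.sum_comp σ, Fin.sum_univ_four]
      ring
    obtain ⟨h₁, h₂, h₃, h₄⟩ := h ω (hω.eigenvalues (σ 3)) (hω.eigenvalues (σ 2))
      (hω.eigenvalues (σ 1)) (hω.eigenvalues (σ 0)) (hσ (by decide)) (hσ (by decide))
      (hσ (by decide)) (by simpa using hs 1) (by rw [hs 2, pow_two]) (by rw [hs 3, pow_succ, pow_two])
      (by rw [hs 4, pow_succ, pow_succ, pow_two])
    funext i
    fin_cases i <;> simp [h₁, h₂, h₃, h₄]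

/-- The Krylov type sequence `∏ i < t, (H - μ i) w`. -/
def shiftedSeq (H : Matrix (Fin 4) (Fin 4) ℂ) (μ : Fin 4 → ℝ) (w : Fin 4 → ℂ) : ℕ → Fin 4 → ℂ
  | 0 => w
  | t + 1 => H.mulVec (shiftedSeq H μ w t) - (μ (Fin.ofNat 4 t) : ℂ) • shiftedSeq H μ w t

-- Cayley–Hamilton: the four shifts multiply to the characteristic polynomial evaluated at `H`, in
-- whatever order the eigenvalues are taken.
open Matrix Polynomial in
theorem shiftedSeq_four {H : Matrix (Fin 4) (Fin 4) ℂ} (hH : H.IsHermitian) (σ : Equiv.Perm (Fin 4))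
    (w : Fin 4 → ℂ) : shiftedSeq H (hH.eigenvalues ∘ σ) w 4 = 0 := by
  have h := Matrix.aeval_self_charpoly H
  have hp : ∏ i, (X - C (hH.eigenvalues (σ i) : ℂ)) = (X - C (hH.eigenvalues (σ 3) : ℂ)) *
      ((X - C (hH.eigenvalues (σ 2) : ℂ)) * ((X - C (hH.eigenvalues (σ 1) : ℂ)) *
      (X - C (hH.eigenvalues (σ 0) : ℂ)))) := by
    rw [Fin.prod_univ_four]; ring
  have hc : H.charpoly = ∏ i, (X - C (hH.eigenvalues (σ i) : ℂ)) := by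
    rw [hH.charpoly_eq, ← Equiv.prod_comp σ]
    rfl
  rw [hc, hp] at h
  simp only [map_mul, map_sub, aeval_X, aeval_C] at h
  have h' := congrArg (fun M => M.mulVec w) h
  simp only [← Matrix.mulVec_mulVec, Matrix.zero_mulVec] at h'
  have key : ∀ (c : ℂ) (x : Fin 4 → ℂ),
      (H - algebraMap ℂ (Matrix (Fin 4) (Fin 4) ℂ) c).mulVec x = H.mulVec x - c • x := by
    intro c x
    rw [Matrix.sub_mulVec, Algebra.algebraMap_eq_smul_one, Matrix.smul_mulVec, Matrix.one_mulVec]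
  rw [key, key, key, key] at h'
  exact h'

theorem shiftedSeq_succ (H : Matrix (Fin 4) (Fin 4) ℂ) (μ : Fin 4 → ℝ) (w : Fin 4 → ℂ) (t : ℕ) :
    shiftedSeq H μ w (t + 1) =
      H.mulVec (shiftedSeq H μ w t) - (μ (Fin.ofNat 4 t) : ℂ) • shiftedSeq H μ w t := rfl

open Matrix in
/-- One element `x` of the sequence `∏ i < t, (H - μ i) w` is an eigenvector of `H`. -/
theorem exists_shiftedSeq_eigenvector {H : Matrix (Fin 4) (Fin 4) ℂ} (hH : H.IsHermitian)
    (σ : Equiv.Perm (Fin 4)) {w : Fin 4 → ℂ} (hw : w ≠ 0) :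
    ∃ t : Fin 4, shiftedSeq H (hH.eigenvalues ∘ σ) w t ≠ 0 ∧
      shiftedSeq H (hH.eigenvalues ∘ σ) w (t + 1) = 0 := by
  -- The sequence starts at a nonzero vector and is zero after four steps, so some factor
  -- annihilates its last nonzero member.
  by_contra! h
  have h0 : shiftedSeq H (hH.eigenvalues ∘ σ) w 0 ≠ 0 := hw
  exact h 3 (h 2 (h 1 (h 0 h0))) (shiftedSeq_four hH σ w)

namespace Comp

variable {D : ℕ}

theorem vsmul {c : (ℕ → ℝ) → ℂ} {x : (ℕ → ℝ) → Fin 4 → ℂ} (hc : Comp D c) (hx : Comp D x) :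
    Comp D fun ω => c ω • x ω := fun i => cmul hc (hx i)

theorem vadd {x y : (ℕ → ℝ) → Fin 4 → ℂ} (hx : Comp D x) (hy : Comp D y) :
    Comp D fun ω => x ω + y ω := fun i => cadd (hx i) (hy i)

theorem vsub {x y : (ℕ → ℝ) → Fin 4 → ℂ} (hx : Comp D x) (hy : Comp D y) :
    Comp D fun ω => x ω - y ω := fun i => csub (hx i) (hy i)

theorem vstar {x : (ℕ → ℝ) → Fin 4 → ℂ} (hx : Comp D x) :
    Comp D fun ω => star (x ω) := fun i => cstar (hx i)

theorem vzero : Comp D fun _ => (0 : Fin 4 → ℂ) := fun _ => czero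

theorem shiftedSeq {H : (ℕ → ℝ) → Matrix (Fin 4) (Fin 4) ℂ} {μ : (ℕ → ℝ) → Fin 4 → ℝ}
    {w : (ℕ → ℝ) → Fin 4 → ℂ} (hH : Comp D H) (hμ : Comp D μ) (hw : Comp D w) (t : ℕ) :
    Comp D fun ω => shiftedSeq (H ω) (μ ω) (w ω) t := by
  induction t with
  | zero => exact hw
  | succ t ih => exact vsub (mulVec hH ih) (vsmul (ofReal (hμ _)) ih)

end Comp

/-! ### Coneigenvectors by deflation. -/

/-- The vectors `v i`, `i < k`, are orthonormal. -/
def OrthonormalBelow (k : ℕ) (v : Fin 4 → Fin 4 → ℂ) : Prop :=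
  ∀ i j : Fin 4, i.1 < k → j.1 < k → star (v i) ⬝ᵥ v j = if i = j then 1 else 0

/-- The component of `w` orthogonal to the orthonormal vectors `v i`, `i < k`. -/
def rejection (k : ℕ) (v : Fin 4 → Fin 4 → ℂ) (w : Fin 4 → ℂ) : Fin 4 → ℂ :=
  w - ∑ i : Fin 4, if i.1 < k then (star (v i) ⬝ᵥ w) • v i else 0

theorem dotProduct_rejection {k : ℕ} {v : Fin 4 → Fin 4 → ℂ} (hv : OrthonormalBelow k v)
    (w : Fin 4 → ℂ) {i : Fin 4} (hi : i.1 < k) : star (v i) ⬝ᵥ rejection k v w = 0 := by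
  rw [rejection, dotProduct_sub, dotProduct_sum, Finset.sum_eq_single i, if_pos hi,
    dotProduct_smul, hv i i hi hi]
  · simp
  · intro j _ hj
    split_ifs with h
    · rw [dotProduct_smul, hv i j hi h, if_neg hj.symm, smul_zero]
    · simp
  · simp

/-- If every basis vector lay in the span, the projection onto it would have trace 4; but its trace
is the number `k < 4` of orthonormal vectors. -/
theorem exists_rejection_ne_zero {k : ℕ} (hk : k < 4) {v : Fin 4 → Fin 4 → ℂ}
    (hv : OrthonormalBelow k v) : ∃ j : Fin 4, rejection k v (Pi.single j 1) ≠ 0 := by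
  by_contra! h
  have h1 : ∀ j : Fin 4, (∑ i : Fin 4, if i.1 < k then star (v i j) * v i j else 0) = 1 := by
    intro j
    have := congrFun (h j) j
    simp only [rejection, Pi.sub_apply, Pi.single_eq_same, Finset.sum_apply, Pi.zero_apply,
      sub_eq_zero] at this
    rw [this]
    refine Finset.sum_congr rfl fun i _ => ?_
    split_ifs <;> simp
  have h2 : (∑ j : Fin 4, ∑ i : Fin 4, if i.1 < k then star (v i j) * v i j else 0) = 4 := by
    rw [Finset.sum_congr rfl fun j _ => h1 j]
    simp
  rw [Finset.sum_comm] at h2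
  have h3 : ∀ i : Fin 4, (∑ j : Fin 4, if i.1 < k then star (v i j) * v i j else 0) =
      if i.1 < k then 1 else 0 := by
    intro i
    split_ifs with hi
    · have := hv i i hi hi
      rw [if_pos rfl] at this
      exact this
    · simp
  rw [Finset.sum_congr rfl fun j _ => h3 j, Fin.sum_univ_four] at h2
  interval_cases k <;> norm_num at h2

/-- The antilinear operator `y ↦ conj (τ y)` maps an eigenvector `y` of its square to a
coneigenvector. -/
theorem mulVec_conj_add {τ : Matrix (Fin 4) (Fin 4) ℂ} (hτ : τ.transpose = τ) {y : Fin 4 → ℂ}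
    {l : ℝ} (hy : (τ.conjTranspose * τ).mulVec y = ((l ^ 2 : ℝ) : ℂ) • y) :
    τ.mulVec (star (τ.mulVec y) + (l : ℂ) • y) =
      (l : ℂ) • star (star (τ.mulVec y) + (l : ℂ) • y) := by
  have h1 : τ.mulVec (star (τ.mulVec y)) = ((l ^ 2 : ℝ) : ℂ) • star y := by
    have h := congrArg star hy
    rw [← Matrix.mulVec_mulVec, Matrix.star_mulVec, Matrix.conjTranspose_conjTranspose,
      ← Matrix.mulVec_transpose, hτ, star_smul] at h
    simpa using h
  rw [Matrix.mulVec_add, h1, Matrix.mulVec_smul, star_add, star_star, star_smul, smul_add, smul_smul]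
  simp [pow_two]
  abel

/-- Symmetry of `τ` makes the orthogonal complement of a coneigenvector invariant under the
antilinear map `y ↦ conj (τ y)`. This invariance is what permits deflation. -/
theorem star_dotProduct_conj {τ : Matrix (Fin 4) (Fin 4) ℂ} (hτ : τ.transpose = τ)
    {v y : Fin 4 → ℂ} {l : ℝ} (hv : τ.mulVec v = (l : ℂ) • star v) (hy : star v ⬝ᵥ y = 0) :
    star v ⬝ᵥ star (τ.mulVec y) = 0 := by
  rw [Matrix.star_dotProduct_star, dotProduct_comm, Matrix.dotProduct_mulVec,
    ← Matrix.mulVec_transpose, hτ, hv, smul_dotProduct, hy]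
  simp

theorem Comp.rejection {D k : ℕ} {v : (ℕ → ℝ) → Fin 4 → Fin 4 → ℂ} {w : (ℕ → ℝ) → Fin 4 → ℂ}
    (hv : Comp D v) (hw : Comp D w) : Comp D fun ω => rejection k (v ω) (w ω) := by
  refine vsub hw fun j => ?_
  simp only [Finset.sum_apply]
  refine csum _ fun i _ => ?_
  by_cases h : i.1 < k
  · simp only [h, if_true]
    exact vsmul (dotProd (vstar (hv i)) hw) (hv i) j
  · simpa [h] using czero

/-- A unit vector in the direction of `x ≠ 0`. -/
noncomputable def unitVec (x : Fin 4 → ℂ) : Fin 4 → ℂ := ((1 / √(star x ⬝ᵥ x).re : ℝ) : ℂ) • x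

theorem Comp.unitVec {D : ℕ} {x : (ℕ → ℝ) → Fin 4 → ℂ} (hx : Comp D x) :
    Comp D fun ω => unitVec (x ω) :=
  vsmul (ofReal (CompReal.one.div (re (dotProd (vstar hx) hx)).sqrt)) hx

open scoped ComplexOrder in
theorem star_unitVec_dotProduct {x : Fin 4 → ℂ} (hx : x ≠ 0) :
    star (unitVec x) ⬝ᵥ unitVec x = 1 := by
  have h0 : 0 ≤ star x ⬝ᵥ x := dotProduct_star_self_nonneg x
  have h1 : star x ⬝ᵥ x ≠ 0 := fun h => hx (dotProduct_star_self_eq_zero.1 h)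
  obtain ⟨c, hc, hc'⟩ : ∃ c : ℝ, 0 ≤ c ∧ star x ⬝ᵥ x = (c : ℂ) := by
    refine ⟨(star x ⬝ᵥ x).re, (Complex.le_def.1 h0).1, ?_⟩
    rw [Complex.ext_iff]
    exact ⟨rfl, (Complex.le_def.1 h0).2.symm⟩
  have hc0 : c ≠ 0 := by
    rintro rfl
    exact h1 hc'
  rw [unitVec, star_smul, smul_dotProduct, dotProduct_smul, hc']
  simp only [Complex.ofReal_re, smul_eq_mul, Complex.star_def, Complex.conj_ofReal]
  rw [← Complex.ofReal_mul, ← Complex.ofReal_mul]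
  norm_cast
  field_simp
  exact (Real.sq_sqrt hc).symm

/-- The vectors `v i`, `i < k`, are coneigenvectors of `τ` with coneigenvalues `l i ≥ 0`. -/
def ConeigenBelow (k : ℕ) (τ : Matrix (Fin 4) (Fin 4) ℂ) (v : Fin 4 → Fin 4 → ℂ) (l : Fin 4 → ℝ) :
    Prop :=
  ∀ i : Fin 4, i.1 < k → 0 ≤ l i ∧ τ.mulVec (v i) = (l i : ℂ) • star (v i)

-- A Krylov sequence started from a rejection stays orthogonal to the vectors already found, and
-- zero tests locate an eigenvector `y` of `τ† τ` in it, with eigenvalue `m²`. Then `conj (τ y) + m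
-- y` is a coneigenvector unless it vanishes, and in that case `I y` is one.
open scoped ComplexOrder in
theorem Comp.exists_next_coneigenvector {D k : ℕ} (hk : k < 4)
    {τ : (ℕ → ℝ) → Matrix (Fin 4) (Fin 4) ℂ} (hτ : Comp D τ)
    {v : (ℕ → ℝ) → Fin 4 → Fin 4 → ℂ} (hv : Comp D v) :
    ∃ (x : (ℕ → ℝ) → Fin 4 → ℂ) (m : (ℕ → ℝ) → ℝ), Comp D x ∧ Comp D m ∧
      ∀ ω, (τ ω).transpose = τ ω → OrthonormalBelow k (v ω) →
        ∀ l, ConeigenBelow k (τ ω) (v ω) l →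
        star (x ω) ⬝ᵥ x ω = 1 ∧ (∀ i : Fin 4, i.1 < k → star (v ω i) ⬝ᵥ x ω = 0) ∧ 0 ≤ m ω ∧
          (τ ω).mulVec (x ω) = (m ω : ℂ) • star (x ω) := by
  have hH := mmul (conjTranspose hτ) hτ
  obtain ⟨μ, hμ, hμ'⟩ := Comp.exists_eigenvalues hH
  let Z : Fin 4 × Fin 4 → ℕ → (ℕ → ℝ) → Fin 4 → ℂ := fun jt s ω =>
    _root_.shiftedSeq ((τ ω).conjTranspose * τ ω) (μ ω) (_root_.rejection k (v ω) (Pi.single jt.1 1)) s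
  have hZ : ∀ jt s, Comp D (Z jt s) := fun jt s =>
    shiftedSeq hH hμ (rejection hv fun i => by
      by_cases h : i = jt.1
      · subst h; simpa using cone
      · simpa [h] using czero) s
  obtain ⟨g, hg, hsel⟩ := exists_comp_select
    (p := fun jt ω => ¬ Z jt jt.2 ω = 0 ∧ Z jt (jt.2 + 1) ω = 0)
    (f := fun jt ω => ((Z jt jt.2 ω, μ ω jt.2) : (Fin 4 → ℂ) × ℝ))
    (fun jt => (vec_eq_pred (hZ _ _) vzero).not.and (vec_eq_pred (hZ _ _) vzero))
    (fun jt => pair (hZ _ _) (hμ _))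
  have hl : CompReal D fun ω => √(g ω).2 := CompReal.sqrt hg.2
  have ha : Comp D fun ω => star ((τ ω).mulVec (g ω).1) + ((√(g ω).2 : ℝ) : ℂ) • (g ω).1 :=
    vadd (vstar (mulVec hτ hg.1)) (vsmul (ofReal hl) hg.1)
  have hx := unitVec (cond (vec_eq_pred ha vzero) (vsmul cI hg.1) ha)
  refine ⟨_, _, hx, hl, fun ω hsymm hon l hco => ?_⟩
  have hherm : ((τ ω).conjTranspose * τ ω).IsHermitian :=
    Matrix.isHermitian_conjTranspose_mul_self _
  obtain ⟨σ, hσ⟩ := hμ' ω hherm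
  obtain ⟨j, hj⟩ := exists_rejection_ne_zero hk hon
  obtain ⟨t, ht0, ht1⟩ := exists_shiftedSeq_eigenvector hherm σ hj
  rw [← hσ] at ht0 ht1
  obtain ⟨⟨j', t'⟩, ⟨hz0, hz1⟩, hgz⟩ := hsel ω ⟨(j, t), ht0, ht1⟩
  have hy0 : (g ω).1 ≠ 0 := by rw [hgz]; exact hz0
  have hm0 : 0 ≤ (g ω).2 := by
    rw [hgz]
    simp only [hσ, Function.comp]
    exact (Matrix.posSemidef_conjTranspose_mul_self (τ ω)).eigenvalues_nonneg _
  have hyH : ((τ ω).conjTranspose * τ ω).mulVec (g ω).1 = (((√(g ω).2) ^ 2 : ℝ) : ℂ) • (g ω).1 := by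
    rw [Real.sq_sqrt hm0, hgz]
    have h := hz1
    simp only [Z, shiftedSeq_succ, sub_eq_zero] at h
    simpa using h
  have hyorth : ∀ i : Fin 4, i.1 < k → star (v ω i) ⬝ᵥ (g ω).1 = 0 := by
    intro i hi
    rw [hgz]
    obtain ⟨-, hvi⟩ := hco i hi
    -- Moving `τ` to the left factor reduces the inner product of `v i` with `τ† τ y` to that of
    -- `conj (v i)` with `τ y`, which vanishes by the antilinear invariance.
    have : ∀ s, star (v ω i) ⬝ᵥ Z (j', t') s ω = 0 := by
      intro s
      induction s with
      | zero => exact dotProduct_rejection hon _ hi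
      | succ s ih =>
        have h1 := star_dotProduct_conj hsymm hvi ih
        have h2 : star (v ω i) ⬝ᵥ ((τ ω).conjTranspose * τ ω).mulVec (Z (j', t') s ω) = 0 := by
          rw [← Matrix.mulVec_mulVec, Matrix.dotProduct_mulVec, ← Matrix.star_mulVec, hvi,
            star_smul, star_star, smul_dotProduct]
          have h3 : star (star (v ω i) ⬝ᵥ star ((τ ω).mulVec (Z (j', t') s ω))) = 0 := by
            rw [h1, star_zero]
          rw [Matrix.star_dotProduct_star, star_star, dotProduct_comm] at h3
          rw [h3, smul_zero]
        simp only [Z, shiftedSeq_succ] at h2 ih ⊢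
        rw [dotProduct_sub, h2, dotProduct_smul, ih, smul_zero, sub_zero]
    exact this _
  have key : ∀ y : Fin 4 → ℂ, y ≠ 0 → (∀ i : Fin 4, i.1 < k → star (v ω i) ⬝ᵥ y = 0) →
      (τ ω).mulVec y = ((√(g ω).2 : ℝ) : ℂ) • star y →
      star (_root_.unitVec y) ⬝ᵥ _root_.unitVec y = 1 ∧
      (∀ i : Fin 4, i.1 < k → star (v ω i) ⬝ᵥ _root_.unitVec y = 0) ∧ 0 ≤ √(g ω).2 ∧
      (τ ω).mulVec (_root_.unitVec y) = ((√(g ω).2 : ℝ) : ℂ) • star (_root_.unitVec y) := by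
    intro y h1 h2 h3
    refine ⟨star_unitVec_dotProduct h1, fun i hi => ?_, Real.sqrt_nonneg _, ?_⟩
    · rw [_root_.unitVec, dotProduct_smul, h2 i hi, smul_zero]
    · rw [_root_.unitVec, Matrix.mulVec_smul, h3, star_smul, smul_comm]
      simp
  by_cases hcase : star ((τ ω).mulVec (g ω).1) + ((√(g ω).2 : ℝ) : ℂ) • (g ω).1 = 0
  -- Here `conj (τ y) = -m y`; the factor `I` changes the sign because the map is antilinear.
  · simp only [if_pos hcase]
    refine key _ ?_ ?_ ?_
    · simpa using hy0
    · intro i hi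
      rw [dotProduct_smul, hyorth i hi, smul_zero]
    · have h := congrArg star (eq_neg_of_add_eq_zero_left hcase)
      rw [star_star] at h
      rw [Matrix.mulVec_smul, h]
      funext i
      simp
      ring
  · simp only [if_neg hcase]
    refine key _ hcase ?_ (mulVec_conj_add hsymm hyH)
    intro i hi
    rw [dotProduct_add, star_dotProduct_conj hsymm (hco i hi).2 (hyorth i hi), dotProduct_smul,
      hyorth i hi, smul_zero, add_zero]

theorem Comp.exists_coneigenvectors {D : ℕ} {τ : (ℕ → ℝ) → Matrix (Fin 4) (Fin 4) ℂ}
    (hτ : Comp D τ) {k : ℕ} (hk : k ≤ 4) :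
    ∃ (v : (ℕ → ℝ) → Fin 4 → Fin 4 → ℂ) (l : (ℕ → ℝ) → Fin 4 → ℝ), Comp D v ∧ Comp D l ∧
      ∀ ω, (τ ω).transpose = τ ω →
        OrthonormalBelow k (v ω) ∧ ConeigenBelow k (τ ω) (v ω) (l ω) := by
  induction k with
  | zero =>
    exact ⟨fun _ _ => 0, fun _ _ => 0, fun _ => vzero, fun _ => CompReal.zero, fun ω _ =>
      ⟨fun i j hi => absurd hi (by omega), fun i hi => absurd hi (by omega)⟩⟩
  | succ k ih =>
    obtain ⟨v, l, hv, hl, h⟩ := ih (by omega)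
    obtain ⟨x, m, hx, hm, h'⟩ := exists_next_coneigenvector (by omega : k < 4) hτ hv
    refine ⟨fun ω i => if i.1 = k then x ω else v ω i, fun ω i => if i.1 = k then m ω else l ω i,
      fun i => ?_, fun i => ?_, fun ω hω => ?_⟩
    · by_cases hi : i.1 = k
      · simpa only [hi, if_true] using hx
      · simpa only [hi, if_false] using hv i
    · by_cases hi : i.1 = k
      · simpa only [hi, if_true] using hm
      · simpa only [hi, if_false] using hl i
    · obtain ⟨hon, hco⟩ := h ω hω
      obtain ⟨hxx, hvx, hm0, hxm⟩ := h' ω hω hon _ hco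
      constructor
      · intro i j hi hj
        by_cases h1 : i.1 = k <;> by_cases h2 : j.1 = k
        · have : i = j := Fin.ext (h1.trans h2.symm)
          simp only [h2, this, if_true, hxx]
        · have : i ≠ j := fun h => h2 (h ▸ h1)
          simp only [h1, h2, this, if_true, if_false]
          rw [Matrix.star_dotProduct, hvx j (by omega), star_zero]
        · have : i ≠ j := fun h => h1 (h ▸ h2)
          simp only [h1, h2, this, if_true, if_false]
          exact hvx i (by omega)
        · simp only [h1, h2, if_false]
          exact hon i j (by omega) (by omega)
      · intro i hi
        by_cases h1 : i.1 = k
        · simp only [h1, if_true]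
          exact ⟨hm0, hxm⟩
        · simp only [h1, if_false]
          exact hco i (by omega)

/-- Takagi factorization, computably. -/
theorem Comp.exists_takagi {D : ℕ} {τ : (ℕ → ℝ) → Matrix (Fin 4) (Fin 4) ℂ} (hτ : Comp D τ) :
    ∃ (V : (ℕ → ℝ) → Matrix (Fin 4) (Fin 4) ℂ) (l : (ℕ → ℝ) → Fin 4 → ℝ), Comp D V ∧ Comp D l ∧
      ∀ ω, (τ ω).transpose = τ ω → (V ω).conjTranspose * V ω = 1 ∧ (∀ i, 0 ≤ l ω i) ∧
        (V ω).transpose * τ ω * V ω = Matrix.diagonal fun i => (l ω i : ℂ) := by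
  obtain ⟨v, l, hv, hl, h⟩ := exists_coneigenvectors hτ le_rfl
  refine ⟨fun ω => Matrix.of fun i j => v ω j i, l, fun i j => hv j i, hl, fun ω hω => ?_⟩
  obtain ⟨hon, hco⟩ := h ω hω
  refine ⟨?_, fun i => (hco i i.2).1, ?_⟩
  · ext i j
    rw [Matrix.one_apply, ← hon i j i.2 j.2]
    rfl
  · ext i j
    have h1 : ((Matrix.of fun i j => v ω j i).transpose * τ ω * Matrix.of fun i j => v ω j i) i j =
        v ω i ⬝ᵥ (τ ω).mulVec (v ω j) := by
      rw [mul_assoc]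
      rfl
    rw [h1, (hco j j.2).2, dotProduct_smul, Matrix.diagonal_apply, dotProduct_comm, hon j i j.2 i.2]
    by_cases hij : i = j
    · simp [hij]
    · simp [hij, Ne.symm hij]

/-! A unitary that equalizes the diagonal of a Takagi form. -/

namespace Comp

variable {D : ℕ}

theorem rmmul {l m n : Type*} [Fintype m] {A : (ℕ → ℝ) → Matrix l m ℝ}
    {B : (ℕ → ℝ) → Matrix m n ℝ} (hA : Comp D A) (hB : Comp D B) :
    Comp D fun ω => A ω * B ω := fun i j => by
  change CompReal D _
  simpa only [Matrix.mul_apply] using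
    CompReal.sum Finset.univ fun k _ => CompReal.mul (hA i k) (hB k j)

theorem rone {n : ℕ} : Comp D fun _ => (1 : Matrix (Fin n) (Fin n) ℝ) := fun i j => by
  change CompReal D _
  by_cases h : i = j
  · subst h; simpa using CompReal.one
  · simpa [Matrix.one_apply_ne h] using CompReal.zero

end Comp

/-- The columns of the rotation by the angle with cosine `c` and sine `s` in the coordinate plane
of `k` and `j`. -/
def planeRotationCol (k j : Fin 4) (c s : ℝ) (i : Fin 4) : Fin 4 → ℝ :=
  if i = k then Pi.single k c + Pi.single j s
  else if i = j then Pi.single k (-s) + Pi.single j c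
  else Pi.single i 1

/-- The rotation by the angle with cosine `c` and sine `s` in the coordinate plane of `k`, `j`. -/
def planeRotation (k j : Fin 4) (c s : ℝ) : Matrix (Fin 4) (Fin 4) ℝ :=
  Matrix.of fun a i => planeRotationCol k j c s i a

theorem planeRotation_transpose_mul_self {k j : Fin 4} (hkj : k ≠ j) {c s : ℝ}
    (h : c ^ 2 + s ^ 2 = 1) : (planeRotation k j c s).transpose * planeRotation k j c s = 1 := by
  ext a b
  have : ((planeRotation k j c s).transpose * planeRotation k j c s) a b =
      planeRotationCol k j c s a ⬝ᵥ planeRotationCol k j c s b := rfl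
  rw [this, Matrix.one_apply]
  unfold planeRotationCol
  by_cases hak : a = k <;> by_cases haj : a = j <;> by_cases hbk : b = k <;> by_cases hbj : b = j <;>
    by_cases hab : a = b <;> subst_vars <;> simp_all <;> grind

theorem planeRotation_conj_apply (S : Matrix (Fin 4) (Fin 4) ℝ) (k j : Fin 4) (c s : ℝ)
    (i : Fin 4) :
    ((planeRotation k j c s).transpose * S * planeRotation k j c s) i i =
      planeRotationCol k j c s i ⬝ᵥ S.mulVec (planeRotationCol k j c s i) := by
  rw [mul_assoc]
  rfl

theorem planeRotation_conj_apply_of_ne (S : Matrix (Fin 4) (Fin 4) ℝ) {k j i : Fin 4} (c s : ℝ)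
    (hk : i ≠ k) (hj : i ≠ j) :
    ((planeRotation k j c s).transpose * S * planeRotation k j c s) i i = S i i := by
  simp [planeRotation_conj_apply, planeRotationCol, hk, hj]

theorem planeRotation_conj_apply_self {S : Matrix (Fin 4) (Fin 4) ℝ} (hS : S.transpose = S)
    {k j : Fin 4} (c s : ℝ) :
    ((planeRotation k j c s).transpose * S * planeRotation k j c s) k k =
      c ^ 2 * S k k + 2 * c * s * S k j + s ^ 2 * S j j := by
  have h : S j k = S k j := congrFun (congrFun hS k) j
  simp [planeRotation_conj_apply, planeRotationCol, Matrix.mulVec_add, h]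
  ring

/-- The (not normalized) cosine of a rotation that annihilates a diagonal entry. -/
noncomputable def annihilatingCos (S : Matrix (Fin 4) (Fin 4) ℝ) (k j : Fin 4) : ℝ :=
  -S k j + √(S k j ^ 2 - S k k * S j j)

/-- A rotation in the coordinate plane of `k` and `j` that annihilates the `k`-th diagonal entry. -/
noncomputable def annihilatingRotation (S : Matrix (Fin 4) (Fin 4) ℝ) (k j : Fin 4) :
    Matrix (Fin 4) (Fin 4) ℝ :=
  planeRotation k j (annihilatingCos S k j / √(annihilatingCos S k j ^ 2 + S k k ^ 2))
    (S k k / √(annihilatingCos S k j ^ 2 + S k k ^ 2))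

/-- With `S k k` as unnormalized sine, the condition on the unnormalized cosine `x` is `x² + 2 x S k
j + S k k S j j = 0`. Opposite signs of the diagonal entries make its discriminant nonnegative, and
`S k k ≠ 0` keeps the normalizing factor positive. -/
theorem annihilatingRotation_spec {S : Matrix (Fin 4) (Fin 4) ℝ} (hS : S.transpose = S)
    {k j : Fin 4} (hkj : k ≠ j) (h0 : S k k ≠ 0) (h1 : S k k * S j j ≤ 0) :
    (annihilatingRotation S k j).transpose * annihilatingRotation S k j = 1 ∧
      ((annihilatingRotation S k j).transpose * S * annihilatingRotation S k j) k k = 0 := by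
  have hn : 0 < annihilatingCos S k j ^ 2 + S k k ^ 2 := by positivity
  have hn' := Real.sq_sqrt hn.le
  have hn0 : √(annihilatingCos S k j ^ 2 + S k k ^ 2) ≠ 0 := (Real.sqrt_pos.2 hn).ne'
  constructor
  · apply planeRotation_transpose_mul_self hkj
    field_simp
    rw [hn']
  · rw [annihilatingRotation, planeRotation_conj_apply_self hS]
    have hd : 0 ≤ S k j ^ 2 - S k k * S j j := by nlinarith [sq_nonneg (S k j)]
    have h : annihilatingCos S k j ^ 2 + 2 * annihilatingCos S k j * S k j + S k k * S j j = 0 := by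
      have := Real.sq_sqrt hd
      rw [annihilatingCos]
      linear_combination this
    field_simp
    linear_combination (S k k) * h

theorem Comp.annihilatingRotation {D : ℕ} {S : (ℕ → ℝ) → Matrix (Fin 4) (Fin 4) ℝ} (hS : Comp D S)
    (k j : Fin 4) : Comp D fun ω => annihilatingRotation (S ω) k j := by
  have hu : CompReal D fun ω => annihilatingCos (S ω) k j :=
    (CompReal.neg (hS k j)).add
      (((CompReal.pow (hS k j) 2).sub (CompReal.mul (hS k k) (hS j j))).sqrt)
  have hn := ((hu.pow 2).add (CompReal.pow (hS k k) 2)).sqrt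
  have hc := hu.div hn
  have hs := CompReal.div (hS k k) hn
  have h0 : CompReal D fun _ => (0 : ℝ) := CompReal.zero
  have h1 : CompReal D fun _ => (1 : ℝ) := CompReal.one
  have hsingle : ∀ (a b : Fin 4) {f : (ℕ → ℝ) → ℝ}, CompReal D f →
      CompReal D fun ω => (Pi.single b (f ω) : Fin 4 → ℝ) a := by
    intro a b f hf
    by_cases h : a = b
    · subst h; simpa using hf
    · simpa [h] using h0
  intro a i
  change CompReal D fun ω => planeRotationCol k j _ _ i a
  unfold planeRotationCol
  by_cases hik : i = k
  · simp only [hik, if_true, Pi.add_apply]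
    exact (hsingle _ _ hc).add (hsingle _ _ hs)
  · by_cases hij : i = j
    · simp only [if_neg hik, if_pos hij, Pi.add_apply]
      exact (hsingle _ _ hs.neg).add (hsingle _ _ hc)
    · simp only [if_neg hik, if_neg hij]
      exact hsingle _ _ h1

/-- As the trace and the earlier entries vanish, a nonzero `S k k` is compensated by a later entry
of opposite sign. Rotating in the plane of these two coordinates leaves the earlier diagonal entries
alone. -/
theorem Comp.exists_annihilate_next {D : ℕ} {S : (ℕ → ℝ) → Matrix (Fin 4) (Fin 4) ℝ}
    (hS : Comp D S) (k : Fin 4) :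
    ∃ R : (ℕ → ℝ) → Matrix (Fin 4) (Fin 4) ℝ, Comp D R ∧ ∀ ω, (S ω).transpose = S ω →
      (S ω).trace = 0 → (∀ i < k, S ω i i = 0) →
      (R ω).transpose * R ω = 1 ∧ ∀ i ≤ k, ((R ω).transpose * S ω * R ω) i i = 0 := by
  classical
  obtain ⟨R, hR, hsel⟩ := exists_comp_select (D := D)
    (p := fun (j : Fin 4) ω => if j = k then S ω k k = 0 else
      k < j ∧ ¬ S ω k k = 0 ∧ S ω k k * S ω j j ≤ 0)
    (f := fun j ω => if j = k then 1 else _root_.annihilatingRotation (S ω) k j)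
    (fun j => by
      by_cases h : j = k
      · simpa only [h, if_true] using CompPred.eq (hS k k) CompReal.zero
      · simpa only [h, if_false] using (CompPred.const _).and ((CompPred.eq (hS k k)
          CompReal.zero).not.and (CompPred.le (CompReal.mul (hS k k) (hS j j)) CompReal.zero)))
    (fun j => by
      by_cases h : j = k
      · simpa only [h, if_true] using rone
      · simpa only [h, if_false] using annihilatingRotation hS k j)
  refine ⟨R, hR, fun ω hsymm htr hlt => ?_⟩
  obtain ⟨j, hj, hRj⟩ : _ := hsel ω (by
    by_contra! hno
    have hk := hno k
    rw [if_pos rfl] at hk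
    have hpos : 0 < ∑ j, S ω k k * S ω j j := by
      refine Finset.sum_pos' (fun j _ => ?_) ⟨k, Finset.mem_univ k, mul_self_pos.2 hk⟩
      rcases lt_trichotomy j k with h | h | h
      · rw [hlt j h, mul_zero]
      · subst h; exact mul_self_nonneg _
      · have := hno j
        rw [if_neg h.ne'] at this
        push Not at this
        exact (this h hk).le
    rw [← Finset.mul_sum] at hpos
    have : ∑ j, S ω j j = 0 := htr
    rw [this, mul_zero] at hpos
    exact lt_irrefl _ hpos)
  rw [hRj]
  by_cases hjk : j = k
  · simp only [hjk, if_true] at hj ⊢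
    refine ⟨by simp, fun i hi => ?_⟩
    rcases hi.lt_or_eq with h | rfl
    · simpa using hlt i h
    · simpa using hj
  · simp only [hjk, if_false] at hj ⊢
    obtain ⟨h1, h2⟩ := annihilatingRotation_spec hsymm (Ne.symm hjk) hj.2.1 hj.2.2
    refine ⟨h1, fun i hi => ?_⟩
    rcases hi.lt_or_eq with h | rfl
    · rw [_root_.annihilatingRotation, planeRotation_conj_apply_of_ne _ _ _ h.ne (h.trans hj.1).ne]
      exact hlt i h
    · exact h2

/-- A real symmetric matrix of trace zero is orthogonally similar to one with zero diagonal. -/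
theorem Comp.exists_orthogonal_diag_eq_zero {D : ℕ} {S : (ℕ → ℝ) → Matrix (Fin 4) (Fin 4) ℝ}
    (hS : Comp D S) :
    ∃ R : (ℕ → ℝ) → Matrix (Fin 4) (Fin 4) ℝ, Comp D R ∧ ∀ ω, (S ω).transpose = S ω →
      (S ω).trace = 0 →
      (R ω).transpose * R ω = 1 ∧ ∀ i, ((R ω).transpose * S ω * R ω) i i = 0 := by
  have key : ∀ k : ℕ, k ≤ 4 → ∃ R : (ℕ → ℝ) → Matrix (Fin 4) (Fin 4) ℝ, Comp D R ∧
      ∀ ω, (S ω).transpose = S ω → (S ω).trace = 0 →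
      (R ω).transpose * R ω = 1 ∧ ∀ i : Fin 4, i.1 < k → ((R ω).transpose * S ω * R ω) i i = 0 := by
    intro k
    induction k with
    | zero =>
      refine fun _ => ⟨fun _ => 1, rone, fun ω _ _ => ⟨by simp, fun i hi => by omega⟩⟩
    | succ k ih =>
      intro hk
      obtain ⟨R, hR, h⟩ := ih (by omega)
      have hS' : Comp D fun ω => (R ω).transpose * S ω * R ω :=
        rmmul (rmmul (fun i j => hR j i) hS) hR
      obtain ⟨Q, hQ, h'⟩ := exists_annihilate_next hS' ⟨k, by omega⟩
      refine ⟨_, rmmul hR hQ, fun ω hsymm htr => ?_⟩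
      obtain ⟨h1, h2⟩ := h ω hsymm htr
      obtain ⟨h3, h4⟩ := h' ω (by simp [Matrix.transpose_mul, hsymm, mul_assoc])
        (by rw [Matrix.trace_mul_comm, ← mul_assoc, mul_eq_one_comm.1 h1, one_mul, htr])
        (fun i hi => h2 i hi)
      refine ⟨?_, fun i hi => ?_⟩
      · rw [Matrix.transpose_mul, mul_assoc, ← mul_assoc _ (R ω), h1, one_mul, h3]
      · have := h4 i (Fin.le_def.2 (by simp; omega))
        rw [Matrix.transpose_mul]
        simpa only [mul_assoc] using this
  obtain ⟨R, hR, h⟩ := key 4 le_rfl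
  exact ⟨R, hR, fun ω h1 h2 => ⟨(h ω h1 h2).1, fun i => (h ω h1 h2).2 i i.2⟩⟩

/-! ### Phases that close a polygon. -/

/-- The sides of a triangle as plane vectors. -/
theorem Comp.exists_triangle {D : ℕ} {a b m : (ℕ → ℝ) → ℝ} (ha : CompReal D a) (hb : CompReal D b)
    (hm : CompReal D m) :
    ∃ z w : (ℕ → ℝ) → ℂ, Comp D z ∧ Comp D w ∧ ∀ ω, 0 ≤ a ω → 0 ≤ b ω → |a ω - b ω| ≤ m ω →
      m ω ≤ a ω + b ω → Complex.normSq (z ω) = 1 ∧ Complex.normSq (w ω) = 1 ∧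
        (a ω : ℂ) * z ω + (b ω : ℂ) * w ω = m ω := by
  classical
  -- By the law of cosines this is the projection of the side `a` onto the side `m`.
  have hx : CompReal D fun ω => (m ω ^ 2 + a ω ^ 2 - b ω ^ 2) / (2 * m ω) :=
    (((hm.pow 2).add (ha.pow 2)).sub (hb.pow 2)).div (CompReal.ofNat.mul hm)
  obtain ⟨x, hx, hx'⟩ : ∃ e : (ℕ → ℝ) → ℝ, CompReal D e ∧
      ∀ ω, e ω = (m ω ^ 2 + a ω ^ 2 - b ω ^ 2) / (2 * m ω) := ⟨_, hx, fun _ => rfl⟩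
  obtain ⟨y, hy, hy'⟩ : ∃ e : (ℕ → ℝ) → ℝ, CompReal D e ∧
      ∀ ω, e ω = √(a ω ^ 2 - x ω ^ 2) := ⟨_, ((ha.pow 2).sub (hx.pow 2)).sqrt, fun _ => rfl⟩
  have h0 : ∀ {f : (ℕ → ℝ) → ℝ}, CompReal D f → CompPred D fun ω => f ω = 0 :=
    fun hf => CompPred.eq hf CompReal.zero
  -- For `m = 0` the sides are equal, and opposite directions cancel. A side of length zero gets the
  -- direction 1 so that it still has modulus one.
  refine ⟨_, _, cond (h0 hm) cone (cond (h0 ha) cone (mk (hx.div ha) (hy.div ha))),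
    cond (h0 hm) (cneg cone) (cond (h0 hb) cone (mk ((hm.sub hx).div hb) (hy.neg.div hb))),
    fun ω ha0 hb0 h1 h2 => ?_⟩
  rw [abs_le] at h1
  by_cases hm0 : m ω = 0
  · have : a ω = b ω := by linarith
    simp [hm0, this]
  have hmpos : 0 < m ω := lt_of_le_of_ne (by linarith) (Ne.symm hm0)
  have hxm : 2 * m ω * x ω = m ω ^ 2 + a ω ^ 2 - b ω ^ 2 := by
    rw [hx']; field_simp
  have hge : 0 ≤ a ω ^ 2 - x ω ^ 2 := by
    have h3 : 0 ≤ (2 * m ω) ^ 2 * (a ω ^ 2 - x ω ^ 2) := by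
      -- Heron's factorization: each factor is nonnegative by a triangle inequality.
      have : (2 * m ω) ^ 2 * (a ω ^ 2 - x ω ^ 2) =
          ((m ω + a ω - b ω) * (m ω + a ω + b ω)) * ((b ω - m ω + a ω) * (b ω + m ω - a ω)) := by
        have : (2 * m ω) ^ 2 * (a ω ^ 2 - x ω ^ 2) =
          (2 * m ω * a ω) ^ 2 - (2 * m ω * x ω) ^ 2 := by ring
        rw [this, hxm]; ring
      rw [this]
      exact mul_nonneg (mul_nonneg (by linarith) (by linarith))
        (mul_nonneg (by linarith) (by linarith))
    exact nonneg_of_mul_nonneg_right h3 (by positivity)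
  have hy2 : y ω ^ 2 = a ω ^ 2 - x ω ^ 2 := by rw [hy', Real.sq_sqrt hge]
  simp only [hm0, if_false]
  refine ⟨?_, ?_, ?_⟩
  · by_cases ha1 : a ω = 0
    · simp [ha1]
    · simp only [ha1, if_false, Complex.normSq_mk]
      field_simp
      linear_combination hy2
  · by_cases hb1 : b ω = 0
    · simp [hb1]
    · simp only [hb1, if_false, Complex.normSq_mk]
      field_simp
      linear_combination hy2 - hxm
  · have e1 : (a ω : ℂ) * (if a ω = 0 then 1 else ⟨x ω / a ω, y ω / a ω⟩) = ⟨x ω, y ω⟩ := by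
      by_cases ha1 : a ω = 0
      · have h3 : x ω = 0 := by
          rw [ha1] at hge
          nlinarith [sq_nonneg (x ω)]
        have h4 : y ω = 0 := by
          rw [ha1, h3] at hy2
          simpa using hy2
        simp [ha1, h3, h4, Complex.ext_iff]
      · simp [ha1, Complex.ext_iff]
        constructor <;> field_simp
    have e2 : (b ω : ℂ) * (if b ω = 0 then 1 else ⟨(m ω - x ω) / b ω, -y ω / b ω⟩) =
        ⟨m ω - x ω, -y ω⟩ := by
      by_cases hb1 : b ω = 0
      · have h5 : (m ω - x ω) ^ 2 + y ω ^ 2 = 0 := by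
          rw [hb1] at hxm
          linear_combination hy2 - hxm
        have h3 : m ω - x ω = 0 := by nlinarith [sq_nonneg (m ω - x ω), sq_nonneg (y ω)]
        have h4 : y ω = 0 := by nlinarith [sq_nonneg (m ω - x ω), sq_nonneg (y ω)]
        simp [hb1, h3, h4, Complex.ext_iff]
      · simp [hb1, Complex.ext_iff]
        constructor <;> field_simp
    rw [e1, e2]
    simp [Complex.ext_iff]

/-- Half-angle formulas give both parts up to sign. The real part is taken nonnegative, so the
imaginary part must carry the sign of `Im z`. -/
theorem Comp.exists_unit_sqrt {D : ℕ} {z : (ℕ → ℝ) → ℂ} (hz : Comp D z) :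
    ∃ w : (ℕ → ℝ) → ℂ, Comp D w ∧ ∀ ω, Complex.normSq (z ω) = 1 →
      star (w ω) * w ω = 1 ∧ w ω * w ω = z ω := by
  have h1 := ((CompReal.one.add hz.re).div CompReal.ofNat).sqrt (D := D)
    (f := fun ω => (1 + (z ω).re) / 2)
  have h2 := ((CompReal.one.sub hz.re).div CompReal.ofNat).sqrt (D := D)
    (f := fun ω => (1 - (z ω).re) / 2)
  refine ⟨_, mk h1 (CompReal.ite CompReal.zero hz.im h2 h2.neg), fun ω hω => ?_⟩
  rw [Complex.normSq_apply] at hω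
  have hle : |(z ω).re| ≤ 1 := by
    rw [← abs_one, ← sq_le_sq]
    nlinarith [mul_self_nonneg (z ω).im]
  rw [abs_le] at hle
  have e1 := Real.sq_sqrt (show 0 ≤ (1 + (z ω).re) / 2 by linarith)
  have e2 := Real.sq_sqrt (show 0 ≤ (1 - (z ω).re) / 2 by linarith)
  have e3 : √((1 + (z ω).re) / 2) * √((1 - (z ω).re) / 2) = |(z ω).im| / 2 := by
    rw [← Real.sqrt_mul (by linarith), ← Real.sqrt_sq (show 0 ≤ |(z ω).im| / 2 by positivity),
      div_pow, sq_abs]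
    congr 1
    linarith
  constructor <;> split_ifs with h <;> simp only [Complex.ext_iff, Complex.mul_re, Complex.mul_im,
    Complex.star_def, Complex.conj_re, Complex.conj_im, Complex.one_re, Complex.one_im]
  · constructor <;> linarith
  · constructor <;> linarith
  · rw [abs_of_nonneg h] at e3
    constructor <;> linarith
  · rw [abs_of_neg (not_le.1 h)] at e3
    constructor <;> linarith

/-- Four sides of a closed polygon as plane vectors. -/
theorem Comp.exists_polygon {D : ℕ} {l : (ℕ → ℝ) → Fin 4 → ℝ} (hl : Comp D l) :
    ∃ z : (ℕ → ℝ) → Fin 4 → ℂ, Comp D z ∧ ∀ ω, (∀ i, 0 ≤ l ω i) →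
      (∀ k, 2 * l ω k ≤ ∑ i, l ω i) →
      (∀ i, Complex.normSq (z ω i) = 1) ∧ ∑ i, (l ω i : ℂ) * z ω i = 0 := by
  -- The quadrilateral is cut along a diagonal into two triangles. The larger of the two lower
  -- bounds is an admissible length for the diagonal, since the polygon inequalities put it below
  -- both upper bounds.
  have hm : CompReal D fun ω => max |l ω 0 - l ω 1| |l ω 2 - l ω 3| :=
    (CompReal.sub (hl 0) (hl 1)).abs.max (CompReal.sub (hl 2) (hl 3)).abs
  obtain ⟨z₀, z₁, hz₀, hz₁, h⟩ := exists_triangle (hl 0) (hl 1) hm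
  obtain ⟨z₂, z₃, hz₂, hz₃, h'⟩ := exists_triangle (hl 2) (hl 3) hm
  refine ⟨fun ω => ![z₀ ω, z₁ ω, -z₂ ω, -z₃ ω], fun i => ?_, fun ω h0 hle => ?_⟩
  · fin_cases i
    exacts [hz₀, hz₁, cneg hz₂, cneg hz₃]
  have l0 := h0 0
  have l1 := h0 1
  have l2 := h0 2
  have l3 := h0 3
  have k0 := hle 0
  have k1 := hle 1
  have k2 := hle 2
  have k3 := hle 3
  rw [Fin.sum_univ_four] at k0 k1 k2 k3
  obtain ⟨a1, a2, a3⟩ := h ω l0 l1 (le_max_left _ _) (max_le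
    (abs_le.2 ⟨by linarith, by linarith⟩) (abs_le.2 ⟨by linarith, by linarith⟩))
  obtain ⟨b1, b2, b3⟩ := h' ω l2 l3 (le_max_right _ _) (max_le
    (abs_le.2 ⟨by linarith, by linarith⟩) (abs_le.2 ⟨by linarith, by linarith⟩))
  constructor
  · intro i
    fin_cases i <;> simp [a1, a2, b1, b2]
  · rw [Fin.sum_univ_four]
    simp
    linear_combination a3 - b3

/-- A real orthogonal matrix with entries `± 1 / 2`. -/
noncomputable def hadamardFour : Matrix (Fin 4) (Fin 4) ℂ :=
  (1 / 2 : ℂ) • !![1, 1, 1, 1; 1, -1, 1, -1; 1, 1, -1, -1; 1, -1, -1, 1]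

theorem hadamardFour_conjTranspose_mul_self : hadamardFour.conjTranspose * hadamardFour = 1 := by
  ext i j
  fin_cases i <;> fin_cases j <;>
    simp [hadamardFour, Matrix.mul_apply, Fin.sum_univ_four, Complex.conj_ofNat] <;> norm_num

theorem hadamardFour_mul_self_apply (i j : Fin 4) : hadamardFour i j * hadamardFour i j = 1 / 4 := by
  fin_cases i <;> fin_cases j <;> simp [hadamardFour] <;> norm_num

theorem Comp.hadamardFour {D : ℕ} : Comp D fun _ => hadamardFour := by
  have h1 : Comp D fun _ => (1 / 2 : ℂ) :=
    ⟨CompReal.const (1 / 2) (by norm_num), CompReal.const 0 (by norm_num)⟩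
  intro i j
  fin_cases i <;> fin_cases j <;>
    simp only [_root_.hadamardFour, Matrix.smul_apply] <;> simp <;>
    first | simpa using h1 | simpa using cneg h1

theorem Comp.diagonal {D : ℕ} {w : (ℕ → ℝ) → Fin 4 → ℂ} (hw : Comp D w) :
    Comp D fun ω => Matrix.diagonal (w ω) := fun i j => by
  by_cases h : i = j
  · subst h; simpa using hw i
  · simpa [h] using czero

theorem Comp.ofRealMatrix {D : ℕ} {A : (ℕ → ℝ) → Matrix (Fin 4) (Fin 4) ℝ} (hA : Comp D A) :
    Comp D fun ω => (A ω).map ((↑) : ℝ → ℂ) := fun i j => ofReal (hA i j)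

theorem diagonal_conjTranspose_mul_self {w : Fin 4 → ℂ} (hw : ∀ i, star (w i) * w i = 1) :
    (Matrix.diagonal w).conjTranspose * Matrix.diagonal w = 1 := by
  rw [Matrix.diagonal_conjTranspose, Matrix.diagonal_mul_diagonal, ← Matrix.diagonal_one]
  congr 1
  funext i
  exact hw i

theorem conjTranspose_mul_self_mul {V W : Matrix (Fin 4) (Fin 4) ℂ}
    (hV : V.conjTranspose * V = 1) (hW : W.conjTranspose * W = 1) :
    (V * W).conjTranspose * (V * W) = 1 := by
  rw [Matrix.conjTranspose_mul, mul_assoc, ← mul_assoc _ V, hV, one_mul, hW]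

/-! ### Optimal mixings from a Takagi form. -/

/-- `V` brings the symmetric matrix `τ` to a form whose diagonal is `C` times the diagonal of the
Gram matrix `V† G V / Tr G`, where `C` is the concurrence that belongs to `τ`. -/
def IsOptimalMixing (τ G V : Matrix (Fin 4) (Fin 4) ℂ) : Prop :=
  V.conjTranspose * V = 1 ∧ ∃ C : ℝ, 0 ≤ C ∧
    (∀ j, (V.transpose * τ * V) j j * G.trace = C * (V.conjTranspose * G * V) j j) ∧
    (C = 0 ∨ ∃ (V₀ : Matrix (Fin 4) (Fin 4) ℂ) (l : Fin 4 → ℝ) (k : Fin 4),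
      V₀.conjTranspose * V₀ = 1 ∧ (∀ i, 0 ≤ l i) ∧
      V₀.transpose * τ * V₀ = Matrix.diagonal (fun i => (l i : ℂ)) ∧ C = 2 * l k - ∑ i, l i)

/-- Diagonal square roots of the closing phases turn the Takagi values into `l i * z i` with sum
zero. All squared entries of `hadamardFour` equal 1/4, so after it each diagonal entry is a quarter
of that sum, and `C = 0`. -/
theorem Comp.exists_isOptimalMixing_of_le {D : ℕ} {τ G : (ℕ → ℝ) → Matrix (Fin 4) (Fin 4) ℂ}
    {V : (ℕ → ℝ) → Matrix (Fin 4) (Fin 4) ℂ} {l : (ℕ → ℝ) → Fin 4 → ℝ} (hV : Comp D V)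
    (hl : Comp D l) :
    ∃ W : (ℕ → ℝ) → Matrix (Fin 4) (Fin 4) ℂ, Comp D W ∧ ∀ ω,
      (V ω).conjTranspose * V ω = 1 → (∀ i, 0 ≤ l ω i) →
      (V ω).transpose * τ ω * V ω = Matrix.diagonal (fun i => (l ω i : ℂ)) →
      (∀ k, 2 * l ω k ≤ ∑ i, l ω i) → IsOptimalMixing (τ ω) (G ω) (W ω) := by
  obtain ⟨z, hz, h⟩ := exists_polygon hl
  choose w hw hw' using fun i => exists_unit_sqrt (hz i)
  refine ⟨_, mmul hV (mmul (diagonal (w := fun ω i => w i ω) hw) hadamardFour),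
    fun ω hVV hl0 hτ hle => ?_⟩
  obtain ⟨hz1, hz2⟩ := h ω hl0 hle
  refine ⟨conjTranspose_mul_self_mul hVV (conjTranspose_mul_self_mul
    (diagonal_conjTranspose_mul_self fun i => (hw' i ω (hz1 i)).1)
    hadamardFour_conjTranspose_mul_self), 0, le_rfl, fun j => ?_, Or.inl rfl⟩
  have h1 : (V ω * (Matrix.diagonal (fun i => w i ω) * _root_.hadamardFour)).transpose * τ ω *
      (V ω * (Matrix.diagonal (fun i => w i ω) * _root_.hadamardFour)) =
      _root_.hadamardFour.transpose * (Matrix.diagonal (fun i => w i ω) *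
        ((V ω).transpose * τ ω * V ω) * Matrix.diagonal (fun i => w i ω)) * _root_.hadamardFour := by
    simp only [Matrix.transpose_mul, Matrix.diagonal_transpose, mul_assoc]
  have h2 : ∀ i, w i ω * (l ω i : ℂ) * w i ω = l ω i * z ω i := fun i => by
    rw [← (hw' i ω (hz1 i)).2]; ring
  rw [h1, hτ, Matrix.diagonal_mul_diagonal, Matrix.diagonal_mul_diagonal]
  simp only [h2]
  rw [Matrix.mul_apply]
  simp only [Matrix.mul_diagonal, Matrix.transpose_apply]
  have h3 : ∑ i, _root_.hadamardFour i j * (l ω i * z ω i) * _root_.hadamardFour i j =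
      1 / 4 * ∑ i, (l ω i : ℂ) * z ω i := by
    rw [Finset.mul_sum]
    refine Finset.sum_congr rfl fun i _ => ?_
    rw [← hadamardFour_mul_self_apply i j]; ring
  rw [h3, hz2]
  simp

theorem ofRealMatrix_conj_apply_re (M : Matrix (Fin 4) (Fin 4) ℂ) (R : Matrix (Fin 4) (Fin 4) ℝ)
    (j : Fin 4) :
    (((R.map ((↑) : ℝ → ℂ)).transpose * M * R.map ((↑) : ℝ → ℂ)) j j).re =
      (R.transpose * M.map Complex.re * R) j j := by
  simp [Matrix.mul_apply]

theorem ofRealMatrix_conj_apply_im (M : Matrix (Fin 4) (Fin 4) ℂ) (R : Matrix (Fin 4) (Fin 4) ℝ)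
    (j : Fin 4) :
    (((R.map ((↑) : ℝ → ℂ)).transpose * M * R.map ((↑) : ℝ → ℂ)) j j).im =
      (R.transpose * M.map Complex.im * R) j j := by
  simp [Matrix.mul_apply]

theorem ofRealMatrix_conjTranspose (R : Matrix (Fin 4) (Fin 4) ℝ) :
    (R.map ((↑) : ℝ → ℂ)).conjTranspose = (R.map ((↑) : ℝ → ℂ)).transpose := by
  ext i j
  simp

/-- The phases make `τ` real diagonal with trace `C = 2 l k - ∑ l i`. A real orthogonal matrix acts
on the tangle form and on the Gram matrix by the same conjugation, so both fit into the single real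
symmetric matrix `Tr G · τ' - C · Re G'`, which has trace zero. Making its diagonal vanish gives
every mixed vector the ratio `C`. -/
theorem Comp.exists_isOptimalMixing_of_lt {D : ℕ} {τ G : (ℕ → ℝ) → Matrix (Fin 4) (Fin 4) ℂ}
    {V : (ℕ → ℝ) → Matrix (Fin 4) (Fin 4) ℂ} {l : (ℕ → ℝ) → Fin 4 → ℝ} (hτ : Comp D τ)
    (hG : Comp D G) (hV : Comp D V) (k : Fin 4) :
    ∃ W : (ℕ → ℝ) → Matrix (Fin 4) (Fin 4) ℂ, Comp D W ∧ ∀ ω, (G ω).IsHermitian →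
      (V ω).conjTranspose * V ω = 1 → (∀ i, 0 ≤ l ω i) →
      (V ω).transpose * τ ω * V ω = Matrix.diagonal (fun i => (l ω i : ℂ)) →
      ∑ i, l ω i ≤ 2 * l ω k → IsOptimalMixing (τ ω) (G ω) (W ω) := by
  classical
  -- The form is bilinear, so the phase `I` multiplies a diagonal entry by `-1`: all values but the
  -- dominant one change sign.
  obtain ⟨d, hd⟩ : ∃ d : Fin 4 → ℂ, d = fun i => if i = k then 1 else Complex.I := ⟨_, rfl⟩
  have hdc : Comp D fun _ => Matrix.diagonal d := diagonal fun i => by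
    by_cases h : i = k
    · simpa [hd, h] using cone
    · simpa [hd, h] using cI
  have hY := mmul hV hdc
  have hT := mmul (mmul (transpose hY) hτ) hY
  have hK := mmul (mmul (conjTranspose hY) hG) hY
  have hS : Comp D fun ω => Matrix.of fun i j =>
      (G ω).trace.re * (((V ω * Matrix.diagonal d).transpose * τ ω * (V ω * Matrix.diagonal d)) i j).re -
      (((V ω * Matrix.diagonal d).transpose * τ ω * (V ω * Matrix.diagonal d)).trace).re *
        (((V ω * Matrix.diagonal d).conjTranspose * G ω * (V ω * Matrix.diagonal d)) i j).re :=
    fun i j => ((re (trace hG)).mul (re (hT i j))).sub ((re (trace hT)).mul (re (hK i j)))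
  obtain ⟨R, hR, h⟩ := exists_orthogonal_diag_eq_zero hS
  refine ⟨_, mmul hY (ofRealMatrix hR), fun ω hGH hVV hl0 hVτ hle => ?_⟩
  set Y := V ω * Matrix.diagonal d with hYdef
  set c : ℝ := 2 * l ω k - ∑ i, l ω i with hc
  have hYY : Y.conjTranspose * Y = 1 := conjTranspose_mul_self_mul hVV
    (diagonal_conjTranspose_mul_self fun i => by by_cases h : i = k <;> simp [hd, h])
  have hYτ : Y.transpose * τ ω * Y =
      (Matrix.diagonal fun i => if i = k then l ω i else -l ω i).map ((↑) : ℝ → ℂ) := by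
    have h1 : Y.transpose * τ ω * Y =
        Matrix.diagonal d * ((V ω).transpose * τ ω * V ω) * Matrix.diagonal d := by
      simp only [hYdef, Matrix.transpose_mul, Matrix.diagonal_transpose, mul_assoc]
    rw [h1, hVτ, Matrix.diagonal_mul_diagonal, Matrix.diagonal_mul_diagonal,
      Matrix.diagonal_map Complex.ofReal_zero]
    congr 1
    funext i
    by_cases hi : i = k
    · simp [hd, hi]
    · simp [hd, hi]
      linear_combination (l ω i : ℂ) * Complex.I_mul_I
  have hGtr : ((G ω).trace.re : ℂ) = (G ω).trace := by
    rw [Matrix.trace, Complex.re_sum, Complex.ofReal_sum]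
    exact Finset.sum_congr rfl fun i _ => hGH.coe_re_apply_self i
  have hKH : (Y.conjTranspose * G ω * Y).IsHermitian :=
    Matrix.isHermitian_conjTranspose_mul_mul Y hGH
  have hKtr : (Y.conjTranspose * G ω * Y).trace = (G ω).trace := by
    rw [Matrix.trace_mul_comm, ← mul_assoc, mul_eq_one_comm.1 hYY, one_mul]
  have hTtr : (Y.transpose * τ ω * Y).trace.re = c := by
    rw [hYτ]
    simp only [Matrix.trace, Matrix.diag_apply, Matrix.map_apply, Matrix.diagonal_apply_eq,
      Complex.re_sum, Complex.ofReal_re, hc]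
    rw [← Finset.add_sum_erase _ _ (Finset.mem_univ k), if_pos rfl,
      ← Finset.add_sum_erase (Finset.univ) (l ω) (Finset.mem_univ k),
      Finset.sum_congr rfl fun i hi => if_neg (Finset.ne_of_mem_erase hi), Finset.sum_neg_distrib]
    ring
  have hSeq : (Matrix.of fun i j => (G ω).trace.re * ((Y.transpose * τ ω * Y) i j).re -
      ((Y.transpose * τ ω * Y).trace).re * ((Y.conjTranspose * G ω * Y) i j).re) =
      (G ω).trace.re • (Y.transpose * τ ω * Y).map Complex.re -
        c • (Y.conjTranspose * G ω * Y).map Complex.re := by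
    rw [hTtr]
    ext i j
    simp
  obtain ⟨hRR, hdiag⟩ := h ω (by
      rw [hSeq, hYτ]
      ext i j
      have h1 : ((Y.conjTranspose * G ω * Y) j i).re = ((Y.conjTranspose * G ω * Y) i j).re := by
        conv_lhs => rw [← hKH.apply j i]
        simp
      simp only [Matrix.transpose_apply, Matrix.sub_apply, Matrix.smul_apply, Matrix.map_apply, h1,
        Complex.ofReal_re]
      congr 2
      by_cases hij : i = j
      · rw [hij]
      · rw [Matrix.diagonal_apply_ne _ hij, Matrix.diagonal_apply_ne _ (Ne.symm hij)]) (by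
      rw [hSeq, Matrix.trace_sub, Matrix.trace_smul, Matrix.trace_smul]
      have h1 : ((Y.conjTranspose * G ω * Y).map Complex.re).trace = (G ω).trace.re := by
        rw [← hKtr, Matrix.trace, Matrix.trace, Complex.re_sum]
        rfl
      have h2 : ((Y.transpose * τ ω * Y).map Complex.re).trace = c := by
        rw [← hTtr, Matrix.trace, Matrix.trace, Complex.re_sum]
        rfl
      rw [h1, h2, smul_eq_mul, smul_eq_mul]
      ring)
  rw [hSeq] at hdiag
  have hRc : ((R ω).map ((↑) : ℝ → ℂ)).conjTranspose * (R ω).map ((↑) : ℝ → ℂ) = 1 := by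
    rw [ofRealMatrix_conjTranspose, ← Matrix.transpose_map]
    have := congrArg (fun M => M.map Complex.ofRealHom) hRR
    rw [Matrix.map_mul] at this
    exact this.trans (Matrix.map_one _ (map_zero _) (map_one _))
  refine ⟨conjTranspose_mul_self_mul hYY hRc, c, by linarith, fun j => ?_,
    Or.inr ⟨V ω, l ω, k, hVV, hl0, hVτ, hc⟩⟩
  have e1 : (Y * (R ω).map ((↑) : ℝ → ℂ)).transpose * τ ω * (Y * (R ω).map ((↑) : ℝ → ℂ)) =
      ((R ω).map ((↑) : ℝ → ℂ)).transpose * (Y.transpose * τ ω * Y) * (R ω).map ((↑) : ℝ → ℂ) := by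
    simp only [Matrix.transpose_mul, mul_assoc]
  have e2 : (Y * (R ω).map ((↑) : ℝ → ℂ)).conjTranspose * G ω * (Y * (R ω).map ((↑) : ℝ → ℂ)) =
      ((R ω).map ((↑) : ℝ → ℂ)).transpose * (Y.conjTranspose * G ω * Y) *
        (R ω).map ((↑) : ℝ → ℂ) := by
    rw [← ofRealMatrix_conjTranspose]
    simp only [Matrix.conjTranspose_mul, mul_assoc]
  have hK' := Matrix.isHermitian_conjTranspose_mul_mul (Y * (R ω).map ((↑) : ℝ → ℂ)) hGH
  rw [← hGtr, ← hK'.coe_re_apply_self j, e1, e2]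
  have hd := hdiag j
  simp only [Matrix.mul_sub, Matrix.sub_mul, Matrix.mul_smul, Matrix.smul_mul, Matrix.sub_apply,
    Matrix.smul_apply, smul_eq_mul] at hd
  apply Complex.ext
  · rw [Complex.re_mul_ofReal, ofRealMatrix_conj_apply_re]
    simp only [RCLike.re_to_complex, ofRealMatrix_conj_apply_re, Complex.re_ofReal_mul]
    have hre : ∀ x : ℝ, (((RCLike.ofReal x : ℂ))).re = x := fun _ => rfl
    rw [hre]
    linarith
  -- The imaginary parts agree because the transformed form is real and the diagonal of a Hermitian
  -- matrix is real.
  · rw [Complex.im_mul_ofReal, ofRealMatrix_conj_apply_im, hYτ]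
    have : (((Matrix.diagonal fun i => if i = k then l ω i else -l ω i).map
        ((↑) : ℝ → ℂ)).map Complex.im) = 0 := by
      ext a b
      simp only [Matrix.map_apply, Complex.ofReal_im, Matrix.zero_apply]
    have him : ∀ x : ℝ, (((RCLike.ofReal x : ℂ))).im = 0 := fun _ => rfl
    rw [this, Complex.im_ofReal_mul, him]
    simp

/-- The optimal mixing of a family of four vectors with Gram matrix `G` and tangles `τ` is
computable. -/
theorem Comp.exists_isOptimalMixing {D : ℕ} {τ G : (ℕ → ℝ) → Matrix (Fin 4) (Fin 4) ℂ}
    (hτ : Comp D τ) (hG : Comp D G) :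
    ∃ W : (ℕ → ℝ) → Matrix (Fin 4) (Fin 4) ℂ, Comp D W ∧ ∀ ω, (τ ω).transpose = τ ω →
      (G ω).IsHermitian → IsOptimalMixing (τ ω) (G ω) (W ω) := by
  obtain ⟨V, l, hV, hl, h⟩ := exists_takagi hτ
  obtain ⟨W₀, hW₀, h₀⟩ := exists_isOptimalMixing_of_le (τ := τ) (G := G) hV hl
  choose W hW h₁ using fun k => exists_isOptimalMixing_of_lt (l := l) hτ hG hV k
  have hsum := CompReal.sum Finset.univ fun i _ => hl i
  have h2 : ∀ k, CompReal D fun ω => 2 * l ω k := fun k => CompReal.ofNat.mul (hl k)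
  obtain ⟨g, hg, hsel⟩ := exists_comp_select (D := D)
    (p := fun (o : Option (Fin 4)) ω => o.elim (∀ k, 2 * l ω k ≤ ∑ i, l ω i)
      fun k => ∑ i, l ω i ≤ 2 * l ω k)
    (f := fun o => o.elim W₀ W)
    (fun o => by
      cases o with
      | none => exact CompPred.forall_fin fun k => CompPred.le (h2 k) hsum
      | some k => exact CompPred.le hsum (h2 k))
    (fun o => by
      cases o with
      | none => exact hW₀
      | some k => exact hW k)
  refine ⟨g, hg, fun ω hsymm hherm => ?_⟩
  obtain ⟨hVV, hl0, hVτ⟩ := h ω hsymm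
  obtain ⟨o, ho, hgo⟩ := hsel ω (by
    by_cases hall : ∀ k, 2 * l ω k ≤ ∑ i, l ω i
    · exact ⟨none, hall⟩
    · push Not at hall
      obtain ⟨k, hk⟩ := hall
      exact ⟨some k, hk.le⟩)
  rw [hgo]
  cases o with
  | none => exact h₀ ω hVV hl0 hVτ ho
  | some k => exact h₁ k ω hherm hVV hl0 hVτ ho

/-! Pure states in the span of a Schmidt basis of the rest, and a lower bound on the average
concurrence of the ensembles of a mixed state. -/

section Tangle

variable {E : Type*} [AddCommGroup E] [Module ℂ E]

/-- If two families have the same second moments, then each vector of the first lies in the span of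
the second. -/
theorem mem_span_of_sum_norm_sq_eq {ι κ : Type*} [Fintype ι] [Fintype κ] {x : ι → E} {M : κ → E}
    (h : ∀ f : E →ₗ[ℂ] ℂ, ∑ j, ‖f (M j)‖ ^ 2 = ∑ i, ‖f (x i)‖ ^ 2) (j : κ) :
    M j ∈ Submodule.span ℂ (Set.range x) := by
  -- A functional that vanishes on all `x i` has second moment zero, hence vanishes on every `M j`.
  rw [← Subspace.forall_mem_dualAnnihilator_apply_eq_zero_iff]
  intro f hf
  have h0 : ∑ i, ‖f (x i)‖ ^ 2 = 0 := by
    refine Finset.sum_eq_zero fun i _ => ?_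
    rw [(Submodule.mem_dualAnnihilator f).1 hf _ (Submodule.subset_span ⟨i, rfl⟩)]
    simp
  rw [← h f, Finset.sum_eq_zero_iff_of_nonneg fun _ _ => by positivity] at h0
  simpa using h0 j (Finset.mem_univ j)

/-- Wootters' lower bound on the sum of the moduli of a quadratic form over a decomposition. -/
theorem le_sum_norm_of_takagi {ι κ : Type*} [Fintype ι] [DecidableEq ι] [Fintype κ]
    (B : E →ₗ[ℂ] E →ₗ[ℂ] ℂ) {x : ι → E} {l : ι → ℝ} (hl : ∀ i, 0 ≤ l i)
    (hB : ∀ i j, B (x i) (x j) = if i = j then (l i : ℂ) else 0) {M : κ → E}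
    (h : ∀ f : E →ₗ[ℂ] ℂ, ∑ j, ‖f (M j)‖ ^ 2 = ∑ i, ‖f (x i)‖ ^ 2) (k : ι) :
    2 * l k - ∑ i, l i ≤ ∑ j, ‖B (M j) (M j)‖ := by
  -- Expanding `M j` in the `x i` gives coefficients `c i` with `B (x i) (M j) = c i * l i`. Where
  -- `l i = 0` the term is zero on both sides, in accordance with division by zero.
  have hexp : ∀ j, B (M j) (M j) = ∑ i, B (x i) (M j) ^ 2 / l i := by
    intro j
    obtain ⟨c, hc⟩ := (Submodule.mem_span_range_iff_exists_fun ℂ).1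
      (mem_span_of_sum_norm_sq_eq h j)
    have h1 : ∀ i, B (x i) (M j) = c i * l i := by
      intro i
      rw [← hc, map_sum, Finset.sum_eq_single i]
      · simp [hB]
      · intro b _ hb
        simp [hB, hb.symm]
      · simp
    have h2 : B (M j) (M j) = ∑ i, c i * B (x i) (M j) := by
      conv_lhs => rw [← hc]
      simp only [map_sum, map_smul, LinearMap.sum_apply, LinearMap.smul_apply, smul_eq_mul]
      refine Finset.sum_congr rfl fun i _ => ?_
      rw [← hc]
      simp [hB]
    rw [h2]
    refine Finset.sum_congr rfl fun i _ => ?_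
    rw [h1]
    by_cases h0 : (l i : ℂ) = 0
    · simp [h0]
    · field_simp
  -- Reverse triangle inequality: the term `k` against the sum of all others.
  have hle : ∀ j, 2 * (‖B (x k) (M j)‖ ^ 2 / l k) - ∑ i, ‖B (x i) (M j)‖ ^ 2 / l i ≤
      ‖B (M j) (M j)‖ := by
    intro j
    have hn : ∀ i, ‖B (x i) (M j) ^ 2 / (l i : ℂ)‖ = ‖B (x i) (M j)‖ ^ 2 / l i := fun i => by
      rw [norm_div, norm_pow, Complex.norm_of_nonneg (hl i)]
    rw [hexp, ← Finset.add_sum_erase _ (fun i => B (x i) (M j) ^ 2 / (l i : ℂ))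
      (Finset.mem_univ k), ← Finset.add_sum_erase _ (fun i => ‖B (x i) (M j)‖ ^ 2 / l i) (Finset.mem_univ k)]
    have h1 := norm_sum_le (Finset.univ.erase k) fun i => B (x i) (M j) ^ 2 / (l i : ℂ)
    rw [Finset.sum_congr rfl fun i _ => hn i] at h1
    have h2 := norm_sub_le (B (x k) (M j) ^ 2 / (l k : ℂ) +
      ∑ i ∈ Finset.univ.erase k, B (x i) (M j) ^ 2 / (l i : ℂ))
      (∑ i ∈ Finset.univ.erase k, B (x i) (M j) ^ 2 / (l i : ℂ))
    rw [add_sub_cancel_right, hn] at h2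
    linarith
  -- The functional `B (x i)` has the same second moment on both families, and on the `x` family
  -- this is `l i ^ 2`.
  have hsum : ∀ i, ∑ j, ‖B (x i) (M j)‖ ^ 2 / l i = l i := by
    intro i
    rw [← Finset.sum_div, h (B (x i)), Finset.sum_eq_single i]
    · rw [hB, if_pos rfl, Complex.norm_of_nonneg (hl i)]
      by_cases h0 : l i = 0
      · simp [h0]
      · field_simp
    · intro b _ hb
      simp [hB, hb.symm]
    · simp
  calc 2 * l k - ∑ i, l i
      = ∑ j, (2 * (‖B (x k) (M j)‖ ^ 2 / l k) - ∑ i, ‖B (x i) (M j)‖ ^ 2 / l i) := by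
        rw [Finset.sum_sub_distrib, ← Finset.mul_sum, hsum, Finset.sum_comm]
        simp only [hsum]
    _ ≤ _ := Finset.sum_le_sum fun j _ => hle j

end Tangle

/-- The polarization of twice the determinant of `2 × 2` matrices. -/
def tangleForm : Matrix (Fin 2) (Fin 2) ℂ →ₗ[ℂ] Matrix (Fin 2) (Fin 2) ℂ →ₗ[ℂ] ℂ :=
  LinearMap.mk₂ ℂ (fun M N => M 0 0 * N 1 1 + M 1 1 * N 0 0 - M 0 1 * N 1 0 - M 1 0 * N 0 1)
    (fun _ _ _ => by simp; ring) (fun _ _ _ => by simp; ring) (fun _ _ _ => by simp; ring)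
    (fun _ _ _ => by simp; ring)

theorem tangleForm_apply (M N : Matrix (Fin 2) (Fin 2) ℂ) :
    tangleForm M N = M 0 0 * N 1 1 + M 1 1 * N 0 0 - M 0 1 * N 1 0 - M 1 0 * N 0 1 := rfl

/-- For a normalized coefficient matrix the modulus of this value is the concurrence. -/
theorem tangleForm_self (M : Matrix (Fin 2) (Fin 2) ℂ) : tangleForm M M = 2 * M.det := by
  rw [tangleForm_apply, Matrix.det_fin_two]; ring

theorem tangleForm_comm (M N : Matrix (Fin 2) (Fin 2) ℂ) : tangleForm M N = tangleForm N M := by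
  rw [tangleForm_apply, tangleForm_apply]; ring

/-! Coordinates with respect to the qubit `q` and the rest. -/

section Split

variable {n : ℕ} (q : Fin n)

theorem sum_glueIdx {α : Type*} [AddCommMonoid α] (f : (Fin n → Fin 2) → α) :
    ∑ x, f x = ∑ a, ∑ y : RestIdx q, f (glueIdx q a y) := by
  rw [← Fintype.sum_prod_type', ← Equiv.sum_comp (Equiv.funSplitAt q (Fin 2)).symm]
  refine Finset.sum_congr rfl fun p _ => congrArg f ?_
  funext j
  by_cases h : j = q <;> simp [glueIdx, Equiv.funSplitAt, Equiv.piSplitAt, h]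

@[simp] theorem glueIdx_self (a : Fin 2) (y : RestIdx q) : glueIdx q a y q = a := by simp [glueIdx]

@[simp] theorem glueIdx_rest (a : Fin 2) (y : RestIdx q) (j : {j : Fin n // j ≠ q}) :
    glueIdx q a y j.1 = y j := by
  simp [glueIdx, j.2]

theorem exists_glueIdx (x : Fin n → Fin 2) : ∃ a y, x = glueIdx q a y := by
  refine ⟨x q, fun j => x j.1, ?_⟩
  funext j
  by_cases h : j = q
  · subst h; simp
  · simp [glueIdx, h]

theorem qstate_ext {φ χ : QState n} (h : ∀ a y, φ (glueIdx q a y) = χ (glueIdx q a y)) :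
    φ = χ := by
  ext x
  obtain ⟨a, y, rfl⟩ := exists_glueIdx q x
  exact h a y

theorem tensorAt_glueIdx (u : EuclideanSpace ℂ (Fin 2)) (v : EuclideanSpace ℂ (RestIdx q))
    (a : Fin 2) (y : RestIdx q) : tensorAt q u v (glueIdx q a y) = u a * v y := by
  simp [tensorAt]

theorem localOp_glueIdx (K : Matrix (Fin 2) (Fin 2) ℂ) (a b : Fin 2) (y z : RestIdx q) :
    localOp q K (glueIdx q a y) (glueIdx q b z) = if y = z then K a b else 0 := by
  have : (∀ j, j ≠ q → glueIdx q a y j = glueIdx q b z j) ↔ y = z := by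
    constructor
    · intro h
      funext j
      simpa using h j.1 j.2
    · rintro rfl j hj
      simp [glueIdx, hj]
  simp [localOp, this]

theorem applyAt_glueIdx (K : Matrix (Fin 2) (Fin 2) ℂ) (ψ : QState n) (a : Fin 2) (y : RestIdx q) :
    applyAt q K ψ (glueIdx q a y) = ∑ b, K a b * ψ (glueIdx q b y) := by
  simp only [applyAt, Matrix.mulVec, dotProduct]
  rw [sum_glueIdx q]
  simp [localOp_glueIdx]

theorem norm_sq_eq_trace_reducedState (φ : QState n) :
    ((‖φ‖ ^ 2 : ℝ) : ℂ) = (reducedState q φ).trace := by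
  rw [EuclideanSpace.norm_sq_eq, sum_glueIdx q, Matrix.trace]
  push_cast
  refine Finset.sum_congr rfl fun a _ => ?_
  simp only [reducedState, Matrix.diag_apply, Matrix.of_apply, ketbra]
  refine Finset.sum_congr rfl fun y _ => ?_
  rw [Complex.star_def, Complex.mul_conj']

end Split

section Schmidt

variable {n : ℕ} (q : Fin n) (v : Fin 2 → EuclideanSpace ℂ (RestIdx q))

/-- The state whose `k`-th component with respect to `v` is the `k`-th column of `M`. -/
def ofMat : Matrix (Fin 2) (Fin 2) ℂ →ₗ[ℂ] QState n where
  toFun M := WithLp.toLp 2 fun x => ∑ k, M (x q) k * v k (fun j => x j.1)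
  map_add' M N := by
    ext x
    simp [add_mul, Finset.sum_add_distrib]
  map_smul' c M := by
    ext x
    simp [mul_add, mul_assoc]

/-- The matrix of components with respect to `v`. -/
def coefMat : QState n →ₗ[ℂ] Matrix (Fin 2) (Fin 2) ℂ where
  toFun φ := Matrix.of fun a k => ∑ y, star (v k y) * φ (glueIdx q a y)
  map_add' φ χ := by
    ext a k
    simp [mul_add, Finset.sum_add_distrib]
  map_smul' c φ := by
    ext a k
    simp only [Matrix.of_apply, Matrix.smul_apply, RingHom.id_apply, PiLp.smul_apply, smul_eq_mul,
      Finset.mul_sum]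
    exact Finset.sum_congr rfl fun y _ => by ring

theorem ofMat_glueIdx (M : Matrix (Fin 2) (Fin 2) ℂ) (a : Fin 2) (y : RestIdx q) :
    ofMat q v M (glueIdx q a y) = ∑ k, M a k * v k y := by
  simp [ofMat]

variable {q v}

theorem sum_star_mul (hv : Orthonormal ℂ v) (k l : Fin 2) : ∑ y, star (v k y) * v l y = if k = l then 1 else 0 := by
  rw [← orthonormal_iff_ite.1 hv k l, PiLp.inner_apply]
  refine Finset.sum_congr rfl fun y _ => ?_
  simp [mul_comm]

theorem coefMat_ofMat (hv : Orthonormal ℂ v) (M : Matrix (Fin 2) (Fin 2) ℂ) : coefMat q v (ofMat q v M) = M := by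
  ext a k
  have h : ∀ y, star (v k y) * ofMat q v M (glueIdx q a y) =
      ∑ l, M a l * (star (v k y) * v l y) := fun y => by
    rw [ofMat_glueIdx, Finset.mul_sum]
    exact Finset.sum_congr rfl fun l _ => by ring
  change ∑ y, star (v k y) * ofMat q v M (glueIdx q a y) = M a k
  simp only [h]
  rw [Finset.sum_comm]
  simp only [← Finset.mul_sum, sum_star_mul hv]
  simp

/-- Orthonormality of `v` removes the rest: the entropy depends on the 2 × 2 matrix only. -/
theorem reducedState_ofMat (hv : Orthonormal ℂ v) (M : Matrix (Fin 2) (Fin 2) ℂ) :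
    reducedState q (ofMat q v M) = M * M.conjTranspose := by
  ext a b
  simp only [reducedState, ketbra, Matrix.of_apply, ofMat_glueIdx, Matrix.mul_apply,
    Matrix.conjTranspose_apply]
  have h : ∀ y, (∑ k, M a k * v k y) * star (∑ l, M b l * v l y) =
      ∑ k, ∑ l, M a k * star (M b l) * (star (v l y) * v k y) := by
    intro y
    rw [star_sum, Finset.sum_mul_sum]
    refine Finset.sum_congr rfl fun k _ => Finset.sum_congr rfl fun l _ => ?_
    rw [star_mul']
    ring
  simp only [h]
  rw [Finset.sum_comm]
  refine Finset.sum_congr rfl fun k _ => ?_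
  rw [Finset.sum_comm]
  simp only [← Finset.mul_sum, sum_star_mul hv]
  simp

theorem norm_sq_ofMat (hv : Orthonormal ℂ v) (M : Matrix (Fin 2) (Fin 2) ℂ) :
    ((‖ofMat q v M‖ ^ 2 : ℝ) : ℂ) = (M * M.conjTranspose).trace := by
  rw [norm_sq_eq_trace_reducedState q, reducedState_ofMat hv]

end Schmidt

/-- The matrix of components of the state with Schmidt coefficients `s`, `√(1 - s²)` and Schmidt
vectors `u` of the singled out qubit. -/
noncomputable def schmidtMat (s : ℝ) (u : Fin 2 → EuclideanSpace ℂ (Fin 2)) : Matrix (Fin 2) (Fin 2) ℂ :=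
  Matrix.of fun a k => (if k = 0 then (s : ℂ) else (Real.sqrt (1 - s ^ 2) : ℂ)) * u k a

theorem schmidtMat_conjTranspose_mul_self_trace {s : ℝ} {u : Fin 2 → EuclideanSpace ℂ (Fin 2)}
    (h0 : 0 ≤ s) (h1 : s ≤ 1) (hu : Orthonormal ℂ u) :
    ((schmidtMat s u).conjTranspose * schmidtMat s u).trace = 1 := by
  have hs : (s : ℂ) * s + (Real.sqrt (1 - s ^ 2) : ℂ) * (Real.sqrt (1 - s ^ 2) : ℂ) = 1 := by
    rw [← Complex.ofReal_mul, ← Complex.ofReal_mul, Real.mul_self_sqrt (by nlinarith)]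
    push_cast
    ring
  have hk : ∀ k, star (u k 0) * u k 0 + star (u k 1) * u k 1 = 1 := by
    intro k
    have := orthonormal_iff_ite.1 hu k k
    rw [PiLp.inner_apply, Fin.sum_univ_two, if_pos rfl] at this
    simpa [← Complex.mul_conj', mul_comm] using this
  have k0 := hk 0
  have k1 := hk 1
  simp only [Matrix.trace, Fin.sum_univ_two, Matrix.diag_apply, Matrix.mul_apply, schmidtMat,
    Matrix.conjTranspose_apply, Matrix.of_apply, if_true, star_mul', Complex.star_def,
    Complex.conj_ofReal, one_ne_zero, if_false] at k0 k1 ⊢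
  linear_combination hs + s * s * k0 + (Real.sqrt (1 - s ^ 2) : ℂ) * (Real.sqrt (1 - s ^ 2) : ℂ) * k1

/-- Operators on the target multiply the coefficient matrix from the left, so no trajectory leaves
the span of `v` in the second factor. -/
theorem applyAt_eq_ofMat {n : ℕ} {q : Fin n} {v : Fin 2 → EuclideanSpace ℂ (RestIdx q)}
    {s : ℝ} {u : Fin 2 → EuclideanSpace ℂ (Fin 2)} {ψ : QState n}
    (hψ : ψ = (s : ℂ) • tensorAt q (u 0) (v 0)
      + (Real.sqrt (1 - s ^ 2) : ℂ) • tensorAt q (u 1) (v 1)) (K : Matrix (Fin 2) (Fin 2) ℂ) :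
    applyAt q K ψ = ofMat q v (K * schmidtMat s u) := by
  apply qstate_ext q
  intro a y
  rw [applyAt_glueIdx, ofMat_glueIdx, hψ]
  simp [tensorAt_glueIdx, Matrix.mul_apply, schmidtMat, Fin.sum_univ_two]
  ring

/-! Ensembles. -/

section Ensembles

variable {n : ℕ}

/-- The squared modulus of a functional is linear in `ketbra φ`; hence its sum over an ensemble sees
only the density matrix. -/
theorem norm_sq_apply_eq (f : QState n →ₗ[ℂ] ℂ) (φ : QState n) :
    ((‖f φ‖ ^ 2 : ℝ) : ℂ) = ∑ x, ∑ y, f (EuclideanSpace.single x 1) *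
      star (f (EuclideanSpace.single y 1)) * ketbra φ x y := by
  have hf : f φ = ∑ x, φ x * f (EuclideanSpace.single x 1) := by
    conv_lhs => rw [← (EuclideanSpace.basisFun (Fin n → Fin 2) ℂ).sum_repr φ]
    simp
  push_cast
  rw [← Complex.mul_conj', ← Complex.star_def, hf, star_sum, Finset.sum_mul_sum]
  refine Finset.sum_congr rfl fun x _ => Finset.sum_congr rfl fun y _ => ?_
  rw [star_mul', ketbra, Matrix.of_apply]
  ring

theorem sum_norm_sq_apply_eq {ι : Type*} [Fintype ι] (φ : ι → QState n) (f : QState n →ₗ[ℂ] ℂ) :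
    ((∑ i, ‖f (φ i)‖ ^ 2 : ℝ) : ℂ) = ∑ x, ∑ y, f (EuclideanSpace.single x 1) *
      star (f (EuclideanSpace.single y 1)) * (∑ i, ketbra (φ i)) x y := by
  rw [Complex.ofReal_sum]
  simp only [norm_sq_apply_eq]
  rw [Finset.sum_comm]
  refine Finset.sum_congr rfl fun x _ => ?_
  rw [Finset.sum_comm]
  refine Finset.sum_congr rfl fun y _ => ?_
  rw [Matrix.sum_apply, Finset.mul_sum]

/-- The second moments of a functional depend on the density matrix only. -/
theorem sum_norm_sq_eq_of_sum_ketbra_eq {ι κ : Type*} [Fintype ι] [Fintype κ] {φ : ι → QState n}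
    {χ : κ → QState n} (h : ∑ i, ketbra (φ i) = ∑ j, ketbra (χ j)) (f : QState n →ₗ[ℂ] ℂ) :
    ∑ i, ‖f (φ i)‖ ^ 2 = ∑ j, ‖f (χ j)‖ ^ 2 := by
  have h1 := sum_norm_sq_apply_eq φ f
  rw [h, ← sum_norm_sq_apply_eq χ] at h1
  exact_mod_cast h1

theorem sum_norm_sq_of_sum_ketbra_eq {ι κ : Type*} [Fintype ι] [Fintype κ] {φ : ι → QState n}
    {χ : κ → QState n} (h : ∑ i, ketbra (φ i) = ∑ j, ketbra (χ j)) :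
    ∑ i, ‖φ i‖ ^ 2 = ∑ j, ‖χ j‖ ^ 2 := by
  simp only [EuclideanSpace.norm_sq_eq]
  rw [Finset.sum_comm, Finset.sum_comm (s := Finset.univ (α := κ))]
  refine Finset.sum_congr rfl fun x _ => ?_
  exact sum_norm_sq_eq_of_sum_ketbra_eq h
    ((EuclideanSpace.proj x : QState n →L[ℂ] ℂ) : QState n →ₗ[ℂ] ℂ)

theorem ketbra_smul (c : ℝ) (φ : QState n) : ketbra ((c : ℂ) • φ) = ((c ^ 2 : ℝ) : ℂ) • ketbra φ := by
  ext x y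
  simp [ketbra]
  ring

theorem ketbra_applyAt (q : Fin n) (K : Matrix (Fin 2) (Fin 2) ℂ) (ψ : QState n) :
    ketbra (applyAt q K ψ) = localOp q K * ketbra ψ * (localOp q K).conjTranspose := by
  have h : ∀ φ : QState n, ketbra φ = Matrix.vecMulVec φ.ofLp (star φ.ofLp) := fun φ => rfl
  rw [h, h, Matrix.mul_vecMulVec, Matrix.vecMulVec_mul, ← Matrix.star_mulVec]
  rfl

theorem channelAt_ketbra {r : ℕ} (q : Fin n) (K : Fin r → Matrix (Fin 2) (Fin 2) ℂ) (ψ : QState n) :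
    channelAt q K (ketbra ψ) = ∑ i, ketbra (applyAt q (K i) ψ) := by
  simp only [channelAt, ketbra_applyAt]

/-- A unitary combination of vectors has the same density matrix. -/
theorem sum_ketbra_mix {ι : Type*} [Fintype ι] [DecidableEq ι] {U : Matrix ι ι ℂ}
    (hU : U * U.conjTranspose = 1) (φ : ι → QState n) :
    ∑ c, ketbra (∑ i, U i c • φ i) = ∑ i, ketbra (φ i) := by
  ext x y
  simp only [Matrix.sum_apply, ketbra, Matrix.of_apply]
  have h : ∀ i j, ∑ c, U i c * star (U j c) = if i = j then 1 else 0 := fun i j => by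
    rw [← Matrix.one_apply, ← hU, Matrix.mul_apply]
    rfl
  have h1 : ∀ c, (∑ i, U i c • φ i) x * star ((∑ i, U i c • φ i) y) =
      ∑ i, ∑ j, φ i x * star (φ j y) * (U i c * star (U j c)) := by
    intro c
    have e : ∀ z, (∑ i, U i c • φ i) z = ∑ i, U i c * φ i z := fun z => by
      simp
    rw [e, e, star_sum, Finset.sum_mul_sum]
    refine Finset.sum_congr rfl fun i _ => Finset.sum_congr rfl fun j _ => ?_
    rw [star_mul']
    ring
  simp only [h1]
  rw [Finset.sum_comm]
  refine Finset.sum_congr rfl fun i _ => ?_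
  rw [Finset.sum_comm]
  simp only [← Finset.mul_sum, h]
  simp

end Ensembles

/-! The entanglement entropy of a qubit as a function of the concurrence. -/

/-- The entropy, in nats, of the qubit states of determinant `c² / 4`. -/
noncomputable def concEntropy (c : ℝ) : ℝ := Real.binEntropy ((1 + √(1 - c ^ 2)) / 2)

theorem concaveOn_arsinh : ConcaveOn ℝ (Set.Ici 0) Real.arsinh := by
  refine AntitoneOn.concaveOn_of_deriv (convex_Ici 0) Real.continuous_arsinh.continuousOn
    Real.differentiable_arsinh.differentiableOn ?_
  intro x hx y hy hxy
  rw [interior_Ici, Set.mem_Ioi] at hx hy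
  rw [(Real.hasDerivAt_arsinh x).deriv, (Real.hasDerivAt_arsinh y).deriv]
  apply inv_anti₀ (Real.sqrt_pos.2 (by positivity))
  apply Real.sqrt_le_sqrt
  nlinarith

/-- The quotient is the slope from the origin of a concave function vanishing there. -/
theorem arsinh_div_antitone {x y : ℝ} (hx : 0 < x) (hxy : x ≤ y) :
    Real.arsinh y / y ≤ Real.arsinh x / x := by
  have := concaveOn_arsinh.antitoneOn_slope_gt (x := 0) (by simp) (a := x) (b := y)
    ⟨hx.le, hx⟩ ⟨hx.le.trans hxy, hx.trans_le hxy⟩ hxy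
  simpa [slope_def_field] using this

/-- This turns the logarithms in the derivative of the binary entropy into `arsinh`, whose concavity
is easy to use. -/
theorem two_mul_arsinh {x : ℝ} (h0 : 0 ≤ x) (h1 : x < 1) :
    2 * Real.arsinh (x / √(1 - x ^ 2)) = Real.log (1 + x) - Real.log (1 - x) := by
  have hc : 0 < 1 - x ^ 2 := by nlinarith
  have hs := Real.sq_sqrt hc.le
  have hs0 := Real.sqrt_pos.2 hc
  have h2 : √(1 + (x / √(1 - x ^ 2)) ^ 2) = 1 / √(1 - x ^ 2) := by
    rw [Real.sqrt_eq_iff_mul_self_eq (by positivity) (by positivity)]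
    field_simp
    rw [hs]; ring
  rw [Real.arsinh, h2, ← add_div, ← Real.log_div (by linarith) (by linarith)]
  have h3 : (1 + x) / (1 - x) = ((x + 1) / √(1 - x ^ 2)) ^ 2 := by
    rw [div_pow, hs]
    have : 1 - x ≠ 0 := by linarith
    have : 1 - x ^ 2 ≠ 0 := hc.ne'
    field_simp
    ring
  rw [h3, Real.log_pow]
  norm_num

theorem hasDerivAt_concEntropy {c : ℝ} (h0 : 0 < c) (h1 : c < 1) :
    HasDerivAt concEntropy (Real.arsinh (√(1 - c ^ 2) / c) / (√(1 - c ^ 2) / c)) c := by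
  have hc : 0 < 1 - c ^ 2 := by nlinarith
  have hs := Real.sq_sqrt hc.le
  have hs0 := Real.sqrt_pos.2 hc
  have hs1 : √(1 - c ^ 2) < 1 := by
    rw [Real.sqrt_lt' one_pos]; nlinarith
  have e1 : HasDerivAt (fun c : ℝ => 1 - c ^ 2) (-(2 * c)) c := by
    simpa using (hasDerivAt_pow 2 c).const_sub 1
  have e2 := ((e1.sqrt hc.ne').const_add 1).div_const 2
  have e3 := (Real.hasDerivAt_binEntropy (p := (1 + √(1 - c ^ 2)) / 2) (by positivity)
    (by linarith)).comp c e2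
  have e4 := two_mul_arsinh hs0.le hs1
  have e5 : √(1 - √(1 - c ^ 2) ^ 2) = c := by
    rw [hs, sub_sub_cancel, Real.sqrt_sq h0.le]
  rw [e5] at e4
  have e6 : Real.log (1 - (1 + √(1 - c ^ 2)) / 2) - Real.log ((1 + √(1 - c ^ 2)) / 2) =
      -(2 * Real.arsinh (√(1 - c ^ 2) / c)) := by
    rw [e4, show 1 - (1 + √(1 - c ^ 2)) / 2 = (1 - √(1 - c ^ 2)) / 2 by ring,
      Real.log_div (by linarith) (by norm_num), Real.log_div (by positivity) (by norm_num)]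
    ring
  rw [e6] at e3
  refine e3.congr_deriv ?_
  field_simp

theorem continuous_concEntropy : Continuous concEntropy := by
  unfold concEntropy
  exact Real.binEntropy_continuous.comp (by fun_prop)

/-- The derivative is `arsinh z / z` with `z = √(1 - c²) / c`. It decreases in `z`, and `z`
decreases in `c`, so it increases in `c`. -/
theorem concEntropy_convexOn : ConvexOn ℝ (Set.Icc 0 1) concEntropy := by
  refine MonotoneOn.convexOn_of_deriv (convex_Icc 0 1) continuous_concEntropy.continuousOn ?_ ?_
  · intro c hc
    rw [interior_Icc] at hc
    exact (hasDerivAt_concEntropy hc.1 hc.2).differentiableAt.differentiableWithinAt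
  · intro x hx y hy hxy
    rw [interior_Icc] at hx hy
    rw [(hasDerivAt_concEntropy hx.1 hx.2).deriv, (hasDerivAt_concEntropy hy.1 hy.2).deriv]
    apply arsinh_div_antitone
    · exact div_pos (Real.sqrt_pos.2 (by nlinarith [hy.1, hy.2])) hy.1
    · apply div_le_div₀ (Real.sqrt_nonneg _) _ hx.1 hxy
      apply Real.sqrt_le_sqrt
      nlinarith [hx.1]

theorem concEntropy_monotoneOn : MonotoneOn concEntropy (Set.Icc 0 1) := by
  refine monotoneOn_of_deriv_nonneg (convex_Icc 0 1) continuous_concEntropy.continuousOn ?_ ?_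
  · intro c hc
    rw [interior_Icc] at hc
    exact (hasDerivAt_concEntropy hc.1 hc.2).differentiableAt.differentiableWithinAt
  · intro c hc
    rw [interior_Icc] at hc
    rw [(hasDerivAt_concEntropy hc.1 hc.2).deriv]
    have : 0 ≤ √(1 - c ^ 2) / c := div_nonneg (Real.sqrt_nonneg _) hc.1.le
    exact div_nonneg (Real.arsinh_nonneg_iff.2 this) this

/-- The entropy of a mixture of concurrences is at least that of any smaller concurrence. -/
theorem concEntropy_le_sum {ι : Type*} [Fintype ι] {p c : ι → ℝ} {C : ℝ} (hp : ∀ i, 0 ≤ p i)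
    (hp1 : ∑ i, p i = 1) (hc : ∀ i, c i ∈ Set.Icc (0 : ℝ) 1) (hC : 0 ≤ C)
    (hle : C ≤ ∑ i, p i * c i) : concEntropy C ≤ ∑ i, p i * concEntropy (c i) := by
  have h1 : ∑ i, p i * c i ≤ 1 := by
    rw [← hp1]
    exact Finset.sum_le_sum fun i _ => mul_le_of_le_one_right (hp i) (hc i).2
  refine (concEntropy_monotoneOn ⟨hC, hle.trans h1⟩ ⟨hC.trans hle, h1⟩ hle).trans ?_
  simpa using concEntropy_convexOn.map_sum_le (t := Finset.univ) (fun i _ => hp i) hp1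
    fun i _ => hc i

/-- For `a + b = 1` one has `1 - 4ab = (a - b)²`, so the concurrence recovers the larger of `a` and
`b`; the entropy is symmetric in them. -/
theorem binEntropy_eq_concEntropy {a b c : ℝ} (hab : a + b = 1)
    (hc : c ^ 2 = 4 * (a * b)) : Real.binEntropy a = concEntropy c := by
  have h : 1 - c ^ 2 = (a - b) ^ 2 := by
    rw [hc, ← one_pow 2, ← hab]; ring
  rw [concEntropy, h, Real.sqrt_sq_eq_abs]
  rcases le_total b a with hle | hle
  · rw [abs_of_nonneg (sub_nonneg.2 hle)]
    congr 1
    linarith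
  · rw [abs_of_nonpos (sub_nonpos.2 hle), ← Real.binEntropy_one_sub]
    congr 1
    linarith

section Qubit

variable {n : ℕ} {q : Fin n} {v : Fin 2 → EuclideanSpace ℂ (RestIdx q)}

open scoped ComplexOrder in
theorem reducedState_posSemidef (hv : Orthonormal ℂ v) (M : Matrix (Fin 2) (Fin 2) ℂ) :
    (reducedState q (ofMat q v M)).PosSemidef := by
  rw [reducedState_ofMat hv]
  exact Matrix.posSemidef_self_mul_conjTranspose M

/-- The entanglement entropy of a normalized state in terms of its concurrence. -/
theorem entEntropy_ofMat (hv : Orthonormal ℂ v) {M : Matrix (Fin 2) (Fin 2) ℂ}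
    (hM : ‖ofMat q v M‖ = 1) :
    entEntropy q (ofMat q v M) = concEntropy ‖tangleForm M M‖ / Real.log 2 ∧
      ‖tangleForm M M‖ ∈ Set.Icc (0 : ℝ) 1 := by
  set h := reducedState_isHermitian q (ofMat q v M) with hh
  have hp := (reducedState_posSemidef hv M).eigenvalues_nonneg
  have htr : h.eigenvalues 0 + h.eigenvalues 1 = 1 := by
    have h1 := h.trace_eq_sum_eigenvalues
    rw [← norm_sq_eq_trace_reducedState, hM, Fin.sum_univ_two] at h1
    have h2 : ((1 : ℝ) : ℂ) = ((h.eigenvalues 0 + h.eigenvalues 1 : ℝ) : ℂ) := by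
      push_cast
      simpa using h1
    exact (Complex.ofReal_injective h2).symm
  have hdet : ‖tangleForm M M‖ ^ 2 = 4 * (h.eigenvalues 0 * h.eigenvalues 1) := by
    have h1 := h.det_eq_prod_eigenvalues
    have h0 : (reducedState q (ofMat q v M)).det = (‖M.det‖ : ℂ) ^ 2 := by
      rw [reducedState_ofMat hv, Matrix.det_mul, Matrix.det_conjTranspose, Complex.star_def,
        Complex.mul_conj']
    rw [h0, Fin.prod_univ_two] at h1
    have h2 : ((‖M.det‖ ^ 2 : ℝ) : ℂ) = ((h.eigenvalues 0 * h.eigenvalues 1 : ℝ) : ℂ) := by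
      push_cast
      simpa using h1
    rw [← Complex.ofReal_injective h2, tangleForm_self, norm_mul, mul_pow]
    norm_num
  constructor
  · rw [← binEntropy_eq_concEntropy htr hdet, entEntropy, Fin.sum_univ_two,
      Real.binEntropy_eq_negMulLog_add_negMulLog_one_sub, ← htr, add_sub_cancel_left]
    simp only [Real.negMulLog, Real.logb]
    ring
  · refine ⟨norm_nonneg _, ?_⟩
    have : ‖tangleForm M M‖ ^ 2 ≤ 1 ^ 2 := by
      rw [hdet, ← htr]
      nlinarith [sq_nonneg (h.eigenvalues 0 - h.eigenvalues 1)]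
    exact le_of_sq_le_sq this zero_le_one

end Qubit

/-! Optimality of an unraveling whose Kraus operators have equal concurrences. -/

theorem Fin.sum_eq_sum_castLE {α : Type*} [AddCommMonoid α] {r R : ℕ} (h : r ≤ R) (F : Fin R → α)
    (hF : ∀ i : Fin R, r ≤ i.1 → F i = 0) : ∑ i, F i = ∑ i : Fin r, F (Fin.castLE h i) := by
  have h1 : ∑ i : Fin r, F (Fin.castLE h i) =
      ∑ i ∈ Finset.univ.map (Fin.castLEEmb h), F i := by
    rw [Finset.sum_map]
    rfl
  rw [h1]
  symm
  apply Finset.sum_subset (Finset.subset_univ _)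
  intro i _ hi
  apply hF
  by_contra hlt
  exact hi (Finset.mem_map.2 ⟨⟨i.1, not_le.1 hlt⟩, Finset.mem_univ _, rfl⟩)

/-- The family `K`, continued by zeros. -/
def padKraus {r : ℕ} (R : ℕ) (K : Fin r → Matrix (Fin 2) (Fin 2) ℂ) :
    Fin R → Matrix (Fin 2) (Fin 2) ℂ :=
  fun i => if h : i.1 < r then K ⟨i.1, h⟩ else 0

theorem padKraus_castLE {r R : ℕ} (h : r ≤ R) (K : Fin r → Matrix (Fin 2) (Fin 2) ℂ) (i : Fin r) :
    padKraus R K (Fin.castLE h i) = K i := by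
  simp [padKraus]

theorem padKraus_of_le {r R : ℕ} (K : Fin r → Matrix (Fin 2) (Fin 2) ℂ) {i : Fin R}
    (hi : r ≤ i.1) : padKraus R K i = 0 := by
  simp [padKraus, hi]

/-- Zero operators in the missing places let the full unitarity of `U` be used although only its
first `r` rows enter. -/
theorem mixKraus_eq_sum_padKraus {r R : ℕ} (h : r ≤ R) (K : Fin r → Matrix (Fin 2) (Fin 2) ℂ)
    (U : Matrix (Fin R) (Fin R) ℂ) (c : Fin R) :
    mixKraus h K U c = ∑ i, U i c • padKraus R K i := by
  rw [Fin.sum_eq_sum_castLE h _ fun i hi => by rw [padKraus_of_le K hi, smul_zero]]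
  simp [mixKraus, padKraus_castLE]

section Applied

variable {n : ℕ} {q : Fin n}

theorem applyAt_sum_smul {ι : Type*} [Fintype ι] (c : ι → ℂ) (K : ι → Matrix (Fin 2) (Fin 2) ℂ)
    (ψ : QState n) : applyAt q (∑ i, c i • K i) ψ = ∑ i, c i • applyAt q (K i) ψ := by
  apply qstate_ext q
  intro a y
  rw [applyAt_glueIdx]
  have h : (∑ i, c i • applyAt q (K i) ψ) (glueIdx q a y) =
      ∑ i, c i * applyAt q (K i) ψ (glueIdx q a y) := by simp
  rw [h]
  simp only [applyAt_glueIdx, Matrix.sum_apply, Matrix.smul_apply, smul_eq_mul, Finset.sum_mul,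
    Finset.mul_sum]
  rw [Finset.sum_comm]
  exact Finset.sum_congr rfl fun i _ => Finset.sum_congr rfl fun b _ => by ring

theorem applyAt_zero (ψ : QState n) : applyAt q 0 ψ = 0 := by
  apply qstate_ext q
  intro a y
  simp [applyAt_glueIdx]

theorem ketbra_zero : ketbra (0 : QState n) = 0 := by
  ext x y
  simp [ketbra]

/-- All unravelings of a channel produce the same mixed state. -/
theorem sum_ketbra_mixKraus {r R : ℕ} (h : r ≤ R) (K : Fin r → Matrix (Fin 2) (Fin 2) ℂ)
    {U : Matrix (Fin R) (Fin R) ℂ} (hU : U ∈ Matrix.unitaryGroup (Fin R) ℂ) (ψ : QState n) :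
    ∑ c, ketbra (applyAt q (mixKraus h K U c) ψ) = channelAt q K (ketbra ψ) := by
  simp only [mixKraus_eq_sum_padKraus, applyAt_sum_smul]
  rw [sum_ketbra_mix (Matrix.mem_unitaryGroup_iff.1 hU), Fin.sum_eq_sum_castLE h, channelAt_ketbra]
  · simp only [padKraus_castLE]
  · intro i hi
    rw [padKraus_of_le K hi, applyAt_zero, ketbra_zero]

theorem trajState_ensemble {m : ℕ} (K : Fin m → Matrix (Fin 2) (Fin 2) ℂ) (ψ : QState n) (i : Fin m)
    (hi : trajProb q K ψ i ≠ 0) : ‖trajState q K ψ i‖ = 1 ∧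
      (trajProb q K ψ i : ℂ) • ketbra (trajState q K ψ i) = ketbra (applyAt q (K i) ψ) := by
  have h0 : 0 ≤ trajProb q K ψ i := sq_nonneg _
  have h1 : √(trajProb q K ψ i) = ‖applyAt q (K i) ψ‖ := Real.sqrt_sq (norm_nonneg _)
  have h2 : ‖applyAt q (K i) ψ‖ ≠ 0 := by
    rw [← h1]
    exact (Real.sqrt_pos.2 (lt_of_le_of_ne h0 hi.symm)).ne'
  constructor
  · rw [trajState, norm_smul, h1, Complex.norm_real, Real.norm_of_nonneg (by positivity)]
    field_simp
  · rw [trajState, ketbra_smul, smul_smul, ← Complex.ofReal_mul, div_pow, Real.sq_sqrt h0, one_pow,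
      mul_one_div_cancel hi, Complex.ofReal_one, one_smul]

/-- The average entropy of an unraveling is attained by an ensemble. -/
theorem unravelingEntropy_mem_ensembleAverages {m : ℕ} {K : Fin m → Matrix (Fin 2) (Fin 2) ℂ}
    {ψ : QState n} {ρ : Matrix (Fin n → Fin 2) (Fin n → Fin 2) ℂ}
    (hρ : ∑ c, ketbra (applyAt q (K c) ψ) = ρ) (h1 : ∑ c, trajProb q K ψ c = 1) :
    unravelingEntropy q K ψ ∈ ensembleAverages q ρ := by
  classical
  -- An ensemble needs unit vectors even at weight zero, where `trajState` is zero; any basis state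
  -- serves, as it contributes nothing.
  refine ⟨m, trajProb q K ψ, fun i => if trajProb q K ψ i = 0 then EuclideanSpace.single 0 1 else
    trajState q K ψ i, ⟨fun i => sq_nonneg _, h1, fun i => ?_, ?_⟩, ?_⟩
  · by_cases hi : trajProb q K ψ i = 0
    · simp [hi]
    · simp [hi, (trajState_ensemble K ψ i hi).1]
  · rw [← hρ]
    refine Finset.sum_congr rfl fun i _ => ?_
    by_cases hi : trajProb q K ψ i = 0
    · have : applyAt q (K i) ψ = 0 := by simpa [trajProb] using hi
      simp [hi, this, ketbra_zero]
    · simp only [if_neg hi, (trajState_ensemble K ψ i hi).2]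
  · unfold unravelingEntropy avgEntropy
    refine Finset.sum_congr rfl fun i _ => ?_
    by_cases hi : trajProb q K ψ i = 0 <;> simp [hi]

end Applied

section Schmidt

variable {n : ℕ} {q : Fin n} {v : Fin 2 → EuclideanSpace ℂ (RestIdx q)} {ψ : QState n} {s : ℝ}
  {u : Fin 2 → EuclideanSpace ℂ (Fin 2)}

theorem sum_norm_sq_applyAt {r : ℕ} {K : Fin r → Matrix (Fin 2) (Fin 2) ℂ} (hK : IsKraus K)
    (h0 : 0 ≤ s) (h1 : s ≤ 1) (hu : Orthonormal ℂ u) (hv : Orthonormal ℂ v)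
    (hψ : ψ = (s : ℂ) • tensorAt q (u 0) (v 0)
      + (Real.sqrt (1 - s ^ 2) : ℂ) • tensorAt q (u 1) (v 1)) :
    ∑ i, ‖applyAt q (K i) ψ‖ ^ 2 = 1 := by
  have h : ((∑ i, ‖applyAt q (K i) ψ‖ ^ 2 : ℝ) : ℂ) = 1 := by
    rw [Complex.ofReal_sum, ← schmidtMat_conjTranspose_mul_self_trace h0 h1 hu]
    have e : (schmidtMat s u).conjTranspose * schmidtMat s u =
        (schmidtMat s u).conjTranspose * ((∑ i, (K i).conjTranspose * K i) * schmidtMat s u) := by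
      rw [hK, one_mul]
    rw [e, Finset.sum_mul, Finset.mul_sum, Matrix.trace_sum]
    refine Finset.sum_congr rfl fun i _ => ?_
    rw [applyAt_eq_ofMat hψ, norm_sq_ofMat hv, Matrix.trace_mul_comm, Matrix.conjTranspose_mul]
    simp only [mul_assoc]
  exact_mod_cast h

/-- If the decompositions of `ρ` have total concurrence at least `C`, then their average entropies
are at least that of concurrence `C`. -/
theorem le_avgEntropy {ι : Type*} [Fintype ι] {N : ι → Matrix (Fin 2) (Fin 2) ℂ} {C : ℝ}
    (hv : Orthonormal ℂ v) (hC : 0 ≤ C) {m : ℕ} {p : Fin m → ℝ} {φ : Fin m → QState n}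
    (hens : IsEnsemble p φ (∑ i, ketbra (ofMat q v (N i))))
    (hlow : C ≤ ∑ j, ‖tangleForm (coefMat q v ((√(p j) : ℂ) • φ j))
      (coefMat q v ((√(p j) : ℂ) • φ j))‖) :
    concEntropy C / Real.log 2 ≤ avgEntropy q p φ := by
  classical
  obtain ⟨hp, hp1, hφ, hρ⟩ := hens
  have hk : ∑ j, ketbra ((√(p j) : ℂ) • φ j) = ∑ i, ketbra (ofMat q v (N i)) := by
    rw [← hρ]
    refine Finset.sum_congr rfl fun j _ => ?_
    rw [ketbra_smul, Real.sq_sqrt (hp j)]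
  have hspan := mem_span_of_sum_norm_sq_eq (sum_norm_sq_eq_of_sum_ketbra_eq hk)
  -- Members of positive weight lie in the span of the generating vectors, hence in the range of
  -- `ofMat`, and so are recovered from their coefficient matrices.
  have hmat : ∀ j, p j ≠ 0 → ofMat q v (coefMat q v (φ j)) = φ j := by
    intro j hj
    have h1 : Submodule.span ℂ (Set.range fun i => ofMat q v (N i)) ≤
        LinearMap.range (ofMat q v) := by
      rw [Submodule.span_le]
      rintro _ ⟨i, rfl⟩
      exact ⟨N i, rfl⟩
    have hne : (√(p j) : ℂ) ≠ 0 := by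
      exact_mod_cast (Real.sqrt_pos.2 (lt_of_le_of_ne (hp j) hj.symm)).ne'
    have h2 : φ j ∈ LinearMap.range (ofMat q v) :=
      (Submodule.smul_mem_iff _ hne).1 (h1 (hspan j))
    obtain ⟨M, hM⟩ := h2
    rw [← hM, coefMat_ofMat hv]
  -- A member of weight zero may lie outside that range, so its concurrence is set to zero to remain
  -- in `[0, 1]`.
  let c : Fin m → ℝ := fun j =>
    if p j = 0 then 0 else ‖tangleForm (coefMat q v (φ j)) (coefMat q v (φ j))‖
  have hent : ∀ j, p j * entEntropy q (φ j) = p j * concEntropy (c j) / Real.log 2 ∧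
      c j ∈ Set.Icc (0 : ℝ) 1 := by
    intro j
    by_cases hj : p j = 0
    · simp [hj, c]
    · have h1 := entEntropy_ofMat hv (q := q) (M := coefMat q v (φ j))
        (by rw [hmat j hj, hφ])
      rw [hmat j hj] at h1
      simp only [c, if_neg hj]
      exact ⟨by rw [h1.1]; ring, h1.2⟩
  have hsum : ∑ j, ‖tangleForm (coefMat q v ((√(p j) : ℂ) • φ j))
      (coefMat q v ((√(p j) : ℂ) • φ j))‖ = ∑ j, p j * c j := by
    refine Finset.sum_congr rfl fun j _ => ?_
    by_cases hj : p j = 0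
    · simp [hj]
    · simp only [map_smul, LinearMap.smul_apply, smul_eq_mul, norm_mul, Complex.norm_real,
        Real.norm_of_nonneg (Real.sqrt_nonneg _), c, if_neg hj, ← mul_assoc,
        Real.mul_self_sqrt (hp j)]
  rw [hsum] at hlow
  have h1 := concEntropy_le_sum hp hp1 (fun j => (hent j).2) hC hlow
  rw [avgEntropy, Finset.sum_congr rfl fun j _ => (hent j).1, ← Finset.sum_div]
  exact div_le_div_of_nonneg_right h1 (Real.log_nonneg one_le_two)

/-- The average entropy of an unraveling all of whose trajectories have concurrence `C`. -/
theorem unravelingEntropy_eq {m : ℕ} {K : Fin m → Matrix (Fin 2) (Fin 2) ℂ} {C : ℝ}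
    (hv : Orthonormal ℂ v)
    (hψ : ψ = (s : ℂ) • tensorAt q (u 0) (v 0)
      + (Real.sqrt (1 - s ^ 2) : ℂ) • tensorAt q (u 1) (v 1))
    (h1 : ∑ c, trajProb q K ψ c = 1)
    (hC : ∀ c, ‖tangleForm (K c * schmidtMat s u) (K c * schmidtMat s u)‖ =
      C * ‖ofMat q v (K c * schmidtMat s u)‖ ^ 2) :
    unravelingEntropy q K ψ = concEntropy C / Real.log 2 := by
  rw [unravelingEntropy, avgEntropy]
  have h : ∀ c, trajProb q K ψ c * entEntropy q (trajState q K ψ c) =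
      trajProb q K ψ c * (concEntropy C / Real.log 2) := by
    intro c
    by_cases hc : trajProb q K ψ c = 0
    · simp [hc]
    congr 1
    have hn := (trajState_ensemble K ψ c hc).1
    have ht : trajState q K ψ c = ofMat q v
        (((1 / √(trajProb q K ψ c) : ℝ) : ℂ) • (K c * schmidtMat s u)) := by
      rw [map_smul, trajState, applyAt_eq_ofMat hψ]
    rw [ht] at hn ⊢
    rw [(entEntropy_ofMat hv hn).1]
    congr 2
    have hp : trajProb q K ψ c = ‖ofMat q v (K c * schmidtMat s u)‖ ^ 2 := by
      rw [trajProb, applyAt_eq_ofMat hψ]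
    have h0 : 0 ≤ trajProb q K ψ c := sq_nonneg _
    -- The tangle form is quadratic: normalization divides it by the probability, which cancels the
    -- squared norm in `hC`.
    have hd : (1 / √(trajProb q K ψ c)) * (1 / √(trajProb q K ψ c)) = 1 / trajProb q K ψ c := by
      rw [div_mul_div_comm, Real.mul_self_sqrt h0, one_mul]
    rw [map_smul, map_smul, LinearMap.smul_apply, smul_smul, norm_smul, ← Complex.ofReal_mul, hd,
      Complex.norm_real, Real.norm_of_nonneg (by positivity), hC, ← hp]
    field_simp
  rw [Finset.sum_congr rfl fun c _ => h c, ← Finset.sum_mul, h1, one_mul]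

end Schmidt

/-! ### Tangle and Gram matrices of four operators; minimality. -/

/-- The values of the tangle form on a family of Kraus operators. -/
noncomputable def tangleMat (s : ℝ) (u : Fin 2 → EuclideanSpace ℂ (Fin 2))
    (N : Fin 4 → Matrix (Fin 2) (Fin 2) ℂ) : Matrix (Fin 4) (Fin 4) ℂ :=
  Matrix.of fun i j => tangleForm (N i * schmidtMat s u) (N j * schmidtMat s u)

/-- The Gram matrix of the unnormalized trajectories of a family of Kraus operators. -/
noncomputable def gramMat (s : ℝ) (u : Fin 2 → EuclideanSpace ℂ (Fin 2))
    (N : Fin 4 → Matrix (Fin 2) (Fin 2) ℂ) : Matrix (Fin 4) (Fin 4) ℂ :=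
  Matrix.of fun i j => ((N i * schmidtMat s u).conjTranspose * (N j * schmidtMat s u)).trace

theorem tangleMat_transpose (s : ℝ) (u : Fin 2 → EuclideanSpace ℂ (Fin 2))
    (N : Fin 4 → Matrix (Fin 2) (Fin 2) ℂ) : (tangleMat s u N).transpose = tangleMat s u N := by
  ext i j
  exact tangleForm_comm _ _

theorem gramMat_isHermitian (s : ℝ) (u : Fin 2 → EuclideanSpace ℂ (Fin 2))
    (N : Fin 4 → Matrix (Fin 2) (Fin 2) ℂ) : (gramMat s u N).IsHermitian := by
  ext i j
  rw [Matrix.conjTranspose_apply, gramMat, Matrix.of_apply, Matrix.of_apply,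
    ← Matrix.trace_conjTranspose, Matrix.conjTranspose_mul, Matrix.conjTranspose_conjTranspose]

theorem tangleMat_conj (s : ℝ) (u : Fin 2 → EuclideanSpace ℂ (Fin 2))
    (N : Fin 4 → Matrix (Fin 2) (Fin 2) ℂ) (V : Matrix (Fin 4) (Fin 4) ℂ) (i j : Fin 4) :
    (V.transpose * tangleMat s u N * V) i j =
      tangleForm ((∑ l, V l i • N l) * schmidtMat s u) ((∑ l, V l j • N l) * schmidtMat s u) := by
  simp only [Finset.sum_mul, Matrix.smul_mul, map_sum, map_smul, LinearMap.sum_apply,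
    LinearMap.smul_apply, smul_eq_mul, Matrix.mul_apply, Matrix.transpose_apply, tangleMat,
    Matrix.of_apply]
  refine Finset.sum_congr rfl fun k _ => ?_
  rw [mul_comm, Finset.sum_mul]

theorem gramMat_conj (s : ℝ) (u : Fin 2 → EuclideanSpace ℂ (Fin 2))
    (N : Fin 4 → Matrix (Fin 2) (Fin 2) ℂ) (V : Matrix (Fin 4) (Fin 4) ℂ) (i j : Fin 4) :
    (V.conjTranspose * gramMat s u N * V) i j =
      (((∑ l, V l i • N l) * schmidtMat s u).conjTranspose *
        ((∑ l, V l j • N l) * schmidtMat s u)).trace := by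
  have e : (V.conjTranspose * gramMat s u N * V) i j =
      ∑ k, (∑ l, star (V l i) * gramMat s u N l k) * V k j := by
    simp only [Matrix.mul_apply, Matrix.conjTranspose_apply]
  rw [e]
  simp only [Finset.sum_mul, Matrix.smul_mul, Matrix.conjTranspose_sum,
    Matrix.conjTranspose_smul, Finset.mul_sum, Matrix.mul_smul, Matrix.trace_sum, Matrix.trace_smul,
    smul_eq_mul, gramMat, Matrix.of_apply]
  refine Finset.sum_congr rfl fun k _ => Finset.sum_congr rfl fun l _ => ?_
  ring

/-- A unitary mixing of the Kraus operators which first compresses them to four operators `N` and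
then applies an optimal mixing of these gives the entanglement of formation. -/
theorem isLeast_unravelingEntropy {r R : ℕ} (h : r ≤ R) (h4 : 4 ≤ R)
    {K : Fin r → Matrix (Fin 2) (Fin 2) ℂ} (hK : IsKraus K) {s : ℝ}
    {u : Fin 2 → EuclideanSpace ℂ (Fin 2)} (h0 : 0 ≤ s) (h1 : s ≤ 1) (hu : Orthonormal ℂ u)
    {U₁ U : Matrix (Fin R) (Fin R) ℂ} (hU₁ : U₁ ∈ Matrix.unitaryGroup (Fin R) ℂ)
    (hU : U ∈ Matrix.unitaryGroup (Fin R) ℂ) {N : Fin 4 → Matrix (Fin 2) (Fin 2) ℂ}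
    (hN : ∀ l, mixKraus h K U₁ (Fin.castLE h4 l) = N l)
    (hN0 : ∀ c : Fin R, 4 ≤ c.1 → mixKraus h K U₁ c = 0) {V : Matrix (Fin 4) (Fin 4) ℂ}
    (hV : IsOptimalMixing (tangleMat s u N) (gramMat s u N) V)
    (hUV : ∀ j, mixKraus h K U (Fin.castLE h4 j) = ∑ l, V l j • N l)
    (hU0 : ∀ c : Fin R, 4 ≤ c.1 → mixKraus h K U c = 0)
    {n : ℕ} {q : Fin n} {v : Fin 2 → EuclideanSpace ℂ (RestIdx q)} {ψ : QState n}
    (hv : Orthonormal ℂ v)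
    (hψ : ψ = (s : ℂ) • tensorAt q (u 0) (v 0)
      + (Real.sqrt (1 - s ^ 2) : ℂ) • tensorAt q (u 1) (v 1)) :
    IsLeast (ensembleAverages q (channelAt q K (ketbra ψ)))
        (unravelingEntropy q (mixKraus h K U) ψ) ∧
      ∀ (R' : ℕ) (h' : r ≤ R'), ∀ U' ∈ Matrix.unitaryGroup (Fin R') ℂ,
        unravelingEntropy q (mixKraus h' K U') ψ ∈
          ensembleAverages q (channelAt q K (ketbra ψ)) := by
  have hprob : ∀ (R' : ℕ) (h' : r ≤ R'), ∀ U' ∈ Matrix.unitaryGroup (Fin R') ℂ,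
      ∑ c, trajProb q (mixKraus h' K U') ψ c = 1 := by
    intro R' h' U' hU'
    rw [← sum_norm_sq_applyAt hK h0 h1 hu hv hψ]
    apply sum_norm_sq_of_sum_ketbra_eq
    rw [sum_ketbra_mixKraus h' K hU', channelAt_ketbra]
  have hmem : ∀ (R' : ℕ) (h' : r ≤ R'), ∀ U' ∈ Matrix.unitaryGroup (Fin R') ℂ,
      unravelingEntropy q (mixKraus h' K U') ψ ∈
        ensembleAverages q (channelAt q K (ketbra ψ)) := fun R' h' U' hU' =>
    unravelingEntropy_mem_ensembleAverages (sum_ketbra_mixKraus h' K hU' ψ) (hprob R' h' U' hU')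
  obtain ⟨-, C, hC0, hCeq, hClow⟩ := hV
  -- The compressing unitary does not change the mixed state and leaves only four nonzero operators.
  have hρ : channelAt q K (ketbra ψ) = ∑ l, ketbra (ofMat q v (N l * schmidtMat s u)) := by
    rw [← sum_ketbra_mixKraus h K hU₁, Fin.sum_eq_sum_castLE h4 _ fun i hi => by
      rw [hN0 i hi, applyAt_zero, ketbra_zero]]
    simp only [hN, applyAt_eq_ofMat hψ]
  -- Trace preservation; it removes the normalizing trace from `IsOptimalMixing`.
  have htr : (gramMat s u N).trace = 1 := by
    have e1 : ((∑ l, ‖ofMat q v (N l * schmidtMat s u)‖ ^ 2 : ℝ) : ℂ) = 1 := by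
      have := sum_norm_sq_of_sum_ketbra_eq ((channelAt_ketbra q K ψ).symm.trans hρ)
      rw [← this, sum_norm_sq_applyAt hK h0 h1 hu hv hψ, Complex.ofReal_one]
    rw [← e1, Complex.ofReal_sum]
    refine Finset.sum_congr rfl fun l _ => ?_
    rw [norm_sq_ofMat hv, Matrix.trace_mul_comm]
    rfl
  have hval : unravelingEntropy q (mixKraus h K U) ψ = concEntropy C / Real.log 2 := by
    refine unravelingEntropy_eq hv hψ (hprob R h U hU) fun c => ?_
    by_cases hc : 4 ≤ c.1
    · simp [hU0 c hc]
    · obtain ⟨j, rfl⟩ : ∃ j, c = Fin.castLE h4 j := ⟨⟨c.1, not_le.1 hc⟩, rfl⟩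
      have e := hCeq j
      rw [htr, mul_one, tangleMat_conj, gramMat_conj, Matrix.trace_mul_comm, ← norm_sq_ofMat hv (q := q),
        ← hUV] at e
      rw [e, norm_mul, Complex.norm_real, Complex.norm_real, Real.norm_of_nonneg hC0,
        Real.norm_of_nonneg (sq_nonneg _)]
  refine ⟨⟨hmem R h U hU, ?_⟩, hmem⟩
  rintro _ ⟨m, p, φ, hens, rfl⟩
  rw [hval]
  rw [hρ] at hens
  refine le_avgEntropy hv hC0 hens ?_
  -- Either `C = 0`, where the lower bound is trivial, or the vectors mixed by the Takagi unitary
  -- `V₀` form a diagonalizing family to which Wootters' bound applies.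
  rcases hClow with rfl | ⟨V₀, l, k, hV₀, hl, hτ, rfl⟩
  · exact Finset.sum_nonneg fun _ _ => norm_nonneg _
  · have hk : ∑ j, ketbra ((√(p j) : ℂ) • φ j) =
        ∑ i, ketbra (ofMat q v ((∑ l, V₀ l i • N l) * schmidtMat s u)) := by
      have e1 : ∀ i, ofMat q v ((∑ l, V₀ l i • N l) * schmidtMat s u) =
          ∑ l, V₀ l i • ofMat q v (N l * schmidtMat s u) := fun i => by
        simp [Finset.sum_mul]
      simp only [e1]
      rw [sum_ketbra_mix (mul_eq_one_comm.1 hV₀), ← hens.2.2.2]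
      refine Finset.sum_congr rfl fun j _ => ?_
      rw [ketbra_smul, Real.sq_sqrt (hens.1 j)]
    exact le_sum_norm_of_takagi (tangleForm.compl₁₂ (coefMat q v) (coefMat q v)) hl
      (fun i j => by
        rw [LinearMap.compl₁₂_apply, coefMat_ofMat hv, coefMat_ofMat hv, ← tangleMat_conj, hτ,
          Matrix.diagonal_apply])
      (sum_norm_sq_eq_of_sum_ketbra_eq hk) k

/-! Programs: compilation of computable functions, parallel assignments, loops. -/

namespace RealRAM

theorem IExp.eval_congr {σ τ : State} (h : σ.idx = τ.idx) (e : IExp) : e.eval σ = e.eval τ := by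
  induction e with
  | lit k => rfl
  | reg x => exact congrFun h x
  | add a b iha ihb => simp only [IExp.eval, iha, ihb]
  | sub a b iha ihb => simp only [IExp.eval, iha, ihb]
  | mul a b iha ihb => simp only [IExp.eval, iha, ihb]

theorem State.setMem_self (σ : State) (a : ℕ) (x : ℝ) : (σ.setMem a x).mem a = x :=
  Function.update_self ..

theorem State.setMem_of_ne (σ : State) {a b : ℕ} (x : ℝ) (h : b ≠ a) :
    (σ.setMem a x).mem b = σ.mem b :=
  Function.update_of_ne h ..

/-- `c` writes the value of `f` to the cell `t`, uses otherwise only the cells `t, …, t + m - 1`,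
and takes at most `T` steps. -/
def Evaluates (c : Prog) (f : (ℕ → ℝ) → ℝ) (t m T : ℕ) : Prop :=
  ∀ σ : State, (c.run σ).idx = σ.idx ∧ (c.run σ).mem t = f σ.mem ∧
    (∀ a, a < t ∨ t + m ≤ a → (c.run σ).mem a = σ.mem a) ∧ c.steps σ ≤ T

theorem exists_evaluates_unary {t : ℕ} {f : (ℕ → ℝ) → ℝ} {g : ℝ → ℝ} {e : RExp → RExp}
    (he : ∀ σ a, (e a).eval σ = g (a.eval σ))
    (hf : ∃ c m T, Evaluates c f t m T) :
    ∃ c m T, Evaluates c (fun ω => g (f ω)) t m T := by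
  obtain ⟨c, m, T, h⟩ := hf
  refine ⟨.seq c (.setMem (.lit t) (e (.cell (.lit t)))), m + 1,
    T + ((IExp.lit t).size + (e (.cell (.lit t))).size + 1), fun σ => ?_⟩
  obtain ⟨h1, h2, h3, h4⟩ := h σ
  refine ⟨h1, ?_, fun a ha => ?_, ?_⟩
  · simp [Prog.run, State.setMem, IExp.eval, he, RExp.eval, h2]
  · have hat : a ≠ t := by omega
    simp only [Prog.run, State.setMem, IExp.eval, Function.update_of_ne hat]
    exact h3 a (by omega)
  · simp only [Prog.steps]
    omega

/-- The second argument is evaluated from the cell `t + 1` on, so the first result survives; the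
input cells below `D` are untouched, so the second program sees the original data. -/
theorem exists_evaluates_binary {D t : ℕ} (ht : D ≤ t) {f₁ f₂ : (ℕ → ℝ) → ℝ} {g : ℝ → ℝ → ℝ}
    {e : RExp → RExp → RExp} (he : ∀ σ a b, (e a b).eval σ = g (a.eval σ) (b.eval σ))
    (hf : CompReal D f₂) (h₁ : ∃ c m T, Evaluates c f₁ t m T)
    (h₂ : ∃ c m T, Evaluates c f₂ (t + 1) m T) :
    ∃ c m T, Evaluates c (fun ω => g (f₁ ω) (f₂ ω)) t m T := by
  obtain ⟨c₁, m₁, T₁, h₁⟩ := h₁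
  obtain ⟨c₂, m₂, T₂, h₂⟩ := h₂
  refine ⟨.seq c₁ (.seq c₂ (.setMem (.lit t) (e (.cell (.lit t)) (.cell (.lit (t + 1)))))),
    m₁ + m₂ + 2,
    T₁ + (T₂ + ((IExp.lit t).size + (e (.cell (.lit t)) (.cell (.lit (t + 1)))).size + 1)),
    fun σ => ?_⟩
  obtain ⟨a1, a2, a3, a4⟩ := h₁ σ
  obtain ⟨b1, b2, b3, b4⟩ := h₂ (c₁.run σ)
  have hc : f₂ (c₁.run σ).mem = f₂ σ.mem := hf.congr fun k hk => a3 k (by omega)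
  refine ⟨b1.trans a1, ?_, fun a ha => ?_, ?_⟩
  · simp [Prog.run, State.setMem, IExp.eval, he, RExp.eval, b2, hc, b3 t (by omega), a2]
  · have hat : a ≠ t := by omega
    simp only [Prog.run, State.setMem, IExp.eval, Function.update_of_ne hat]
    rw [b3 a (by omega), a3 a (by omega)]
  · simp only [Prog.steps]
    omega

/-- Computable functions are evaluated by programs with a bounded number of steps. -/
theorem exists_evaluates {D : ℕ} {f : (ℕ → ℝ) → ℝ} (hf : CompReal D f) :
    ∀ t, D ≤ t → ∃ c m T, Evaluates c f t m T := by
  induction hf with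
  | lit q =>
    refine fun t _ => ⟨.setMem (.lit t) (.lit q), 1, 3, fun σ => ⟨rfl, ?_, fun a ha => ?_, le_rfl⟩⟩
    · simp [Prog.run, State.setMem, IExp.eval, RExp.eval]
    · have hat : a ≠ t := by omega
      simp [Prog.run, State.setMem, IExp.eval, hat]
  | cell k _ =>
    refine fun t _ => ⟨.setMem (.lit t) (.cell (.lit k)), 1, 4,
      fun σ => ⟨rfl, ?_, fun a ha => ?_, le_rfl⟩⟩
    · simp [Prog.run, State.setMem, IExp.eval, RExp.eval]
    · have hat : a ≠ t := by omega
      simp [Prog.run, State.setMem, IExp.eval, hat]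
  | add _ h ih₁ ih₂ =>
    exact fun t ht => exists_evaluates_binary ht (g := (· + ·)) (e := .add) (fun _ _ _ => rfl) h
      (ih₁ t ht) (ih₂ (t + 1) (by omega))
  | sub _ h ih₁ ih₂ =>
    exact fun t ht => exists_evaluates_binary ht (g := (· - ·)) (e := .sub) (fun _ _ _ => rfl) h
      (ih₁ t ht) (ih₂ (t + 1) (by omega))
  | mul _ h ih₁ ih₂ =>
    exact fun t ht => exists_evaluates_binary ht (g := (· * ·)) (e := .mul) (fun _ _ _ => rfl) h
      (ih₁ t ht) (ih₂ (t + 1) (by omega))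
  | div _ h ih₁ ih₂ =>
    exact fun t ht => exists_evaluates_binary ht (g := (· / ·)) (e := .div) (fun _ _ _ => rfl) h
      (ih₁ t ht) (ih₂ (t + 1) (by omega))
  | sqrt _ ih =>
    exact fun t ht => exists_evaluates_unary (g := Real.sqrt) (e := .sqrt)
      (fun _ _ => rfl) (ih t ht)
  | cos _ ih =>
    exact fun t ht => exists_evaluates_unary (g := Real.cos) (e := .cos)
      (fun _ _ => rfl) (ih t ht)
  | arccos _ ih =>
    exact fun t ht => exists_evaluates_unary (g := Real.arccos) (e := .arccos)
      (fun _ _ => rfl) (ih t ht)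
  | ite ha hb hf hg iha ihb ihf ihg =>
    intro t ht
    obtain ⟨c₁, m₁, T₁, h₁⟩ := iha t ht
    obtain ⟨c₂, m₂, T₂, h₂⟩ := ihb (t + 1) (by omega)
    obtain ⟨c₃, m₃, T₃, h₃⟩ := ihf t ht
    obtain ⟨c₄, m₄, T₄, h₄⟩ := ihg t ht
    refine ⟨.seq c₁ (.seq c₂ (.ifReal (.cell (.lit t)) (.cell (.lit (t + 1))) c₃ c₄)),
      m₁ + m₂ + m₃ + m₄ + 2, T₁ + (T₂ + (5 + (T₃ + T₄))), fun σ => ?_⟩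
    obtain ⟨a1, a2, a3, a4⟩ := h₁ σ
    obtain ⟨b1, b2, b3, b4⟩ := h₂ (c₁.run σ)
    obtain ⟨d1, d2, d3, d4⟩ := h₃ (c₂.run (c₁.run σ))
    obtain ⟨e1, e2, e3, e4⟩ := h₄ (c₂.run (c₁.run σ))
    have hk : ∀ k < D, (c₂.run (c₁.run σ)).mem k = σ.mem k := fun k hk => by
      rw [b3 k (by omega), a3 k (by omega)]
    have hA := b3 t (by omega)
    rw [a2] at hA
    have hB := hb.congr (ω := (c₁.run σ).mem) (ω' := σ.mem) fun k hk => a3 k (by omega)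
    rw [hB] at b2
    simp only [Prog.run, Prog.steps, RExp.eval, IExp.eval, hA, b2, RExp.size, IExp.size]
    split_ifs
    · refine ⟨d1.trans (b1.trans a1), d2.trans (hf.congr hk), fun a ha => ?_, by omega⟩
      rw [d3 a (by omega), b3 a (by omega), a3 a (by omega)]
    · refine ⟨e1.trans (b1.trans a1), e2.trans (hg.congr hk), fun a ha => ?_, by omega⟩
      rw [e3 a (by omega), b3 a (by omega), a3 a (by omega)]

/-- Finitely many computable functions are evaluated by one program. -/
theorem exists_evaluates_family {D t : ℕ} (ht : D ≤ t) {ι : Type*} [Fintype ι]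
    {F : ι → (ℕ → ℝ) → ℝ} (hF : ∀ i, CompReal D (F i)) :
    ∃ (A : ι → ℕ) (c : Prog) (m T : ℕ), (∀ i, t ≤ A i ∧ A i < t + m) ∧ ∀ σ : State,
      (c.run σ).idx = σ.idx ∧ (∀ i, (c.run σ).mem (A i) = F i σ.mem) ∧
      (∀ a, a < t ∨ t + m ≤ a → (c.run σ).mem a = σ.mem a) ∧ c.steps σ ≤ T := by
  have key : ∀ n (G : Fin n → (ℕ → ℝ) → ℝ), (∀ i, CompReal D (G i)) →
      ∃ (c : Prog) (m T : ℕ), n ≤ m ∧ ∀ σ : State,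
        (c.run σ).idx = σ.idx ∧ (∀ i, (c.run σ).mem (t + i.1) = G i σ.mem) ∧
        (∀ a, a < t ∨ t + m ≤ a → (c.run σ).mem a = σ.mem a) ∧ c.steps σ ≤ T := by
    intro n
    induction n with
    | zero => exact fun G _ => ⟨.skip, 0, 1, le_rfl, fun σ => ⟨rfl, fun i => i.elim0,
        fun _ _ => rfl, le_rfl⟩⟩
    | succ n ih =>
      intro G hG
      obtain ⟨c, m, T, hm, h⟩ := ih (fun i => G i.castSucc) fun i => hG _
      -- The next value goes right behind the finished ones; its scratch cells may overlap leftovers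
      -- of `c`, which are no longer needed.
      obtain ⟨c', m', T', h'⟩ := exists_evaluates (hG (Fin.last n)) (t + n) (by omega)
      refine ⟨.seq c c', m + m' + n + 1, T + T', by omega, fun σ => ?_⟩
      obtain ⟨a1, a2, a3, a4⟩ := h σ
      obtain ⟨b1, b2, b3, b4⟩ := h' (c.run σ)
      refine ⟨b1.trans a1, fun i => ?_, fun a ha => ?_, ?_⟩
      · refine Fin.lastCases ?_ (fun j => ?_) i
        · exact b2.trans ((hG _).congr fun k hk => a3 k (by omega))
        · exact (b3 _ (by simp)).trans (a2 j)
      · exact (b3 a (by omega)).trans (a3 a (by omega))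
      · simp only [Prog.steps]
        omega
  obtain ⟨c, m, T, hm, h⟩ := key (Fintype.card ι) (fun i => F ((Fintype.equivFin ι).symm i))
    fun i => hF _
  refine ⟨fun i => t + (Fintype.equivFin ι i).1, c, m, T, fun i => ⟨by simp, ?_⟩, fun σ => ?_⟩
  · beta_reduce
    have := (Fintype.equivFin ι i).2
    omega
  · obtain ⟨a1, a2, a3, a4⟩ := h σ
    exact ⟨a1, fun i => by simpa using a2 (Fintype.equivFin ι i), a3, a4⟩

/-- The assignments of `e i` to the cells `A i`, for `i` in a list. -/
def assignList {ι : Type*} (A : ι → IExp) (e : ι → RExp) : List ι → Prog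
  | [] => .skip
  | i :: L => .seq (.setMem (A i) (e i)) (assignList A e L)

/-- The assignments of `e i` to the cells `A i`. -/
noncomputable def assign {ι : Type*} [Fintype ι] (A : ι → IExp) (e : ι → RExp) : Prog :=
  assignList A e Finset.univ.toList

/-- No right-hand side depends on an assigned cell, so sequential execution has the effect of a
simultaneous assignment. The reference state `σ₀` is kept apart from the running state for the
induction. -/
theorem assignList_run {ι : Type*} {A : ι → IExp} {e : ι → RExp} {σ₀ : State}
    (hinj : Function.Injective fun i => (A i).eval σ₀)
    (hind : ∀ i, ∀ σ : State, σ.idx = σ₀.idx →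
      (∀ a, (∀ j, (A j).eval σ₀ ≠ a) → σ.mem a = σ₀.mem a) → (e i).eval σ = (e i).eval σ₀)
    (L : List ι) : ∀ σ : State, σ.idx = σ₀.idx →
      (∀ a, (∀ j, (A j).eval σ₀ ≠ a) → σ.mem a = σ₀.mem a) →
      ((assignList A e L).run σ).idx = σ₀.idx ∧
      (∀ i ∈ L, ((assignList A e L).run σ).mem ((A i).eval σ₀) = (e i).eval σ₀) ∧
      ∀ a, (∀ i ∈ L, (A i).eval σ₀ ≠ a) → ((assignList A e L).run σ).mem a = σ.mem a := by
  induction L with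
  | nil => exact fun σ h _ => ⟨h, by simp, fun _ _ => rfl⟩
  | cons i L ih =>
    intro σ hσ hmem
    have hA : (A i).eval σ = (A i).eval σ₀ := IExp.eval_congr hσ _
    obtain ⟨h1, h2, h3⟩ := ih (σ.setMem ((A i).eval σ) ((e i).eval σ)) hσ fun a ha => by
      rw [hA, State.setMem_of_ne _ _ (ha i).symm, hmem a ha]
    refine ⟨h1, fun j hj => ?_, fun a ha => ?_⟩
    · by_cases hjL : j ∈ L
      · exact h2 j hjL
      · obtain rfl : j = i := by
          rcases List.mem_cons.1 hj with h | h
          · exact h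
          · exact absurd h hjL
        refine (h3 _ fun k hk h => hjL ?_).trans ?_
        · rwa [← hinj h]
        · rw [hA, State.setMem_self, hind j σ hσ hmem]
    · refine (h3 a fun k hk => ha k (List.mem_cons_of_mem _ hk)).trans ?_
      rw [hA, State.setMem_of_ne _ _ (ha i List.mem_cons_self).symm]

theorem exists_assignList_steps {ι : Type*} (A : ι → IExp) (e : ι → RExp) (L : List ι) :
    ∃ T, ∀ σ, (assignList A e L).steps σ ≤ T := by
  induction L with
  | nil => exact ⟨1, fun σ => le_rfl⟩
  | cons i L ih =>
    obtain ⟨T, hT⟩ := ih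
    refine ⟨(A i).size + (e i).size + 1 + T, fun σ => ?_⟩
    have := hT ((Prog.setMem (A i) (e i)).run σ)
    simp only [assignList, Prog.steps]
    omega

theorem exists_assign_steps {ι : Type*} [Fintype ι] (A : ι → IExp) (e : ι → RExp) :
    ∃ T, ∀ σ, (assign A e).steps σ ≤ T := exists_assignList_steps A e _

/-- Assignments of expressions that do not read the assigned cells. -/
theorem assign_run {ι : Type*} [Fintype ι] {A : ι → IExp} {e : ι → RExp} {σ : State}
    (hinj : Function.Injective fun i => (A i).eval σ)
    (hind : ∀ i, ∀ τ : State, τ.idx = σ.idx →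
      (∀ a, (∀ j, (A j).eval σ ≠ a) → τ.mem a = σ.mem a) → (e i).eval τ = (e i).eval σ) :
    ((assign A e).run σ).idx = σ.idx ∧
      (∀ i, ((assign A e).run σ).mem ((A i).eval σ) = (e i).eval σ) ∧
      ∀ a, (∀ i, (A i).eval σ ≠ a) → ((assign A e).run σ).mem a = σ.mem a := by
  obtain ⟨h1, h2, h3⟩ := assignList_run hinj hind Finset.univ.toList σ rfl fun _ _ => rfl
  exact ⟨h1, fun i => h2 i (by simp), fun a ha => h3 a fun i _ => ha i⟩

/-- An invariant indexed by the number of completed iterations, together with a uniform cost of the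
body; the extra 1 is the charge for each iteration. -/
theorem loop_spec {x : ℕ} {b : IExp} {c : Prog} {I : ℕ → State → Prop} {T n : ℕ} {σ : State}
    (hn : b.eval σ = n) (h0 : I 0 σ)
    (hstep : ∀ k < n, ∀ τ, I k τ → I (k + 1) (c.run (τ.setIdx x k)) ∧
      c.steps (τ.setIdx x k) ≤ T) :
    I n ((Prog.loop x b c).run σ) ∧ (Prog.loop x b c).steps σ ≤ b.size + 1 + n * (T + 1) := by
  have key : ∀ k ≤ n, I k (iter c.run x σ k) := by
    intro k
    induction k with
    | zero => exact fun _ => h0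
    | succ k ih => exact fun hk => (hstep k hk _ (ih (by omega))).1
  simp only [Prog.run, Prog.steps, hn]
  refine ⟨key n le_rfl, ?_⟩
  have h1 : ∑ k ∈ Finset.range n, (c.steps ((iter c.run x σ k).setIdx x k) + 1) ≤
      ∑ _k ∈ Finset.range n, (T + 1) := by
    refine Finset.sum_le_sum fun k hk => ?_
    have hk' := Finset.mem_range.1 hk
    have := (hstep k hk' _ (key k hk'.le)).2
    omega
  rw [Finset.sum_const, Finset.card_range, smul_eq_mul] at h1
  omega

end RealRAM

/-! Operations on the columns of a complex matrix with `R` columns in the memory. -/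

open Classical in
/-- The row `a`, with its entries in the columns `cs` multiplied by the matrix `V`. -/
noncomputable def rowOp {k R : ℕ} (cs : Fin k → Fin R) (V : Matrix (Fin k) (Fin k) ℂ)
    (a : Fin R → ℂ) : Fin R → ℂ :=
  fun c => if h : ∃ j, cs j = c then ∑ l, a (cs l) * V l h.choose else a c

section RowOp

variable {k R : ℕ} {cs : Fin k → Fin R} {V : Matrix (Fin k) (Fin k) ℂ}

theorem rowOp_apply (hcs : Function.Injective cs) (a : Fin R → ℂ) (j : Fin k) :
    rowOp cs V a (cs j) = ∑ l, a (cs l) * V l j := by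
  have h : ∃ j', cs j' = cs j := ⟨j, rfl⟩
  rw [rowOp, dif_pos h, hcs h.choose_spec]

theorem rowOp_of_ne (a : Fin R → ℂ) {c : Fin R} (h : ∀ j, cs j ≠ c) : rowOp cs V a c = a c := by
  rw [rowOp, dif_neg]
  push Not
  exact h

/-- Linearity in the row: a row that is a combination of others remains the same combination after
the column operation. -/
theorem rowOp_sum {ι : Type*} [Fintype ι] (x : ι → ℂ) (a : ι → Fin R → ℂ) (c : Fin R) :
    rowOp cs V (fun c => ∑ i, x i * a i c) c = ∑ i, x i * rowOp cs V (a i) c := by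
  unfold rowOp
  split_ifs with h
  · simp only [Finset.sum_mul, Finset.mul_sum]
    rw [Finset.sum_comm]
    exact Finset.sum_congr rfl fun i _ => Finset.sum_congr rfl fun l _ => by ring
  · rfl

/-- A unitary acting on the selected columns preserves inner products of rows, hence unitarity of
the stored block. -/
theorem rowOp_inner (hcs : Function.Injective cs) (hV : V * V.conjTranspose = 1)
    (a b : Fin R → ℂ) : ∑ c, rowOp cs V a c * star (rowOp cs V b c) = ∑ c, a c * star (b c) := by
  classical
  have hsplit : ∀ f : Fin R → ℂ, ∑ c, f c =
      ∑ j, f (cs j) + ∑ c ∈ (Finset.univ.image cs)ᶜ, f c := by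
    intro f
    rw [← Finset.sum_image (s := Finset.univ) (g := cs) (f := f) (hcs.injOn),
      Finset.sum_add_sum_compl]
  rw [hsplit, hsplit fun c => a c * star (b c)]
  congr 1
  · simp only [rowOp_apply hcs]
    have h : ∀ l m, ∑ j, V l j * star (V m j) = if l = m then 1 else 0 := fun l m => by
      rw [← Matrix.one_apply, ← hV, Matrix.mul_apply]
      rfl
    have h1 : ∀ j, (∑ l, a (cs l) * V l j) * star (∑ l, b (cs l) * V l j) =
        ∑ l, ∑ m, a (cs l) * star (b (cs m)) * (V l j * star (V m j)) := by
      intro j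
      rw [star_sum, Finset.sum_mul_sum]
      refine Finset.sum_congr rfl fun l _ => Finset.sum_congr rfl fun m _ => ?_
      rw [star_mul']
      ring
    simp only [h1]
    rw [Finset.sum_comm]
    refine Finset.sum_congr rfl fun l _ => ?_
    rw [Finset.sum_comm]
    simp only [← Finset.mul_sum, h]
    simp
  · refine Finset.sum_congr rfl fun c hc => ?_
    have hne : ∀ j, cs j ≠ c := by simpa using hc
    rw [rowOp_of_ne _ hne, rowOp_of_ne _ hne]

end RowOp

namespace RealRAM

/-- The address of a part of the entry in row `ρ` and column `c`. -/
def entryAddr (ρ c : IExp) (p : Fin 2) : IExp :=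
  .add (.add (.reg 3) (.mul (.lit 2) (.add (.mul (.reg 2) ρ) c))) (.lit p.1)

theorem entryAddr_eval (ρ c : IExp) (p : Fin 2) (σ : State) : (entryAddr ρ c p).eval σ =
    σ.idx 3 + 2 * (σ.idx 2 * ρ.eval σ + c.eval σ) + p.1 := rfl

/-- Addresses are mixed-radix numbers with digits `p < 2` and `c < R`, so distinct entries occupy
distinct cells. -/
theorem entry_inj {R b ρ ρ' : ℕ} {c c' : Fin R} {p p' : Fin 2}
    (h : b + 2 * (R * ρ + c.1) + p.1 = b + 2 * (R * ρ' + c'.1) + p'.1) :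
    ρ = ρ' ∧ c = c' ∧ p = p' := by
  have hp : p.1 = p'.1 := by omega
  have h1 : R * ρ + c.1 = R * ρ' + c'.1 := by omega
  have hR : 0 < R := c.pos
  have h2 : ρ = ρ' := by
    have := congrArg (· / R) h1
    simpa [Nat.mul_add_div hR, Nat.div_eq_of_lt c.2, Nat.div_eq_of_lt c'.2] using this
  subst h2
  exact ⟨rfl, Fin.ext (by omega), Fin.ext hp⟩

/-- The sum of a list of expressions. -/
def RExp.sum : List RExp → RExp
  | [] => .lit 0
  | e :: L => .add e (RExp.sum L)

theorem RExp.sum_eval {k : ℕ} (e : Fin k → RExp) (σ : State) :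
    (RExp.sum (List.ofFn e)).eval σ = ∑ i, (e i).eval σ := by
  rw [← List.sum_ofFn]
  have : ∀ L : List RExp, (RExp.sum L).eval σ = (L.map fun e => e.eval σ).sum := by
    intro L
    induction L with
    | nil => simp [RExp.sum, RExp.eval]
    | cons e L ih => simp [RExp.sum, RExp.eval, ih]
  rw [this, List.map_ofFn]
  rfl

/-- A part of the product of two complex numbers given by their parts. -/
def RExp.mulPart (x y : Fin 2 → RExp) (p : Fin 2) : RExp :=
  if p = 0 then .sub (.mul (x 0) (y 0)) (.mul (x 1) (y 1))
  else .add (.mul (x 0) (y 1)) (.mul (x 1) (y 0))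

theorem RExp.mulPart_eval {x y : Fin 2 → RExp} {z w : ℂ} {σ : State}
    (hx : ∀ p, (x p).eval σ = part z p) (hy : ∀ p, (y p).eval σ = part w p) (p : Fin 2) :
    (RExp.mulPart x y p).eval σ = part (z * w) p := by
  unfold RExp.mulPart
  fin_cases p <;> simp [RExp.eval, hx, hy, part]

theorem part_sum {ι : Type*} (s : Finset ι) (f : ι → ℂ) (p : Fin 2) :
    part (∑ i ∈ s, f i) p = ∑ i ∈ s, part (f i) p := by
  unfold part
  split_ifs <;> simp

/-- Multiplication of the entries in the columns `cs` of the row in index register `4` by the matrix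
in the cells `A`, with temporary cells from the address `tb` on. -/
noncomputable def rowProg {k : ℕ} (cs : Fin k → IExp) (A : Fin k × Fin k × Fin 2 → ℕ) (tb : ℕ) :
    Prog :=
  .seq (assign (fun x : Fin k × Fin 2 => .lit (tb + 2 * x.1.1 + x.2.1))
      fun x => .cell (entryAddr (.reg 4) (cs x.1) x.2))
    (assign (fun x : Fin k × Fin 2 => entryAddr (.reg 4) (cs x.1) x.2)
      fun x => RExp.sum (List.ofFn fun l => RExp.mulPart
        (fun p => .cell (.lit (tb + 2 * l.1 + p.1))) (fun p => .cell (.lit (A (l, x.1, p)))) x.2))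

theorem exists_rowProg_steps {k : ℕ} (cs : Fin k → IExp) (A : Fin k × Fin k × Fin 2 → ℕ) (tb : ℕ) :
    ∃ T, ∀ σ, (rowProg cs A tb).steps σ ≤ T := by
  obtain ⟨T₁, h₁⟩ := exists_assign_steps (fun x : Fin k × Fin 2 => IExp.lit (tb + 2 * x.1.1 + x.2.1))
      fun x => RExp.cell (entryAddr (.reg 4) (cs x.1) x.2)
  obtain ⟨T₂, h₂⟩ := exists_assign_steps
    (fun x : Fin k × Fin 2 => entryAddr (.reg 4) (cs x.1) x.2)
      fun x => RExp.sum (List.ofFn fun l => RExp.mulPart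
        (fun p => .cell (.lit (tb + 2 * l.1 + p.1))) (fun p => .cell (.lit (A (l, x.1, p)))) x.2)
  exact ⟨T₁ + T₂, fun σ => Nat.add_le_add (h₁ _) (h₂ _)⟩

/-- Every new entry needs all the old ones, so these are first copied to temporary cells. The
coefficients below `tb`, the temporaries, and the matrix from `b` on are disjoint regions. -/
theorem rowProg_run {k R b ρ tb : ℕ} {cs : Fin k → IExp} {A : Fin k × Fin k × Fin 2 → ℕ}
    {V : Matrix (Fin k) (Fin k) ℂ} {a : Fin R → ℂ} {csv : Fin k → Fin R} {σ : State}
    (h2 : σ.idx 2 = R) (h3 : σ.idx 3 = b) (h4 : σ.idx 4 = ρ) (hcs : ∀ j, (cs j).eval σ = csv j)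
    (hinj : Function.Injective csv) (hA : ∀ x, A x < tb) (htb : tb + 2 * k ≤ b)
    (ha : ∀ (c : Fin R) (p : Fin 2), σ.mem (b + 2 * (R * ρ + c.1) + p.1) = part (a c) p)
    (hV : ∀ l j p, σ.mem (A (l, j, p)) = part (V l j) p) :
    ((rowProg cs A tb).run σ).idx = σ.idx ∧
      (∀ (c : Fin R) (p : Fin 2), ((rowProg cs A tb).run σ).mem (b + 2 * (R * ρ + c.1) + p.1) =
        part (rowOp csv V a c) p) ∧
      (∀ x < tb, ((rowProg cs A tb).run σ).mem x = σ.mem x) ∧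
      ∀ x, b ≤ x → (∀ (c : Fin R) (p : Fin 2), x ≠ b + 2 * (R * ρ + c.1) + p.1) →
        ((rowProg cs A tb).run σ).mem x = σ.mem x := by
  have hent : ∀ τ : State, τ.idx = σ.idx → ∀ x : Fin k × Fin 2,
      (entryAddr (.reg 4) (cs x.1) x.2).eval τ = b + 2 * (R * ρ + (csv x.1).1) + x.2.1 := by
    intro τ hτ x
    rw [IExp.eval_congr hτ, entryAddr_eval, h2, h3, hcs]
    simp only [IExp.eval, h4]
  obtain ⟨a1, a2, a3⟩ := assign_run (σ := σ)
    (A := fun x : Fin k × Fin 2 => IExp.lit (tb + 2 * x.1.1 + x.2.1))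
    (e := fun x => RExp.cell (entryAddr (.reg 4) (cs x.1) x.2))
    (fun x y hxy => by
      simp only [IExp.eval] at hxy
      have := x.2.2
      have := y.2.2
      exact Prod.ext (Fin.ext (by omega)) (Fin.ext (by omega)))
    (fun x τ hτ hmem => by
      simp only [RExp.eval]
      rw [hent τ hτ, hent σ rfl]
      refine hmem _ fun y => ?_
      simp only [IExp.eval]
      have := y.1.2
      have := y.2.2
      omega)
  set σ₁ := (assign (fun x : Fin k × Fin 2 => IExp.lit (tb + 2 * x.1.1 + x.2.1))
    (fun x => RExp.cell (entryAddr (.reg 4) (cs x.1) x.2))).run σ with hσ₁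
  have htmp : ∀ (l : Fin k) (p : Fin 2), σ₁.mem (tb + 2 * l.1 + p.1) = part (a (csv l)) p := by
    intro l p
    exact (a2 (l, p)).trans ((congrArg σ.mem (hent σ rfl (l, p))).trans (ha _ _))
  have hlow : ∀ x < tb, σ₁.mem x = σ.mem x := fun x hx => a3 x fun y => by
    simp only [IExp.eval]
    omega
  have hhigh : ∀ x, b ≤ x → σ₁.mem x = σ.mem x := fun x hx => a3 x fun y => by
    simp only [IExp.eval]
    have := y.1.2
    have := y.2.2
    omega
  have hsum : ∀ (x : Fin k × Fin 2) (τ : State),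
      (∀ (l : Fin k) (p : Fin 2), τ.mem (tb + 2 * l.1 + p.1) = part (a (csv l)) p) →
      (∀ y < tb, τ.mem y = σ.mem y) →
      (RExp.sum (List.ofFn fun l : Fin k => RExp.mulPart
        (fun p => .cell (.lit (tb + 2 * l.1 + p.1))) (fun p => .cell (.lit (A (l, x.1, p))))
        x.2)).eval τ = part (∑ l, a (csv l) * V l x.1) x.2 := by
    intro x τ ht hl
    rw [RExp.sum_eval, part_sum]
    refine Finset.sum_congr rfl fun l _ => RExp.mulPart_eval
      (x := fun p => .cell (.lit (tb + 2 * l.1 + p.1)))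
      (y := fun p => .cell (.lit (A (l, x.1, p)))) (fun p => ht l p) (fun p => ?_) _
    exact (hl _ (hA _)).trans (hV _ _ _)
  obtain ⟨b1, b2, b3⟩ := assign_run (σ := σ₁)
    (A := fun x : Fin k × Fin 2 => entryAddr (.reg 4) (cs x.1) x.2)
    (e := fun x => RExp.sum (List.ofFn fun l => RExp.mulPart
      (fun p => .cell (.lit (tb + 2 * l.1 + p.1))) (fun p => .cell (.lit (A (l, x.1, p)))) x.2))
    (fun x y hxy => by
      simp only [hent σ₁ a1] at hxy
      obtain ⟨-, e1, e2⟩ := entry_inj hxy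
      exact Prod.ext (hinj e1) e2)
    (fun x τ hτ hmem => by
      have hoff : ∀ y < b, τ.mem y = σ₁.mem y := fun y hy => hmem y fun z => by
        rw [hent σ₁ a1]
        omega
      rw [hsum x σ₁ htmp hlow, hsum x τ (fun l p => ?_) fun y hy => ?_]
      · rw [hoff, htmp]
        have := l.2
        have := p.2
        omega
      · rw [hoff y (by omega), hlow y hy])
  refine ⟨b1.trans a1, fun c p => ?_, fun x hx => ?_, fun x hx hne => ?_⟩
  · by_cases hc : ∃ j, csv j = c
    · obtain ⟨j, rfl⟩ := hc
      have := b2 (j, p)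
      rw [hent σ₁ a1, hsum _ σ₁ htmp hlow] at this
      rw [rowOp_apply hinj]
      exact this
    · push Not at hc
      rw [rowOp_of_ne _ hc, ← ha]
      refine (b3 _ fun x => ?_).trans (hhigh _ (by omega))
      rw [hent σ₁ a1]
      intro h
      exact hc x.1 (entry_inj h).2.1
  · refine (b3 _ fun y => ?_).trans (hlow x hx)
    rw [hent σ₁ a1]
    omega
  · refine (b3 _ fun y => ?_).trans (hhigh x hx)
    rw [hent σ₁ a1]
    exact (hne _ _).symm

/-- The memory holds a matrix `Z` with `R` columns and `R + 4` rows from the address `b` on, and the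
values `hdr` in the first cells. -/
structure Holds (R b : ℕ) (hdr : ℕ → ℝ) (Z : ℕ → Fin R → ℂ) (σ : State) : Prop where
  out : σ.idx 1 = b + 8 * R
  cols : σ.idx 2 = R
  base : σ.idx 3 = b
  header : ∀ x < 9, σ.mem x = hdr x
  entry : ∀ ρ < R + 4, ∀ (c : Fin R) (p : Fin 2),
    σ.mem (b + 2 * (R * ρ + c.1) + p.1) = part (Z ρ c) p

theorem Holds.congr_idx {R b : ℕ} {hdr : ℕ → ℝ} {Z : ℕ → Fin R → ℂ} {σ τ : State}
    (h : Holds R b hdr Z σ) (hidx : ∀ x, x = 1 ∨ x = 2 ∨ x = 3 → τ.idx x = σ.idx x)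
    (hmem : τ.mem = σ.mem) : Holds R b hdr Z τ where
  out := (hidx 1 (by simp)).trans h.out
  cols := (hidx 2 (by simp)).trans h.cols
  base := (hidx 3 (by simp)).trans h.base
  header x hx := by rw [hmem, h.header x hx]
  entry ρ hρ c p := by rw [hmem, h.entry ρ hρ c p]

theorem setIdx_of_ne (σ : State) {x y : ℕ} (k : ℕ) (h : y ≠ x) : (σ.setIdx x k).idx y = σ.idx y :=
  Function.update_of_ne h ..

theorem setIdx_self (σ : State) (x k : ℕ) : (σ.setIdx x k).idx x = k :=
  Function.update_self ..

/-- A computable column operation: the entries of the columns `cs` in the first four rows determine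
a matrix `V`, and the columns `cs` are multiplied by `V`. -/
theorem exists_colProg {k : ℕ} (hk : k ≤ 4) {V : (ℕ → ℝ) → Matrix (Fin k) (Fin k) ℂ}
    (hV : Comp 41 V) (cs : Fin k → IExp) :
    ∃ (c : Prog) (B T : ℕ), ∀ (R b : ℕ) (hdr : ℕ → ℝ) (Z : ℕ → Fin R → ℂ) (σ : State)
      (csv : Fin k → Fin R), B ≤ b → Holds R b hdr Z σ → Function.Injective csv →
      (∀ j (τ : State), (∀ x, x ≠ 4 → τ.idx x = σ.idx x) → (cs j).eval τ = csv j) →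
      (∀ x, x ≠ 4 → (c.run σ).idx x = σ.idx x) ∧ c.steps σ ≤ T * (R + 5) ∧
      ∃ ω : ℕ → ℝ, (∀ x < 9, ω x = hdr x) ∧
        (∀ (l : Fin k) (e : Fin 4) (p : Fin 2),
          ω (9 + 8 * l.1 + 2 * e.1 + p.1) = part (Z e.1 (csv l)) p) ∧
        Holds R b hdr (fun ρ => rowOp csv (V ω) (Z ρ)) (c.run σ) := by
  -- At most four columns with four complex entries each fill the cells 9 to 40 behind the header,
  -- so scratch space starts at 41.
  obtain ⟨A, c₂, m, T₂, hA, h₂⟩ := exists_evaluates_family (le_refl 41)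
    (F := fun (x : Fin k × Fin k × Fin 2) ω => part (V ω x.1 x.2.1) x.2.2) (fun x => by
      unfold part
      split_ifs
      exacts [(hV _ _).1, (hV _ _).2])
  let A₁ : Fin k × Fin 4 × Fin 2 → IExp := fun x => .lit (9 + 8 * x.1.1 + 2 * x.2.1.1 + x.2.2.1)
  let e₁ : Fin k × Fin 4 × Fin 2 → RExp := fun x => .cell (entryAddr (.lit x.2.1.1) (cs x.1) x.2.2)
  obtain ⟨T₁, h₁⟩ := exists_assign_steps A₁ e₁
  obtain ⟨T₃, h₃⟩ := exists_rowProg_steps cs A (41 + m)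
  refine ⟨.seq (assign A₁ e₁) (.seq c₂ (.loop 4 (.add (.reg 2) (.lit 4)) (rowProg cs A (41 + m)))),
    41 + m + 2 * k, T₁ + T₂ + T₃ + 5, fun R b hdr Z σ csv hb hZ hinj hcs => ?_⟩
  have hent : ∀ x : Fin k × Fin 4 × Fin 2, ∀ τ : State, τ.idx = σ.idx →
      (entryAddr (.lit x.2.1.1) (cs x.1) x.2.2).eval τ =
        b + 2 * (R * x.2.1.1 + (csv x.1).1) + x.2.2.1 := by
    intro x τ hτ
    rw [IExp.eval_congr hτ, entryAddr_eval, hZ.cols, hZ.base, hcs x.1 σ fun _ _ => rfl]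
    rfl
  obtain ⟨a1, a2, a3⟩ := assign_run (σ := σ) (A := A₁) (e := e₁)
    (fun x y hxy => by
      simp only [A₁, IExp.eval] at hxy
      have := x.2.1.2
      have := y.2.1.2
      have := x.2.2.2
      have := y.2.2.2
      exact Prod.ext (Fin.ext (by omega)) (Prod.ext (Fin.ext (by omega)) (Fin.ext (by omega))))
    (fun x τ hτ hmem => by
      simp only [e₁, RExp.eval]
      rw [hent x τ hτ, hent x σ rfl]
      refine hmem _ fun y => ?_
      simp only [A₁, IExp.eval]
      have := y.1.2
      have := y.2.1.2
      have := y.2.2.2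
      omega)
  set σ₁ := (assign A₁ e₁).run σ with hσ₁
  obtain ⟨b1, b2, b3, b4⟩ := h₂ σ₁
  set σ₂ := c₂.run σ₁ with hσ₂
  have hoff : ∀ x, x < 9 ∨ b ≤ x → σ₂.mem x = σ.mem x := by
    intro x hx
    rw [b3 x (by omega)]
    refine a3 x fun y => ?_
    simp only [A₁, IExp.eval]
    have := y.1.2
    have := y.2.1.2
    have := y.2.2.2
    omega
  have hidx₂ : σ₂.idx = σ.idx := b1.trans a1
  -- The matrix `V` is computed once, before any row changes; after `i` iterations exactly the rows
  -- below `i` are transformed.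
  obtain ⟨c1, c2⟩ := loop_spec (x := 4) (b := .add (.reg 2) (.lit 4)) (c := rowProg cs A (41 + m))
    (T := T₃) (n := R + 4) (σ := σ₂)
    (I := fun i τ => (∀ x, x ≠ 4 → τ.idx x = σ.idx x) ∧ (∀ x < 41 + m, τ.mem x = σ₂.mem x) ∧
      ∀ ρ < R + 4, ∀ (c : Fin R) (p : Fin 2), τ.mem (b + 2 * (R * ρ + c.1) + p.1) =
        part (if ρ < i then rowOp csv (V σ₁.mem) (Z ρ) c else Z ρ c) p)
    (by simp only [IExp.eval, hidx₂, hZ.cols])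
    ⟨fun x _ => by rw [hidx₂], fun x _ => rfl, fun ρ hρ c p => by
      rw [hoff _ (by omega), hZ.entry ρ hρ]
      simp⟩
    (fun i hi τ hI => by
      obtain ⟨i1, i2, i3⟩ := hI
      obtain ⟨d1, d2, d3, d4⟩ := rowProg_run (R := R) (b := b) (ρ := i) (tb := 41 + m) (cs := cs)
        (A := A) (V := V σ₁.mem) (a := Z i) (csv := csv) (σ := τ.setIdx 4 i)
        (by rw [setIdx_of_ne _ _ (by decide), i1 2 (by decide), hZ.cols])
        (by rw [setIdx_of_ne _ _ (by decide), i1 3 (by decide), hZ.base])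
        (setIdx_self _ _ _)
        (fun j => hcs j _ fun x hx => by rw [setIdx_of_ne _ _ hx, i1 x hx])
        hinj (fun x => (hA x).2) hb
        (fun c p => by
          have := i3 i hi c p
          rw [if_neg (lt_irrefl i)] at this
          exact this)
        (fun l j p => by
          refine (i2 _ (hA _).2).trans ?_
          exact b2 (l, j, p))
      refine ⟨⟨fun x hx => ?_, fun x hx => (d3 x hx).trans (i2 x hx), fun ρ hρ c p => ?_⟩, h₃ _⟩
      · rw [d1, setIdx_of_ne _ _ hx, i1 x hx]
      · by_cases hρi : ρ = i
        · subst hρi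
          rw [d2, if_pos (Nat.lt_succ_self _)]
        · rw [d4 _ (by omega) fun c' p' h => hρi (entry_inj h).1]
          refine (i3 ρ hρ c p).trans ?_
          have : ρ < i ↔ ρ < i + 1 := by omega
          simp only [this])
  obtain ⟨c1, c3, c4⟩ := c1
  refine ⟨c1, ?_, σ₁.mem, fun x hx => ?_, fun l e p => ?_, ⟨?_, ?_, ?_, fun x hx => ?_,
    fun ρ hρ c p => ?_⟩⟩
  · have e1 := h₁ σ
    have : (Prog.seq (assign A₁ e₁) (.seq c₂ (.loop 4 (.add (.reg 2) (.lit 4))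
        (rowProg cs A (41 + m))))).steps σ = (assign A₁ e₁).steps σ + (c₂.steps σ₁ +
        (Prog.loop 4 (.add (.reg 2) (.lit 4)) (rowProg cs A (41 + m))).steps σ₂) := rfl
    rw [this]
    have e2 : (IExp.add (.reg 2) (.lit 4)).size = 3 := rfl
    rw [e2] at c2
    nlinarith
  · rw [← b3 x (by omega), hoff x (Or.inl hx), hZ.header x hx]
  · refine (a2 (l, e, p)).trans ?_
    exact (congrArg σ.mem (hent (l, e, p) σ rfl)).trans
      (hZ.entry _ (by have := e.2; omega) _ _)
  · exact (c1 1 (by decide)).trans hZ.out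
  · exact (c1 2 (by decide)).trans hZ.cols
  · exact (c1 3 (by decide)).trans hZ.base
  · exact (c3 x (by omega)).trans ((hoff x (Or.inl hx)).trans (hZ.header x hx))
  · refine (c4 ρ hρ c p).trans ?_
    rw [if_pos hρ]

end RealRAM

/-! Unitary column operations that compress a family of Kraus operators to four operators. -/

/-- A unitary matrix that annihilates the second entry of the row `(x, y)`. -/
noncomputable def givens (x y : ℂ) : Matrix (Fin 2) (Fin 2) ℂ :=
  if √(Complex.normSq x + Complex.normSq y) = 0 then 1 else
    ((1 / √(Complex.normSq x + Complex.normSq y) : ℝ) : ℂ) • !![star x, -y; star y, x]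

theorem givens_annihilates (x y : ℂ) : x * givens x y 0 1 + y * givens x y 1 1 = 0 := by
  unfold givens
  split_ifs with h
  · have h0 := (Real.sqrt_eq_zero (add_nonneg (Complex.normSq_nonneg x)
      (Complex.normSq_nonneg y))).1 h
    have hy : y = 0 := Complex.normSq_eq_zero.1
      (by linarith [Complex.normSq_nonneg x, Complex.normSq_nonneg y])
    simp [hy]
  · simp
    ring

theorem givens_mul_conjTranspose (x y : ℂ) : givens x y * (givens x y).conjTranspose = 1 := by
  unfold givens
  split_ifs with h
  · simp
  · have hs : (√(Complex.normSq x + Complex.normSq y) : ℂ) ^ 2 = x * star x + y * star y := by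
      rw [← Complex.ofReal_pow, Real.sq_sqrt (add_nonneg (Complex.normSq_nonneg x)
        (Complex.normSq_nonneg y))]
      push_cast
      rw [Complex.normSq_eq_conj_mul_self, Complex.normSq_eq_conj_mul_self]
      simp only [Complex.star_def]
      ring
    have hne : (√(Complex.normSq x + Complex.normSq y) : ℂ) ≠ 0 := Complex.ofReal_ne_zero.2 h
    have hm : !![star x, -y; star y, x] * (!![star x, -y; star y, x]).conjTranspose =
        (x * star x + y * star y) • (1 : Matrix (Fin 2) (Fin 2) ℂ) := by
      ext i j
      fin_cases i <;> fin_cases j <;>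
        simp [Matrix.mul_apply, Fin.sum_univ_two, Matrix.conjTranspose_apply] <;> ring
    rw [Matrix.conjTranspose_smul, Matrix.smul_mul, Matrix.mul_smul, hm, smul_smul, smul_smul, ← hs]
    have : (starRingEnd ℂ) (√(Complex.normSq x + Complex.normSq y) : ℂ) =
        √(Complex.normSq x + Complex.normSq y) := Complex.conj_ofReal _
    simp only [one_div, Complex.ofReal_inv, Complex.star_def, map_inv₀, this]
    rw [show (√(Complex.normSq x + Complex.normSq y) : ℂ)⁻¹ *
      (√(Complex.normSq x + Complex.normSq y) : ℂ)⁻¹ *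
        (√(Complex.normSq x + Complex.normSq y) : ℂ) ^ 2 = 1 by field_simp, one_smul]

theorem Comp.givens {D : ℕ} {x y : (ℕ → ℝ) → ℂ} (hx : Comp D x) (hy : Comp D y) :
    Comp D fun ω => givens (x ω) (y ω) := by
  have hn : CompReal D fun ω => √(Complex.normSq (x ω) + Complex.normSq (y ω)) :=
    (hx.normSq.add hy.normSq).sqrt
  have h : Comp D fun ω => if √(Complex.normSq (x ω) + Complex.normSq (y ω)) = 0 then 1 else
      ((1 / √(Complex.normSq (x ω) + Complex.normSq (y ω)) : ℝ) : ℂ) •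
        !![star (x ω), -(y ω); star (y ω), x ω] := by
    refine Comp.cond (CompPred.eq hn CompReal.zero) Comp.mone fun i j => ?_
    have hs : Comp D fun ω => ((1 / √(Complex.normSq (x ω) + Complex.normSq (y ω)) : ℝ) : ℂ) :=
      Comp.ofReal (CompReal.one.div hn)
    fin_cases i <;> fin_cases j
    exacts [hs.cmul hx.cstar, hs.cmul hy.cneg, hs.cmul hy.cstar, hs.cmul hx]
  unfold _root_.givens
  convert h

/-- Below the first four rows `Z` is a unitary matrix, and the first four rows of `Z` are the
products of the rows of `N` with this matrix. -/
structure IsMixing {R : ℕ} (N : Fin 4 → Fin R → ℂ) (Z : ℕ → Fin R → ℂ) : Prop where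
  unitary : (Matrix.of fun (i c : Fin R) => Z (4 + i.1) c) ∈ Matrix.unitaryGroup (Fin R) ℂ
  top : ∀ (e : Fin 4) (c : Fin R), Z e.1 c = ∑ i : Fin R, N e i * Z (4 + i.1) c

/-- A column operation multiplies the top rows and the unitary block from the right by the same
unitary, so their relation persists. -/
theorem IsMixing.rowOp {k R : ℕ} {N : Fin 4 → Fin R → ℂ} {Z : ℕ → Fin R → ℂ} (h : IsMixing N Z)
    {cs : Fin k → Fin R} (hcs : Function.Injective cs) {V : Matrix (Fin k) (Fin k) ℂ}
    (hV : V * V.conjTranspose = 1) : IsMixing N fun ρ => rowOp cs V (Z ρ) where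
  unitary := by
    have h1 := Matrix.mem_unitaryGroup_iff.1 h.unitary
    refine Matrix.mem_unitaryGroup_iff.2 (Eq.trans ?_ h1)
    ext i j
    exact rowOp_inner hcs hV (Z (4 + i.1)) (Z (4 + j.1))
  top e c := by
    rw [← rowOp_sum]
    exact congrArg (fun a => _root_.rowOp cs V a c) (funext fun c => h.top e c)

namespace RealRAM

/-- The complex number with index `e` in the block `l` of eight cells after the first nine. -/
noncomputable def readEntry (ω : ℕ → ℝ) (l e : ℕ) : ℂ :=
  ⟨ω (9 + 8 * l + 2 * e), ω (9 + 8 * l + 2 * e + 1)⟩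

theorem comp_readEntry {l e : ℕ} (hl : l < 4) (he : e < 4) : Comp 41 fun ω => readEntry ω l e :=
  Comp.mk (CompReal.cell _ (by omega)) (CompReal.cell _ (by omega))

theorem complex_eq_of_part {x y : ℝ} {z : ℂ} (h0 : x = part z 0) (h1 : y = part z 1) :
    (⟨x, y⟩ : ℂ) = z := by
  rw [h0, h1]
  rfl

/-- Elimination of the entries of the row `e` to the right of the diagonal. -/
theorem exists_eliminate_row {e : ℕ} (he : e < 4) :
    ∃ (A : Prog) (B T : ℕ), ∀ (R b : ℕ) (hdr : ℕ → ℝ) (N : Fin 4 → Fin R → ℂ)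
      (Z : ℕ → Fin R → ℂ) (σ : State), B ≤ b → 4 ≤ R → Holds R b hdr Z σ → IsMixing N Z →
      (∀ e' < e, ∀ c : Fin R, e' < c.1 → Z e' c = 0) →
      A.steps σ ≤ T * (R + 5) ^ 2 ∧ ∃ Z', Holds R b hdr Z' (A.run σ) ∧ IsMixing N Z' ∧
        ∀ e' < e + 1, ∀ c : Fin R, e' < c.1 → Z' e' c = 0 := by
  -- The pivot is column `e`; register 5 runs over the columns to its right, each annihilated in row
  -- `e` by one rotation.
  obtain ⟨c, B, T, h⟩ := exists_colProg (k := 2) (by norm_num)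
    (Comp.givens (comp_readEntry (l := 0) (by norm_num) he) (comp_readEntry (l := 1) (by norm_num) he))
    ![.lit e, .add (.reg 5) (.lit (e + 1))]
  refine ⟨.loop 5 (.sub (.reg 2) (.lit (e + 1))) c, B, T + 5, ?_⟩
  intro R b hdr N Z σ hb hR hZ hM h0
  obtain ⟨⟨Z', a1, a2, a3, a4⟩, hsteps⟩ := loop_spec (x := 5) (b := .sub (.reg 2) (.lit (e + 1)))
    (c := c) (n := R - (e + 1)) (σ := σ) (T := T * (R + 5))
    (I := fun i τ => ∃ Z', Holds R b hdr Z' τ ∧ IsMixing N Z' ∧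
      (∀ e' < e, ∀ c : Fin R, e' < c.1 → Z' e' c = 0) ∧
      ∀ c : Fin R, e < c.1 → c.1 < e + 1 + i → Z' e c = 0)
    (by simp only [IExp.eval, hZ.cols])
    ⟨Z, hZ, hM, h0, fun c h1 h2 => by omega⟩
    (fun i hi τ hτ => by
      obtain ⟨Z', a1, a2, a3, a4⟩ := hτ
      have heR : e < R := by omega
      have hiR : i + (e + 1) < R := by omega
      have hne : (⟨e, heR⟩ : Fin R) ≠ ⟨i + (e + 1), hiR⟩ := by
        simp only [ne_eq, Fin.mk.injEq]
        omega
      have hinj : Function.Injective ![(⟨e, heR⟩ : Fin R), ⟨i + (e + 1), hiR⟩] := by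
        intro x y
        fin_cases x <;> fin_cases y <;> simp [hne, hne.symm]
      obtain ⟨b1, b2, ω, b3, b4, b5⟩ := h R b hdr Z' (τ.setIdx 5 i) _ hb
        (a1.congr_idx (fun x hx => setIdx_of_ne _ _ (by omega)) rfl) hinj (by
          intro j τ' hτ'
          fin_cases j
          · rfl
          · have := hτ' 5 (by decide)
            rw [setIdx_self] at this
            simp [IExp.eval, this])
      have hx : readEntry ω 0 e = Z' e ⟨e, heR⟩ :=
        complex_eq_of_part (b4 0 ⟨e, he⟩ 0) (b4 0 ⟨e, he⟩ 1)
      have hy : readEntry ω 1 e = Z' e ⟨i + (e + 1), hiR⟩ :=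
        complex_eq_of_part (b4 1 ⟨e, he⟩ 0) (b4 1 ⟨e, he⟩ 1)
      refine ⟨⟨_, b5, a2.rowOp hinj (givens_mul_conjTranspose _ _), fun e' he' c' hc' => ?_,
        fun c' h1 h2 => ?_⟩, b2⟩
      -- Both rotated columns are already zero in the earlier rows, so the rotation creates no new
      -- entries there.
      · by_cases hc : ∃ j, ![(⟨e, heR⟩ : Fin R), ⟨i + (e + 1), hiR⟩] j = c'
        · obtain ⟨j, rfl⟩ := hc
          rw [rowOp_apply hinj]
          refine Finset.sum_eq_zero fun l _ => ?_
          rw [a3 e' he', zero_mul]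
          fin_cases l
          · exact he'
          · change e' < i + (e + 1)
            omega
        · push Not at hc
          rw [rowOp_of_ne _ hc, a3 e' he' c' hc']
      · by_cases hc : c' = ⟨i + (e + 1), hiR⟩
        · have := rowOp_apply hinj (V := givens (readEntry ω 0 e) (readEntry ω 1 e)) (Z' e) 1
          rw [Fin.sum_univ_two] at this
          rw [hc]
          refine this.trans ?_
          rw [hx, hy]
          exact givens_annihilates _ _
        · have hc1 : c'.1 ≠ i + (e + 1) := fun h => hc (Fin.ext h)
          rw [rowOp_of_ne, a4 c' h1 (by omega)]
          intro j
          fin_cases j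
          · exact fun h => by
              have := congrArg Fin.val h
              simp at this
              omega
          · exact fun h => hc h.symm)
  refine ⟨?_, Z', a1, a2, fun e' he' c' hc' => ?_⟩
  · have e2 : (IExp.sub (.reg 2) (.lit (e + 1))).size = 3 := rfl
    rw [e2] at hsteps
    have : (R - (e + 1)) * (T * (R + 5) + 1) ≤ R * (T * (R + 5) + 1) :=
      Nat.mul_le_mul_right _ (Nat.sub_le _ _)
    nlinarith
  · rcases Nat.lt_succ_iff_lt_or_eq.1 he' with h | rfl
    · exact a3 e' h c' hc'
    · exact a4 c' hc' (by have := c'.2; omega)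

/-- Elimination of the entries of the first four rows to the right of the diagonal. -/
theorem exists_eliminate {E : ℕ} (hE : E ≤ 4) :
    ∃ (A : Prog) (B T : ℕ), ∀ (R b : ℕ) (hdr : ℕ → ℝ) (N : Fin 4 → Fin R → ℂ)
      (Z : ℕ → Fin R → ℂ) (σ : State), B ≤ b → 4 ≤ R → Holds R b hdr Z σ → IsMixing N Z →
      A.steps σ ≤ T * (R + 5) ^ 2 ∧ ∃ Z', Holds R b hdr Z' (A.run σ) ∧ IsMixing N Z' ∧
        ∀ e' < E, ∀ c : Fin R, e' < c.1 → Z' e' c = 0 := by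
  induction E with
  | zero =>
    refine ⟨.skip, 0, 1, fun R b hdr N Z σ _ _ hZ hM => ⟨?_, Z, hZ, hM, by simp⟩⟩
    rw [one_mul]
    exact Nat.one_le_pow _ _ (by omega)
  | succ E ih =>
    obtain ⟨A₁, B₁, T₁, h₁⟩ := ih (by omega)
    obtain ⟨A₂, B₂, T₂, h₂⟩ := exists_eliminate_row (e := E) (by omega)
    refine ⟨.seq A₁ A₂, B₁ + B₂, T₁ + T₂, fun R b hdr N Z σ hb hR hZ hM => ?_⟩
    obtain ⟨s₁, Z₁, a1, a2, a3⟩ := h₁ R b hdr N Z σ (by omega) hR hZ hM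
    obtain ⟨s₂, Z₂, b1, b2, b3⟩ := h₂ R b hdr N Z₁ _ (by omega) hR a1 a2 a3
    refine ⟨?_, Z₂, b1, b2, b3⟩
    rw [add_mul]
    exact Nat.add_le_add s₁ s₂

/-! ### The optimal mixing as a function of 41 memory cells. -/

/-- The operators in the cells `9, …, 40`. -/
noncomputable def readOps (ω : ℕ → ℝ) (l : Fin 4) : Matrix (Fin 2) (Fin 2) ℂ :=
  Matrix.of fun a b => readEntry ω l.1 (2 * a.1 + b.1)

/-- The vectors in the cells `1, …, 8`. -/
noncomputable def readVecs (ω : ℕ → ℝ) (k : Fin 2) : EuclideanSpace ℂ (Fin 2) :=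
  WithLp.toLp 2 fun a => ⟨ω (1 + 4 * k.1 + 2 * a.1), ω (1 + 4 * k.1 + 2 * a.1 + 1)⟩

theorem comp_readOps_mul : Comp 41 fun ω (l : Fin 4) =>
    readOps ω l * schmidtMat (ω 0) (readVecs ω) := by
  intro l
  refine Comp.mmul (fun a b => comp_readEntry l.2 (by omega)) fun a k => ?_
  have hu : Comp 41 fun ω => readVecs ω k a :=
    Comp.mk (CompReal.cell _ (by omega)) (CompReal.cell _ (by omega))
  have hs : CompReal 41 fun ω => ω 0 := CompReal.cell 0 (by norm_num)
  unfold schmidtMat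
  fin_cases k
  · exact (Comp.ofReal hs).cmul hu
  · exact (Comp.ofReal (CompReal.one.sub (hs.pow 2)).sqrt).cmul hu

/-- After compression all data are `s`, the vectors `u` and four operators, so the analytic part of
the algorithm has constant cost. -/
theorem exists_comp_optimalMixing : ∃ V : (ℕ → ℝ) → Matrix (Fin 4) (Fin 4) ℂ, Comp 41 V ∧
    ∀ ω, IsOptimalMixing (tangleMat (ω 0) (readVecs ω) (readOps ω))
      (gramMat (ω 0) (readVecs ω) (readOps ω)) (V ω) := by
  have h := comp_readOps_mul
  have hτ : Comp 41 fun ω => tangleMat (ω 0) (readVecs ω) (readOps ω) := fun i j =>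
    ((((h i 0 0).cmul (h j 1 1)).cadd ((h i 1 1).cmul (h j 0 0))).csub
      ((h i 0 1).cmul (h j 1 0))).csub ((h i 1 0).cmul (h j 0 1))
  have hG : Comp 41 fun ω => gramMat (ω 0) (readVecs ω) (readOps ω) := fun i j =>
    Comp.trace (Comp.mmul (Comp.conjTranspose (h i)) (h j))
  obtain ⟨V, hV, hopt⟩ := Comp.exists_isOptimalMixing hτ hG
  exact ⟨V, hV, fun ω => hopt ω (tangleMat_transpose _ _ _) (gramMat_isHermitian _ _ _)⟩

end RealRAM

/-! ### Memory layout and the complete program. -/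

namespace RealRAM

/-- The entries of the Kraus operators, row by row. -/
noncomputable def krausEntries {r : ℕ} (R : ℕ) (K : Fin r → Matrix (Fin 2) (Fin 2) ℂ) (e : ℕ)
    (i : Fin R) : ℂ :=
  padKraus R K i (Fin.ofNat 2 (e / 2)) (Fin.ofNat 2 e)

theorem krausEntries_apply {r R : ℕ} (K : Fin r → Matrix (Fin 2) (Fin 2) ℂ) (i : Fin R)
    (a b : Fin 2) : krausEntries R K (2 * a.1 + b.1) i = padKraus R K i a b := by
  unfold krausEntries
  congr 1
  · exact Fin.ext (by simp only [Fin.ofNat]; omega)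
  · exact Fin.ext (by simp only [Fin.ofNat]; omega)

section Input

variable {r : ℕ} (K : Fin r → Matrix (Fin 2) (Fin 2) ℂ) (s : ℝ)
  (u : Fin 2 → EuclideanSpace ℂ (Fin 2))

theorem input_mem_vec (k a p : Fin 2) :
    (input K s u).mem (1 + 4 * k.1 + 2 * a.1 + p.1) = part (u k a) p := by
  simp only [input]
  rw [if_neg (by omega), if_pos (by omega)]
  have hk : Fin.ofNat 2 ((1 + 4 * k.1 + 2 * a.1 + p.1 - 1) / 4) = k :=
    Fin.ext (by simp only [Fin.ofNat]; omega)
  have ha : Fin.ofNat 2 ((1 + 4 * k.1 + 2 * a.1 + p.1 - 1) / 2) = a :=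
    Fin.ext (by simp only [Fin.ofNat]; omega)
  have hp : Fin.ofNat 2 (1 + 4 * k.1 + 2 * a.1 + p.1 - 1) = p :=
    Fin.ext (by simp only [Fin.ofNat]; omega)
  rw [hk, ha, hp]

theorem input_mem_kraus {R i : ℕ} (hi : i < r) (hR : i < R) (e : Fin 4) (p : Fin 2) :
    (input K s u).mem (9 + 2 * e.1 + p.1 + 8 * i) = part (krausEntries R K e ⟨i, hR⟩) p := by
  simp only [input]
  have h : (9 + 2 * e.1 + p.1 + 8 * i - 9) / 8 = i := by omega
  rw [if_neg (by omega), if_neg (by omega), dif_pos (by omega)]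
  simp only [krausEntries, padKraus, hi, dif_pos, h]
  congr 1
  · congr 1
    · exact Fin.ext (by simp only [Fin.ofNat]; omega)
    · exact Fin.ext (by simp only [Fin.ofNat]; omega)
  · exact Fin.ext (by simp only [Fin.ofNat]; omega)

theorem input_mem_of_le {k : ℕ} (hk : 9 + 8 * r ≤ k) : (input K s u).mem k = 0 := by
  simp only [input]
  rw [if_neg (by omega), if_neg (by omega), dif_neg (by omega)]

end Input

/-- The program that fixes the number of columns and the addresses of the matrices. -/
def layoutProg (B : ℕ) : Prog :=
  .seq (.ifIdx (.reg 0) (.lit 4) (.setIdx 2 (.lit 4)) (.setIdx 2 (.reg 0)))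
    (.seq (.setIdx 3 (.add (.lit B) (.mul (.lit 8) (.reg 0))))
      (.setIdx 1 (.add (.reg 3) (.mul (.lit 8) (.reg 2)))))

theorem layoutProg_steps (B : ℕ) (σ : State) : (layoutProg B).steps σ ≤ 17 := by
  simp only [layoutProg, Prog.steps, IExp.size]
  split_ifs <;> omega

/-- The matrix is placed beyond the input, where the memory is zero, so the zero matrix is already
stored there. -/
theorem layoutProg_run (B : ℕ) {r : ℕ} (K : Fin r → Matrix (Fin 2) (Fin 2) ℂ) (s : ℝ)
    (u : Fin 2 → EuclideanSpace ℂ (Fin 2)) (hB : 9 ≤ B) :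
    ((layoutProg B).run (input K s u)).idx 0 = r ∧
      ((layoutProg B).run (input K s u)).mem = (input K s u).mem ∧
      Holds (max r 4) (B + 8 * r) (input K s u).mem (fun _ _ => 0)
        ((layoutProg B).run (input K s u)) := by
  have hidx : (input K s u).idx 0 = r := rfl
  have hrun : (layoutProg B).run (input K s u) =
      (((input K s u).setIdx 2 (max r 4)).setIdx 3 (B + 8 * r)).setIdx 1
        (B + 8 * r + 8 * max r 4) := by
    simp only [layoutProg, Prog.run, IExp.eval, hidx]
    have h2 : (if r ≤ 4 then (input K s u).setIdx 2 4 else (input K s u).setIdx 2 r) =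
        (input K s u).setIdx 2 (max r 4) := by
      split_ifs with h
      · rw [max_eq_right h]
      · rw [max_eq_left (by omega)]
    rw [h2]
    simp [State.setIdx, hidx]
  rw [hrun]
  refine ⟨rfl, rfl, rfl, rfl, rfl, fun x _ => rfl, fun ρ _ c p => ?_⟩
  refine (input_mem_of_le K s u (by omega)).trans ?_
  simp [part]

/-- The program that copies the Kraus operators. -/
noncomputable def copyProg : Prog :=
  assign (fun x : Fin 4 × Fin 2 => entryAddr (.lit x.1.1) (.reg 4) x.2)
    fun x => .cell (.add (.lit (9 + 2 * x.1.1 + x.2.1)) (.mul (.lit 8) (.reg 4)))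

/-- The operator `i` becomes column `i` of the first four rows; the columns from `r` on stay zero,
which is the padding. -/
theorem exists_copy_loop : ∃ T, ∀ (r R b : ℕ) (hdr : ℕ → ℝ)
    (K : Fin r → Matrix (Fin 2) (Fin 2) ℂ) (s : ℝ) (u : Fin 2 → EuclideanSpace ℂ (Fin 2))
    (σ : State), r ≤ R → 9 + 8 * r ≤ b → σ.idx 0 = r → σ.mem = (input K s u).mem →
    Holds R b hdr (fun _ _ => 0) σ →
    (Prog.loop 4 (.reg 0) copyProg).steps σ ≤ T * (R + 5) ∧
    Holds R b hdr (fun ρ c => if ρ < 4 then krausEntries R K ρ c else 0)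
      ((Prog.loop 4 (.reg 0) copyProg).run σ) := by
  obtain ⟨T, hT⟩ := exists_assign_steps
    (fun x : Fin 4 × Fin 2 => entryAddr (.lit x.1.1) (.reg 4) x.2)
    fun x => .cell (.add (.lit (9 + 2 * x.1.1 + x.2.1)) (.mul (.lit 8) (.reg 4)))
  refine ⟨T + 1, fun r R b hdr K s u σ hrR hb h0 hmem hZ => ?_⟩
  obtain ⟨⟨a1, -⟩, a2⟩ := loop_spec (x := 4) (b := .reg 0) (c := copyProg) (n := r) (T := T)
    (σ := σ) (I := fun i τ => Holds R b hdr
      (fun ρ c => if ρ < 4 ∧ c.1 < i then krausEntries R K ρ c else 0) τ ∧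
      ∀ x < b, τ.mem x = σ.mem x) h0 (by simpa using hZ)
    (fun i hi τ hτ => by
      obtain ⟨t1, t2⟩ := hτ
      have hA : ∀ x : Fin 4 × Fin 2, (entryAddr (.lit x.1.1) (.reg 4) x.2).eval (τ.setIdx 4 i) =
          b + 2 * (R * x.1.1 + i) + x.2.1 := by
        intro x
        rw [entryAddr_eval, setIdx_of_ne _ _ (by decide), setIdx_of_ne _ _ (by decide), t1.cols,
          t1.base]
        simp only [IExp.eval, setIdx_self]
      have hiR : i < R := by omega
      obtain ⟨c1, c2, c3⟩ := assign_run (σ := τ.setIdx 4 i)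
        (A := fun x : Fin 4 × Fin 2 => entryAddr (.lit x.1.1) (.reg 4) x.2)
        (e := fun x => .cell (.add (.lit (9 + 2 * x.1.1 + x.2.1)) (.mul (.lit 8) (.reg 4))))
        (fun x y hxy => by
          simp only [hA] at hxy
          obtain ⟨e1, -, e2⟩ := entry_inj (c := ⟨i, hiR⟩) (c' := ⟨i, hiR⟩) hxy
          exact Prod.ext (Fin.ext e1) e2)
        (fun x τ' hidx hm => by
          simp only [RExp.eval, IExp.eval, hidx, setIdx_self]
          refine hm _ fun y => ?_
          rw [hA]
          have := x.1.2
          have := x.2.2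
          omega)
      refine ⟨⟨⟨?_, ?_, ?_, fun x hx => ?_, fun ρ hρ c p => ?_⟩, fun x hx => ?_⟩, hT _⟩
      · rw [copyProg, c1, setIdx_of_ne _ _ (by decide), t1.out]
      · rw [copyProg, c1, setIdx_of_ne _ _ (by decide), t1.cols]
      · rw [copyProg, c1, setIdx_of_ne _ _ (by decide), t1.base]
      · refine (c3 x fun y => ?_).trans (t1.header x hx)
        rw [hA]
        omega
      · by_cases hc : ρ < 4 ∧ c.1 = i
        · obtain ⟨hρ4, rfl⟩ := hc
          refine (congrArg _ (hA (⟨ρ, hρ4⟩, p))).symm.trans ((c2 (⟨ρ, hρ4⟩, p)).trans ?_)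
          simp only [RExp.eval, IExp.eval, setIdx_self]
          rw [if_pos ⟨hρ4, Nat.lt_succ_self _⟩]
          refine (t2 _ (by have := p.2; omega)).trans ?_
          rw [hmem]
          exact input_mem_kraus K s u hi c.2 ⟨ρ, hρ4⟩ p
        · refine (c3 _ fun y => ?_).trans ((t1.entry ρ hρ c p).trans ?_)
          · rw [hA]
            intro h
            obtain ⟨e1, e2, -⟩ := entry_inj (c := ⟨i, hiR⟩) h
            refine hc ⟨by have := y.1.2; omega, ?_⟩
            rw [← e2]
          · have : (ρ < 4 ∧ c.1 < i) ↔ (ρ < 4 ∧ c.1 < i + 1) := by omega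
            simp only [this]
      · refine (c3 x fun y => ?_).trans (t2 x hx)
        rw [hA]
        omega)
  refine ⟨?_, ⟨a1.out, a1.cols, a1.base, a1.header, fun ρ hρ c p => (a1.entry ρ hρ c p).trans ?_⟩⟩
  · have : (IExp.reg 0).size = 1 := rfl
    rw [this] at a2
    nlinarith
  · by_cases hρ4 : ρ < 4
    · by_cases hc : c.1 < r
      · rw [if_pos ⟨hρ4, hc⟩, if_pos hρ4]
      · rw [if_neg (fun h => hc h.2), if_pos hρ4, krausEntries, padKraus_of_le K (not_lt.1 hc)]
        rfl
    · rw [if_neg (fun h => hρ4 h.1), if_neg hρ4]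

theorem identity_loop {R b : ℕ} {hdr : ℕ → ℝ} {Z : ℕ → Fin R → ℂ} {σ : State} (hb : 9 ≤ b)
    (hZ : Holds R b hdr (fun ρ c => if ρ < 4 then Z ρ c else 0) σ) :
    (Prog.loop 4 (.reg 2)
      (.setMem (entryAddr (.add (.lit 4) (.reg 4)) (.reg 4) 0) (.lit 1))).steps σ ≤
        20 * (R + 5) ∧
    Holds R b hdr (fun ρ c => if ρ < 4 then Z ρ c else if ρ = 4 + c.1 then 1 else 0)
      ((Prog.loop 4 (.reg 2)
        (.setMem (entryAddr (.add (.lit 4) (.reg 4)) (.reg 4) 0) (.lit 1))).run σ) := by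
  obtain ⟨a1, a2⟩ := loop_spec (x := 4) (b := .reg 2)
    (c := .setMem (entryAddr (.add (.lit 4) (.reg 4)) (.reg 4) 0) (.lit 1)) (n := R) (T := 15)
    (σ := σ) (I := fun i τ => Holds R b hdr
      (fun ρ c => if ρ < 4 then Z ρ c else if ρ = 4 + c.1 ∧ c.1 < i then 1 else 0) τ) hZ.cols
    (by simpa using hZ)
    (fun i hi τ t1 => by
      have hA : (entryAddr (.add (.lit 4) (.reg 4)) (.reg 4) 0).eval (τ.setIdx 4 i) =
          b + 2 * (R * (4 + i) + i) + 0 := by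
        rw [entryAddr_eval, setIdx_of_ne _ _ (by decide), setIdx_of_ne _ _ (by decide), t1.cols,
          t1.base]
        simp [IExp.eval, setIdx_self]
      refine ⟨⟨t1.out, t1.cols, t1.base, fun x hx => ?_, fun ρ hρ c p => ?_⟩, le_of_eq rfl⟩
      · simp only [Prog.run, hA]
        rw [State.setMem_of_ne _ _ (by omega)]
        exact t1.header x hx
      · simp only [Prog.run, hA]
        by_cases h : b + 2 * (R * ρ + c.1) + p.1 = b + 2 * (R * (4 + i) + i) + 0
        · obtain ⟨e1, e2, e3⟩ := entry_inj (c' := ⟨i, hi⟩) (p' := 0) h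
          rw [h, State.setMem_self, if_neg (by omega), if_pos (by rw [e1, e2]; simp), e3]
          simp [RExp.eval, part]
        · rw [State.setMem_of_ne _ _ h]
          refine (t1.entry ρ hρ c p).trans ?_
          by_cases hρ4 : ρ < 4
          · rw [if_pos hρ4, if_pos hρ4]
          · rw [if_neg hρ4, if_neg hρ4]
            by_cases hc : ρ = 4 + c.1 ∧ c.1 = i
            -- This is the cell beside the one just written, an imaginary part; it is zero for both
            -- 0 and 1.
            · have hp : p = 1 := by
                obtain ⟨e1, e2⟩ := hc
                rw [e1, e2] at h
                have : p.1 ≠ 0 := by omega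
                omega
              subst hp
              split_ifs <;> simp [part]
            · have : (ρ = 4 + c.1 ∧ c.1 < i) ↔ (ρ = 4 + c.1 ∧ c.1 < i + 1) := by omega
              simp only [this])
  refine ⟨?_, ⟨a1.out, a1.cols, a1.base, a1.header, fun ρ hρ c p => (a1.entry ρ hρ c p).trans ?_⟩⟩
  · have : (IExp.reg 2).size = 1 := rfl
    rw [this] at a2
    omega
  · simp only [c.2, and_true]

theorem isMixing_identity {R : ℕ} (Z : ℕ → Fin R → ℂ) :
    IsMixing (fun e => Z e.1)
      (fun ρ c => if ρ < 4 then Z ρ c else if ρ = 4 + c.1 then 1 else 0) where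
  unitary := by
    convert one_mem (Matrix.unitaryGroup (Fin R) ℂ)
    ext i c
    simp [Matrix.one_apply, Fin.ext_iff]
  top e c := by
    simp [Fin.val_inj]

/-- The top rows display the operators mixed by the block below: row `2a + b` holds their entries
`(a, b)`. The program thus works on the mixed operators without recomputing them. -/
theorem _root_.IsMixing.mixKraus_apply {r R : ℕ} (h : r ≤ R) {K : Fin r → Matrix (Fin 2) (Fin 2) ℂ}
    {Z : ℕ → Fin R → ℂ} (hZ : IsMixing (fun e => krausEntries R K e.1) Z) (c : Fin R)
    (a b : Fin 2) : mixKraus h K (Matrix.of fun i c => Z (4 + i.1) c) c a b =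
      Z (2 * a.1 + b.1) c := by
  refine Eq.trans ?_ (hZ.top ⟨2 * a.1 + b.1, by omega⟩ c).symm
  rw [mixKraus_eq_sum_padKraus, Matrix.sum_apply]
  refine Finset.sum_congr rfl fun i _ => ?_
  rw [krausEntries_apply, Matrix.smul_apply, smul_eq_mul, mul_comm]
  rfl

/-- A program that compresses the Kraus operators to four operators and mixes these optimally. -/
theorem exists_optimal_program : ∃ (A : Prog) (T : ℕ), ∀ (r : ℕ)
    (K : Fin r → Matrix (Fin 2) (Fin 2) ℂ) (s : ℝ) (u : Fin 2 → EuclideanSpace ℂ (Fin 2)),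
    A.steps (input K s u) ≤ T * (max r 4 + 5) ^ 2 ∧
    ∃ (Z : ℕ → Fin (max r 4) → ℂ) (V : Matrix (Fin 4) (Fin 4) ℂ),
      IsMixing (fun e => krausEntries (max r 4) K e.1) Z ∧
      (∀ e < 4, ∀ c, e < c.1 → Z e c = 0) ∧
      IsOptimalMixing
        (tangleMat s u fun l => Matrix.of fun a b =>
          Z (2 * a.1 + b.1) (Fin.castLE (le_max_right r 4) l))
        (gramMat s u fun l => Matrix.of fun a b =>
          Z (2 * a.1 + b.1) (Fin.castLE (le_max_right r 4) l)) V ∧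
      output (max r 4) (A.run (input K s u)) =
        Matrix.of fun i c => rowOp (Fin.castLE (le_max_right r 4)) V (Z (4 + i.1)) c := by
  obtain ⟨V, hV, hopt⟩ := exists_comp_optimalMixing
  obtain ⟨A₁, B₁, T₁, h₁⟩ := exists_eliminate le_rfl
  obtain ⟨A₂, B₂, T₂, h₂⟩ := exists_colProg le_rfl hV fun l => .lit l.1
  obtain ⟨T₀, h₀⟩ := exists_copy_loop
  refine ⟨.seq (layoutProg (B₁ + B₂ + 9)) (.seq (.loop 4 (.reg 0) copyProg) (.seq (.loop 4 (.reg 2)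
    (.setMem (entryAddr (.add (.lit 4) (.reg 4)) (.reg 4) 0) (.lit 1))) (.seq A₁ A₂))),
    17 + T₀ + 20 + T₁ + T₂, fun r K s u => ?_⟩
  set R := max r 4 with hR
  have hrR : r ≤ R := le_max_left r 4
  have h4R : 4 ≤ R := le_max_right r 4
  obtain ⟨a1, a2, a3⟩ := layoutProg_run (B₁ + B₂ + 9) K s u (by omega)
  have s₁ := layoutProg_steps (B₁ + B₂ + 9) (input K s u)
  obtain ⟨s₂, b1⟩ := h₀ r R _ _ K s u _ hrR (by omega) a1 a2 a3
  obtain ⟨s₃, c1⟩ := identity_loop (by omega) b1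
  obtain ⟨s₄, Z, d1, d2, d3⟩ := h₁ R _ _ _ _ _ (by omega) h4R c1 (isMixing_identity _)
  obtain ⟨-, s₅, ω, e1, e2, e3⟩ := h₂ R _ _ _ _ (Fin.castLE h4R) (by omega) d1
    (Fin.castLE_injective h4R) fun j τ _ => rfl
  have hs : ω 0 = s := e1 0 (by norm_num)
  have hu : readVecs ω = u := by
    funext k
    ext a
    have h : ∀ p : Fin 2, ω (1 + 4 * k.1 + 2 * a.1 + p.1) = part (u k a) p := fun p =>
      (e1 _ (by omega)).trans (input_mem_vec K s u k a p)
    exact complex_eq_of_part (h 0) (h 1)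
  have hN : readOps ω = fun l => Matrix.of fun a b => Z (2 * a.1 + b.1) (Fin.castLE h4R l) := by
    funext l
    ext a b
    have h := e2 l ⟨2 * a.1 + b.1, by omega⟩
    exact complex_eq_of_part (h 0) (h 1)
  have hω := hopt ω
  rw [hs, hu, hN] at hω
  refine ⟨?_, Z, V ω, d2, d3, hω, ?_⟩
  · change _ ≤ (17 + T₀ + 20 + T₁ + T₂) * (R + 5) ^ 2
    -- Only elimination is quadratic; the linear and constant costs are absorbed into the same
    -- square.
    have : R + 5 ≤ (R + 5) ^ 2 := Nat.le_self_pow (by norm_num) _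
    have h17 : 17 ≤ 17 * (R + 5) ^ 2 := by nlinarith
    have m1 : T₀ * (R + 5) ≤ T₀ * (R + 5) ^ 2 := Nat.mul_le_mul_left _ this
    have m2 : T₂ * (R + 5) ≤ T₂ * (R + 5) ^ 2 := Nat.mul_le_mul_left _ this
    have m3 : 20 * (R + 5) ≤ 20 * (R + 5) ^ 2 := Nat.mul_le_mul_left _ this
    simp only [add_mul]
    refine le_trans (Nat.add_le_add s₁ (Nat.add_le_add s₂ (Nat.add_le_add s₃
      (Nat.add_le_add s₄ s₅)))) ?_
    omega
  · ext i c
    -- The output address skips the four top rows, `8 * R` cells, so output row `i` is stored row `4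
    -- + i`.
    have h : ∀ p : Fin 2, _ := e3.entry (4 + i.1) (by omega) c
    simp only [output, Matrix.of_apply]
    refine complex_eq_of_part ?_ ?_
    · rw [← h 0]
      refine congrArg _ ?_
      refine (congrArg (· + _) e3.out).trans ?_
      simp only [Fin.val_zero]
      ring
    · rw [← h 1]
      refine congrArg _ ?_
      refine (congrArg (· + _ + 1) e3.out).trans ?_
      simp only [Fin.val_one]
      ring

end RealRAM

/-! ### The theorem. -/

theorem theorem2 :
    ∃ (A : RealRAM.Prog) (P : Polynomial ℕ),
      ∀ (r : ℕ) (K : Fin r → Matrix (Fin 2) (Fin 2) ℂ), IsKraus K →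
      ∀ (s : ℝ) (u : Fin 2 → EuclideanSpace ℂ (Fin 2)), 0 ≤ s → s ≤ 1 → Orthonormal ℂ u →
        A.steps (RealRAM.input K s u) ≤ P.eval r ∧
        ∃ U : Matrix (Fin (max r 4)) (Fin (max r 4)) ℂ,
          U = RealRAM.output (max r 4) (A.run (RealRAM.input K s u)) ∧
          U ∈ Matrix.unitaryGroup (Fin (max r 4)) ℂ ∧
          ∀ (n : ℕ) (q : Fin n) (v : Fin 2 → EuclideanSpace ℂ (RestIdx q)) (ψ : QState n),
            Orthonormal ℂ v →
            ψ = (s : ℂ) • tensorAt q (u 0) (v 0)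
              + (Real.sqrt (1 - s ^ 2) : ℂ) • tensorAt q (u 1) (v 1) →
            IsLeast (ensembleAverages q (channelAt q K (ketbra ψ)))
              (unravelingEntropy q (mixKraus (le_max_left r 4) K U) ψ) ∧
            unravelingEntropy q (mixKraus (le_max_left r 4) K U) ψ
              = entOfFormation q (channelAt q K (ketbra ψ)) ∧
            ∀ (R : ℕ) (h : r ≤ R), ∀ U' ∈ Matrix.unitaryGroup (Fin R) ℂ,
              unravelingEntropy q (mixKraus (le_max_left r 4) K U) ψ
                ≤ unravelingEntropy q (mixKraus h K U') ψ := by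
  obtain ⟨A, T, hA⟩ := exists_optimal_program
  refine ⟨A, Polynomial.C T * (Polynomial.X + Polynomial.C 9) ^ 2, ?_⟩
  intro r K hK s u h0 h1 hu
  obtain ⟨hsteps, Z, V, hZ, hZ0, hV, hout⟩ := hA r K s u
  have h4 : 4 ≤ max r 4 := le_max_right r 4
  have hinj := Fin.castLE_injective h4
  have hVV : V * V.conjTranspose = 1 := mul_eq_one_comm.1 hV.1
  have hZ' := hZ.rowOp hinj hVV
  refine ⟨?_, _, rfl, ?_, ?_⟩
  · simp only [Polynomial.eval_mul, Polynomial.eval_C, Polynomial.eval_pow, Polynomial.eval_add,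
      Polynomial.eval_X]
    -- The constant 9 comes from `max r 4 + 5 ≤ r + 9`.
    refine hsteps.trans (Nat.mul_le_mul_left _ (Nat.pow_le_pow_left ?_ 2))
    omega
  · rw [hout]
    exact hZ'.unitary
  intro n q v ψ hv hψ
  rw [hout]
  have hop : ∀ l : Fin 4, ∀ c : Fin (max r 4), 4 ≤ c.1 → Fin.castLE h4 l ≠ c := by
    rintro l c hc rfl
    exact absurd l.2 (not_lt.2 hc)
  obtain ⟨hleast, hmem⟩ := isLeast_unravelingEntropy (le_max_left r 4) h4 hK h0 h1 hu hZ.unitary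
    hZ'.unitary (N := fun l => Matrix.of fun a b => Z (2 * a.1 + b.1) (Fin.castLE h4 l))
    (fun l => by
      ext a b
      exact hZ.mixKraus_apply _ _ a b)
    (fun c hc => by
      ext a b
      -- The row index `2a + b` is at most 3, so every column from 4 on lies to the right of the
      -- diagonal.
      exact (hZ.mixKraus_apply _ _ a b).trans (hZ0 _ (by omega) c (by omega)))
    hV
    (fun j => by
      ext a b
      refine (hZ'.mixKraus_apply _ _ a b).trans ((rowOp_apply hinj _ j).trans ?_)
      rw [Matrix.sum_apply]
      exact Finset.sum_congr rfl fun l _ => mul_comm _ _)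
    (fun c hc => by
      ext a b
      refine (hZ'.mixKraus_apply _ _ a b).trans ?_
      rw [rowOp_of_ne _ fun l => hop l c hc]
      exact hZ0 _ (by omega) c (by omega))
    hv hψ
  exact ⟨hleast, hleast.csInf_eq.symm, fun R h U' hU' => hleast.2 (hmem R h U' hU')⟩
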